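/- A 1-independent bond percolation model on a graph $G$ is a probability measure on the spanning subgraphs of $G$ (equivalently, on the configurations declaring each edge open or closed) such that, for any two sets of edges $S_1,S_2$ for which no edge of $S_1$ shares a vertex with an edge of $S_2$, the states of the edges in $S_1$ are independent of the states of the edges in $S_2$. Let $\mathcal D_{\ge p}(G)$ be the class of 1-independent bond percolation models on $G$ in which each edge is open with probability at least $p$. Let $\mathbb Z^2$ denote the square lattice graph, drawn in the plane in the usual way. In any model in $\mathcal D_{\ge 0.8457}(\mathbb Z^2)$ the following hold. (i) For every real $C>0$, the probability that there is an open path crossing the rectangle $[0,Cn]\times[0,n]$ from left to right tends to $1$ as $n\to\infty$ ($n\in\mathbb N$). Here a crossing path is a lattice path that starts at a vertex with first coordinate $0$, ends at a vertex with first coordinate at least $Cn$, and all of whose vertices $(x,y)$ satisfy $0\le x\le\lceil Cn\rceil$ and $0\le y\le n$. (ii) Almost surely, for every bounded set $B$ in the plane there is an open cycle enclosing $B$, that is, a cycle of open edges such that every point of $B$ lies off the closed curve drawn by the cycle and in a bounded connected component of the complement of that curve. (iii) Almost surely, the random subgraph formed by all vertices and the open edges has exactly one infinite connected component. -/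

import Mathlib

open MeasureTheory ProbabilityTheory Filter Topology

/-- A configuration on the edges of `G`: it tells which edges are open (`true`). Configurations
correspond to spanning subgraphs of `G`. They carry the product σ-algebra, and a bond percolation
model on `G` is a probability measure on `BondConfig G`. -/
abbrev BondConfig {V : Type*} (G : SimpleGraph V) : Type _ := G.edgeSet → Bool

/-- The spanning subgraph formed by the open edges of a configuration. -/
def openSubgraph {V : Type*} (G : SimpleGraph V) (ω : BondConfig G) : SimpleGraph V where
  Adj u v := ∃ h : s(u, v) ∈ G.edgeSet, ω ⟨s(u, v), h⟩ = true
  symm := ⟨fun u v h => by rwa [Sym2.eq_swap] at h⟩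
  loopless := ⟨fun _ h => G.irrefl h.1⟩

/-- 1-independence: for any two sets of edges such that no edge of the first shares a vertex with
an edge of the second, the states of the edges in the first set are independent of the states of
the edges in the second. -/
def IsOneIndependent {V : Type*} (G : SimpleGraph V) (μ : Measure (BondConfig G)) : Prop :=
  ∀ S₁ S₂ : Set G.edgeSet,
    (∀ e ∈ S₁, ∀ f ∈ S₂, ∀ v : V, v ∈ (e : Sym2 V) → v ∉ (f : Sym2 V)) →
    IndepFun (fun (ω : BondConfig G) (e : S₁) => ω e) (fun (ω : BondConfig G) (f : S₂) => ω f) μ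

/-- The class `𝒟_{≥ p}(G)` of 1-independent bond percolation models on `G` in which each edge is
open with probability at least `p`. -/
structure IsOneIndepModelGE {V : Type*} (G : SimpleGraph V) (p : ℝ)
    (μ : Measure (BondConfig G)) : Prop where
  isProbabilityMeasure : IsProbabilityMeasure μ
  isOneIndependent : IsOneIndependent G μ
  le_prob_open : ∀ e : G.edgeSet, p ≤ μ.real {ω | ω e = true}

/-- The square lattice `ℤ²`: vertices at Euclidean distance one are adjacent. -/
def squareLattice : SimpleGraph (ℤ × ℤ) where
  Adj u v := |u.1 - v.1| + |u.2 - v.2| = 1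
  symm := ⟨fun u v h => by rwa [abs_sub_comm v.1, abs_sub_comm v.2]⟩
  loopless := ⟨fun _ h => by simp at h⟩

/-- There is a path in `H` crossing the real rectangle `[0, a] × [0, b]` from left to right: it
starts on the left side, ends on or beyond the line `x = a`, and stays in the rectangle until it
reaches that line. If `a` is not an integer, the last vertex of a crossing path lies on the line
`x = ⌈a⌉`, just to the right of the rectangle, and the right side is crossed by an edge; this is
why abscissas less than `a + 1`, that is, at most `⌈a⌉`, are allowed. -/
def HasLeftRightCrossing (H : SimpleGraph (ℤ × ℤ)) (a b : ℝ) : Prop :=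
  ∃ (u v : ℤ × ℤ) (P : H.Walk u v), P.IsPath ∧ u.1 = 0 ∧ a ≤ (v.1 : ℝ) ∧
    ∀ w ∈ P.support, 0 ≤ w.1 ∧ (w.1 : ℝ) < a + 1 ∧ 0 ≤ w.2 ∧ (w.2 : ℝ) ≤ b

/-- The inclusion of `ℤ²` in the plane. -/
def toPlane (v : ℤ × ℤ) : ℝ × ℝ := ((v.1 : ℝ), (v.2 : ℝ))

/-- The polygonal curve in the plane drawn by a walk: the union of the segments that correspond to
its steps. -/
def walkTrace {H : SimpleGraph (ℤ × ℤ)} {u v : ℤ × ℤ} (P : H.Walk u v) : Set (ℝ × ℝ) :=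
  ⋃ d ∈ P.darts, segment ℝ (toPlane d.fst) (toPlane d.snd)

/-- A closed walk encloses a set `B` of points of the plane: no point of `B` lies on the curve, and
every point of `B` lies in a bounded connected component of the complement of the curve. -/
def Encloses {H : SimpleGraph (ℤ × ℤ)} {v : ℤ × ℤ} (c : H.Walk v v) (B : Set (ℝ × ℝ)) : Prop :=
  ∀ x ∈ B, x ∉ walkTrace c ∧ Bornology.IsBounded (connectedComponentIn (walkTrace c)ᶜ x)

/-! The proof renormalizes until closed edges are rare. Cut the lattice into 3 × 3 blocks and
represent a block by a vertex whose open component inside the block has at least five of the nine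
vertices, if there is one; two such components meet, so there is at most one. Declare the edge
between two adjacent blocks open if the representatives are joined by an open path inside the two
blocks. Its state depends only on edges inside these blocks, so coarse edges without common vertex
involve vertex-disjoint sets of fine edges, and the coarse model is again 1-independent
(`IsOneIndependent.map_blocks`, `isScale_coarsen`). Open coarse paths lift to open fine paths, and
the construction iterates (`IsScale.connIn`, `IsScale.comp`).

The point is to bound the probability that a coarse edge is closed when fine edges are closed with
probability at most q. Only a window of 27 edges matters, so this is a linear program, and it is
bounded by dual certificates. If every edge is closed with probability exactly q, then (1_{e closed}
- q) g has expectation zero for every g that depends only on edges sharing no vertex with e.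
Exactness costs nothing: closing further edges independently raises all probabilities to q,
preserves these identities, and can only disconnect the blocks. Hence a combination h of such
functions with 1_{bad} ≤ c + h pointwise proves P(bad) ≤ c (`integral_le_of_isBalanced`). Each term
sees one block, the three links between the blocks and the 3-bit boundary pattern of the other
block. This decouples the pointwise inequality over 2^27 configurations into checks over 2^15
configurations (`le_of_checkCertificate`), done by comparing all digits of large numbers at once.

Four certificates give the closing probabilities 0.1543, 0.143, 0.129, 0.107, 0.065. From there a
union bound over closed matchings gives 14q² + 7q³ (`integral_windowBad_le_of_small`), which
contracts, so the closing probabilities at the scales 81 · 3^k are summable (`closingBound_le`).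

The geometry then only uses boxes of fixed size at each scale, in which all coarse edges are open
with probability tending to 1 and, by Borel–Cantelli, almost surely at all but finitely many scales.
An open row of blocks crosses a rectangle. An open square of blocks contains a closed walk of
winding number one around its interior; such a walk contains an enclosing cycle, and it meets every
open path from inside to outside because lattice edges only cross at common endpoints. So each
infinite component meets all large rings, and consecutive rings are connected to each other. -/

/-! ### Finite dependence -/

/-- A function of a Boolean configuration that only depends on finitely many coordinates is
measurable. -/
theorem measurable_of_dependsOn_finite {ι β : Type*} [MeasurableSpace β] {s : Set ι}
    (hs : s.Finite) {f : (ι → Bool) → β} (hf : DependsOn f s) : Measurable f := by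
  classical
  have := hs.fintype
  obtain ⟨g, rfl⟩ : ∃ g : (s → Bool) → β, f = fun x => g (fun i => x i) := by
    refine ⟨fun y => f (fun i => if h : i ∈ s then y ⟨i, h⟩ else true), ?_⟩
    funext x
    apply hf
    intro i hi
    simp [hi]
  exact (measurable_of_finite g).comp (measurable_pi_lambda _ fun i => measurable_pi_apply _)

/-- Coordinates outside `S` may be filled in with an arbitrary value. The factorization through the
restriction to `S` is the form in which `IsOneIndependent` can be applied. -/
theorem DependsOn.exists_measurable_comp {ι β : Type*} [MeasurableSpace β] {S : Set ι}
    {F : (ι → Bool) → β} (hF : DependsOn F S) (hm : Measurable F) :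
    ∃ g : (S → Bool) → β, Measurable g ∧ F = g ∘ (fun (ω : ι → Bool) (e : S) => ω e) := by
  classical
  refine ⟨fun y => F (fun i => if h : i ∈ S then y ⟨i, h⟩ else true), ?_, ?_⟩
  · refine hm.comp (measurable_pi_lambda _ fun i => ?_)
    by_cases hi : i ∈ S
    · simpa [hi] using measurable_pi_apply (X := fun _ : S => Bool) (⟨i, hi⟩ : S)
    · simp [hi]
  · funext x
    apply hF
    intro i hi
    simp [hi]

/-- Two functions of the configuration that depend on vertex-disjoint sets of edges are
independent. -/
theorem IsOneIndependent.indepFun {V : Type*} {G : SimpleGraph V} {μ : Measure (BondConfig G)}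
    (h : IsOneIndependent G μ) {S₁ S₂ : Set G.edgeSet}
    (hd : ∀ e ∈ S₁, ∀ f ∈ S₂, ∀ v : V, v ∈ (e : Sym2 V) → v ∉ (f : Sym2 V))
    {β γ : Type*} [MeasurableSpace β] [MeasurableSpace γ]
    {F : BondConfig G → β} {F' : BondConfig G → γ}
    (hF : DependsOn F S₁) (hF' : DependsOn F' S₂) (hFm : Measurable F) (hFm' : Measurable F') :
    IndepFun F F' μ := by
  obtain ⟨g, hg, rfl⟩ := hF.exists_measurable_comp hFm
  obtain ⟨g', hg', rfl⟩ := hF'.exists_measurable_comp hFm'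
  exact (h S₁ S₂ hd).comp hg hg'

/-- The edges of `G` with both endpoints in `A`. -/
def edgesIn {V : Type*} (G : SimpleGraph V) (A : Set V) : Set G.edgeSet :=
  {e | ∀ v ∈ (e : Sym2 V), v ∈ A}

theorem edgesIn_mono {V : Type*} {G : SimpleGraph V} {A B : Set V} (h : A ⊆ B) :
    edgesIn G A ⊆ edgesIn G B := fun _ he v hv => h (he v hv)

theorem edgesIn_disjoint {V : Type*} {G : SimpleGraph V} {A B : Set V} (h : Disjoint A B) :
    ∀ e ∈ edgesIn G A, ∀ f ∈ edgesIn G B, ∀ v : V, v ∈ (e : Sym2 V) → v ∉ (f : Sym2 V) :=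
  fun _ he _ hf v hv hv' => Set.disjoint_left.1 h (he v hv) (hf v hv')

theorem edgesIn_finite {V : Type*} {G : SimpleGraph V} {A : Set V} (h : A.Finite) :
    (edgesIn G A).Finite := by
  have : (Set.range fun p : A × A => s((p.1 : V), (p.2 : V))).Finite := by
    have := h.to_subtype
    exact Set.finite_range _
  refine Set.Finite.of_finite_image (f := Subtype.val) (this.subset ?_) Subtype.val_injective.injOn
  rintro _ ⟨⟨e, he⟩, hA, rfl⟩
  induction e using Sym2.ind with
  | _ x y => exact ⟨(⟨x, hA x (by simp)⟩, ⟨y, hA y (by simp)⟩), rfl⟩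

/-- Renormalization: if the state of each coarse edge only depends on the fine edges inside the
union of the (pairwise disjoint, finite) blocks of its endpoints, then the coarse model is
1-independent. -/
theorem IsOneIndependent.map_blocks {V W : Type*} {G : SimpleGraph V} {K : SimpleGraph W}
    {μ : Measure (BondConfig G)} (h : IsOneIndependent G μ) (T : W → Set V)
    (hfin : ∀ w, (T w).Finite) (hT : ∀ v w, v ≠ w → Disjoint (T v) (T w))
    (Φ : BondConfig G → BondConfig K)
    (hΦ : ∀ e : K.edgeSet, DependsOn (fun ω => Φ ω e) (edgesIn G (⋃ w ∈ (e : Sym2 W), T w))) :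
    Measurable Φ ∧ IsOneIndependent K (μ.map Φ) := by
  have hm : Measurable Φ := by
    refine measurable_pi_lambda _ fun e => measurable_of_dependsOn_finite (edgesIn_finite ?_) (hΦ e)
    refine Set.Finite.biUnion ?_ fun w _ => hfin w
    rcases e with ⟨e, he⟩
    induction e using Sym2.ind with
    | _ x y => exact ((Set.finite_singleton y).insert x).subset (fun z hz => by simpa using hz)
  refine ⟨hm, fun S₁ S₂ hd => ?_⟩
  have hr : ∀ S : Set K.edgeSet, Measurable (fun (ω : BondConfig K) (e : S) => ω e) := fun S =>
    measurable_pi_lambda _ fun e => measurable_pi_apply _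
  rw [indepFun_iff_measure_inter_preimage_eq_mul]
  intro s t hs ht
  rw [Measure.map_apply hm ((hr S₁ hs).inter (hr S₂ ht)), Measure.map_apply hm (hr S₁ hs),
    Measure.map_apply hm (hr S₂ ht)]
  have hdep : ∀ S : Set K.edgeSet, DependsOn ((fun (ω : BondConfig K) (e : S) => ω e) ∘ Φ)
      (edgesIn G (⋃ e ∈ S, ⋃ w ∈ (e : Sym2 W), T w)) := by
    intro S x y hxy
    funext e
    exact hΦ e (fun i hi => hxy i (edgesIn_mono (fun v hv => Set.mem_biUnion e.2 hv) hi))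
  have := h.indepFun (edgesIn_disjoint ?_) (hdep S₁) (hdep S₂) ((hr S₁).comp hm) ((hr S₂).comp hm)
  · exact (indepFun_iff_measure_inter_preimage_eq_mul.1 this) s t hs ht
  · rw [Set.disjoint_left]
    intro v hv hv'
    simp only [Set.mem_iUnion] at hv hv'
    obtain ⟨e, he, w, hw, hvw⟩ := hv
    obtain ⟨e', he', w', hw', hvw'⟩ := hv'
    -- A fine vertex lies in at most one block, so a fine vertex common to both families would force
    -- a coarse vertex common to `S₁` and `S₂`.
    have hne : w ≠ w' := by
      rintro rfl
      exact hd e he e' he' w hw hw'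
    exact Set.disjoint_left.1 (hT w w' hne) hvw hvw'

theorem indepFun_measureReal {Ω β γ : Type*} [MeasurableSpace Ω] [MeasurableSpace β]
    [MeasurableSpace γ] {μ : Measure Ω} {F : Ω → β} {F' : Ω → γ} (h : IndepFun F F' μ)
    {s : Set β} {t : Set γ} (hs : MeasurableSet s) (ht : MeasurableSet t) :
    μ.real (F ⁻¹' s ∩ F' ⁻¹' t) = μ.real (F ⁻¹' s) * μ.real (F' ⁻¹' t) := by
  simp only [Measure.real, h.measure_inter_preimage_eq_mul s t hs ht, ENNReal.toReal_mul]

/-- The probability that all edges of a matching are closed. -/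
theorem IsOneIndependent.prob_matching_closed {V : Type*} {G : SimpleGraph V}
    {μ : Measure (BondConfig G)} [IsProbabilityMeasure μ] (h : IsOneIndependent G μ) {q : ℝ}
    (hq : ∀ e, μ.real {ω | ω e = false} ≤ q) (M : List G.edgeSet)
    (hM : M.Pairwise fun e f : G.edgeSet => ∀ v : V, v ∈ (e : Sym2 V) → v ∉ (f : Sym2 V)) :
    μ.real {ω | ∀ e ∈ M, ω e = false} ≤ q ^ M.length := by
  induction M with
  | nil => simp
  | cons e M ih =>
    rw [List.pairwise_cons] at hM
    have hind : IndepFun (fun ω : BondConfig G => ω e) (fun ω (f : {f // f ∈ M}) => ω f) μ := by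
      refine h.indepFun (S₁ := {e}) (S₂ := {f | f ∈ M}) ?_ ?_ ?_ ?_ ?_
      · rintro e' rfl f hf v
        exact hM.1 f hf v
      · intro x y hxy
        exact hxy e rfl
      · intro x y hxy
        funext f
        exact hxy f f.2
      · exact measurable_pi_apply e
      · exact measurable_pi_lambda _ fun f => measurable_pi_apply _
    have : Finite {f // f ∈ M} := M.finite_toSet.to_subtype
    have := indepFun_measureReal hind (s := {false}) (t := {fun _ => false})
      (measurableSet_singleton _) (measurableSet_singleton _)
    have h1 : {ω : BondConfig G | ∀ f ∈ e :: M, ω f = false} =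
        (fun ω : BondConfig G => ω e) ⁻¹' {false} ∩
          (fun ω (f : {f // f ∈ M}) => ω f) ⁻¹' {fun _ => false} := by
      ext ω
      simp [funext_iff]
    have h2 : {ω : BondConfig G | ∀ f ∈ M, ω f = false} =
          (fun ω (f : {f // f ∈ M}) => ω f) ⁻¹' {fun _ => false} := by
      ext ω
      simp [funext_iff]
    rw [h1, this, ← h2, List.length_cons, pow_succ, mul_comm]
    exact mul_le_mul (ih hM.2) (hq e) measureReal_nonneg
      (measureReal_nonneg.trans (ih hM.2))

/-! ### Connections inside a set -/

/-- `u` and `v` are joined by an open path that stays inside `A`. -/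
def ConnIn {V : Type*} (H : SimpleGraph V) (A : Set V) (u v : V) : Prop :=
  ∃ p : H.Walk u v, ∀ w ∈ p.support, w ∈ A

namespace ConnIn

variable {V : Type*} {H : SimpleGraph V} {A B : Set V} {u v w : V}

theorem refl (h : u ∈ A) : ConnIn H A u u := ⟨.nil, by simpa using h⟩

theorem mem_left (h : ConnIn H A u v) : u ∈ A := h.elim fun p hp => hp _ p.start_mem_support

theorem mem_right (h : ConnIn H A u v) : v ∈ A := h.elim fun p hp => hp _ p.end_mem_support

theorem symm (h : ConnIn H A u v) : ConnIn H A v u :=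
  h.elim fun p hp => ⟨p.reverse, by simpa using hp⟩

theorem trans (h : ConnIn H A u v) (h' : ConnIn H A v w) : ConnIn H A u w :=
  h.elim fun p hp => h'.elim fun p' hp' => ⟨p.append p', fun x hx => by
    rcases (SimpleGraph.Walk.mem_support_append_iff _ _).1 hx with hx | hx
    exacts [hp x hx, hp' x hx]⟩

theorem mono (h : ConnIn H A u v) (hAB : A ⊆ B) : ConnIn H B u v :=
  h.elim fun p hp => ⟨p, fun x hx => hAB (hp x hx)⟩

theorem of_adj (h : H.Adj u v) (hu : u ∈ A) (hv : v ∈ A) : ConnIn H A u v :=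
  ⟨h.toWalk, by simp [hu, hv]⟩

theorem mono_graph {H' : SimpleGraph V} (h : ConnIn H A u v)
    (hH : ∀ x ∈ A, ∀ y ∈ A, H.Adj x y → H'.Adj x y) : ConnIn H' A u v := by
  obtain ⟨p, hp⟩ := h
  induction p with
  | nil => exact refl (hp _ (by simp))
  | cons hadj p ih =>
    simp only [SimpleGraph.Walk.support_cons, List.mem_cons, forall_eq_or_imp] at hp
    exact (of_adj (hH _ hp.1 _ (hp.2 _ p.start_mem_support) hadj) hp.1
      (hp.2 _ p.start_mem_support)).trans (ih hp.2)

end ConnIn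

/-- Connections inside `A` only depend on the edges with both endpoints in `A`. -/
theorem dependsOn_connIn {V : Type*} {G : SimpleGraph V} (A : Set V) (u v : V) :
    DependsOn (fun ω : BondConfig G => ConnIn (openSubgraph G ω) A u v) (edgesIn G A) := by
  have key : ∀ ω ω' : BondConfig G, (∀ e ∈ edgesIn G A, ω e = ω' e) →
      ConnIn (openSubgraph G ω) A u v → ConnIn (openSubgraph G ω') A u v := by
    intro ω ω' h hc
    refine hc.mono_graph ?_
    rintro x hx y hy ⟨hxy, ho⟩
    refine ⟨hxy, (h _ ?_).symm.trans ho⟩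
    intro z hz
    rcases Sym2.mem_iff.1 hz with rfl | rfl <;> assumption
  exact fun ω ω' h => propext ⟨key ω ω' h, key ω' ω fun e he => (h e he).symm⟩

/-! ### Blocks and scales -/

/-- The `L × L` block with index `v`. -/
def block (L : ℕ) (v : ℤ × ℤ) : Set (ℤ × ℤ) :=
  {w | w.1 / (L : ℤ) = v.1 ∧ w.2 / (L : ℤ) = v.2}

theorem block_disjoint (L : ℕ) {v w : ℤ × ℤ} (h : v ≠ w) : Disjoint (block L v) (block L w) := by
  rw [Set.disjoint_left]
  rintro x ⟨h1, h2⟩ ⟨h3, h4⟩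
  exact h (Prod.ext (h1.symm.trans h3) (h2.symm.trans h4))

theorem mem_block_iff {L : ℕ} (hL : 0 < L) {v w : ℤ × ℤ} :
    w ∈ block L v ↔ (L * v.1 ≤ w.1 ∧ w.1 < L * v.1 + L) ∧ L * v.2 ≤ w.2 ∧ w.2 < L * v.2 + L := by
  have hL' : (0 : ℤ) < L := by exact_mod_cast hL
  simp only [block, Set.mem_ofPred_eq]
  rw [Int.ediv_eq_iff_of_pos hL', Int.ediv_eq_iff_of_pos hL']
  constructor <;> rintro ⟨⟨_, _⟩, _, _⟩ <;> refine ⟨⟨?_, ?_⟩, ?_, ?_⟩ <;> nlinarith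

theorem block_finite {L : ℕ} (hL : 0 < L) (v : ℤ × ℤ) : (block L v).Finite := by
  refine ((Set.finite_Ico (L * v.1 : ℤ) (L * v.1 + L)).prod
    (Set.finite_Ico (L * v.2 : ℤ) (L * v.2 + L))).subset fun w hw => ?_
  have := (mem_block_iff hL).1 hw
  exact ⟨this.1, this.2⟩

theorem block_mul {L N : ℕ} {v w : ℤ × ℤ} :
    w ∈ block (L * N) v ↔ (w.1 / (L : ℤ), w.2 / (L : ℤ)) ∈ block N v := by
  simp only [block, Set.mem_ofPred_eq, Nat.cast_mul]
  rw [Int.ediv_ediv_of_nonneg (by positivity), Int.ediv_ediv_of_nonneg (by positivity)]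

/-- The random configuration `ω` can be viewed, at scale `L`, as a 1-independent model on the
lattice of `L × L` blocks, whose edges are closed with probability at most `q`: every block has a
representative, and an open coarse edge joins the representatives of two blocks inside their
union. -/
structure IsScale (μ : Measure (BondConfig squareLattice)) (L : ℕ) (q : ℝ)
    (Φ : BondConfig squareLattice → BondConfig squareLattice)
    (R : BondConfig squareLattice → ℤ × ℤ → ℤ × ℤ) : Prop where
  pos : 0 < L
  measurable : Measurable Φ
  model : IsOneIndepModelGE squareLattice (1 - q) (μ.map Φ)
  mem_block : ∀ ω v, R ω v ∈ block L v
  conn : ∀ ω v w, (openSubgraph squareLattice (Φ ω)).Adj v w →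
    ConnIn (openSubgraph squareLattice ω) (block L v ∪ block L w) (R ω v) (R ω w)

theorem IsScale.refl {μ : Measure (BondConfig squareLattice)} {q : ℝ}
    (h : IsOneIndepModelGE squareLattice (1 - q) μ) : IsScale μ 1 q id fun _ v => v where
  pos := one_pos
  measurable := measurable_id
  model := by simpa using h
  mem_block := fun _ v => by simp [block]
  conn := fun _ v w hvw => ConnIn.of_adj hvw (.inl (by simp [block])) (.inr (by simp [block]))

/-- Connections at scale `L` lift to connections of the underlying configuration. -/
theorem IsScale.connIn {μ : Measure (BondConfig squareLattice)} {L : ℕ} {q : ℝ}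
    {Φ : BondConfig squareLattice → BondConfig squareLattice}
    {R : BondConfig squareLattice → ℤ × ℤ → ℤ × ℤ} (h : IsScale μ L q Φ R)
    {ω : BondConfig squareLattice} {A : Set (ℤ × ℤ)} {v w : ℤ × ℤ}
    (hc : ConnIn (openSubgraph squareLattice (Φ ω)) A v w) :
    ConnIn (openSubgraph squareLattice ω) (⋃ a ∈ A, block L a) (R ω v) (R ω w) := by
  obtain ⟨p, hp⟩ := hc
  induction p with
  | nil => exact .refl (Set.mem_biUnion (hp _ (by simp)) (h.mem_block _ _))
  | cons hadj p ih =>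
    simp only [SimpleGraph.Walk.support_cons, List.mem_cons, forall_eq_or_imp] at hp
    refine ((h.conn _ _ _ hadj).mono ?_).trans (ih hp.2)
    exact Set.union_subset (Set.subset_biUnion_of_mem (u := block L) hp.1)
      (Set.subset_biUnion_of_mem (u := block L) (hp.2 _ p.start_mem_support))

/-- Blocks of side `L * N` are unions of blocks of side `L`, so a coarse path at the second scale
lifts to the fine lattice without leaving the two large blocks. The representative of a large block
is the fine representative of the small block chosen in it. -/
theorem IsScale.comp {μ : Measure (BondConfig squareLattice)} {L N : ℕ} {q q' : ℝ}
    {Φ Ψ : BondConfig squareLattice → BondConfig squareLattice}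
    {R Q : BondConfig squareLattice → ℤ × ℤ → ℤ × ℤ} (h : IsScale μ L q Φ R)
    (h' : IsScale (μ.map Φ) N q' Ψ Q) :
    IsScale μ (L * N) q' (Ψ ∘ Φ) fun ω v => R ω (Q (Φ ω) v) where
  pos := Nat.mul_pos h.pos h'.pos
  measurable := h'.measurable.comp h.measurable
  model := by
    rw [← Measure.map_map h'.measurable h.measurable]
    exact h'.model
  mem_block := fun ω v => by
    rw [block_mul]
    have h1 := h.mem_block ω (Q (Φ ω) v)
    have h2 := h'.mem_block (Φ ω) v
    simp only [block, Set.mem_ofPred_eq] at h1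
    rwa [h1.1, h1.2]
  conn := fun ω v w hvw => by
    refine (h.connIn (h'.conn (Φ ω) v w hvw)).mono ?_
    intro x hx
    simp only [Set.mem_iUnion] at hx
    obtain ⟨a, ha, hxa⟩ := hx
    have hxa' : (x.1 / (L : ℤ), x.2 / (L : ℤ)) = a := Prod.ext hxa.1 hxa.2
    rcases ha with ha | ha
    · exact .inl (block_mul.2 (by rwa [hxa']))
    · exact .inr (block_mul.2 (by rwa [hxa']))

open scoped Classical in
/-- The coarse configuration associated with a choice of representatives `R` of the blocks: a
coarse edge is open if the two representatives are joined inside the union of the two blocks. -/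
noncomputable def coarsen (N : ℕ) (R : BondConfig squareLattice → ℤ × ℤ → ℤ × ℤ)
    (ω : BondConfig squareLattice) : BondConfig squareLattice := fun e =>
  decide (∃ v w, (e : Sym2 (ℤ × ℤ)) = s(v, w) ∧
    ConnIn (openSubgraph squareLattice ω) (block N v ∪ block N w) (R ω v) (R ω w))

theorem coarsen_eq_true_iff {N : ℕ} {R : BondConfig squareLattice → ℤ × ℤ → ℤ × ℤ}
    {ω : BondConfig squareLattice} {v w : ℤ × ℤ} (h : s(v, w) ∈ squareLattice.edgeSet) :
    coarsen N R ω ⟨s(v, w), h⟩ = true ↔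
      ConnIn (openSubgraph squareLattice ω) (block N v ∪ block N w) (R ω v) (R ω w) := by
  simp only [coarsen, decide_eq_true_eq]
  constructor
  · rintro ⟨v', w', he, hc⟩
    rcases Sym2.eq_iff.1 he with ⟨rfl, rfl⟩ | ⟨rfl, rfl⟩
    · exact hc
    · rw [Set.union_comm]
      exact hc.symm
  · exact fun hc => ⟨v, w, rfl, hc⟩

/-- Each representative is a function of the edges in its own block, so a coarse edge is decided by
the edges inside its two blocks and `IsOneIndependent.map_blocks` applies. Any local choice of
representatives is allowed; only the bound `q'` depends on its quality. -/
theorem isScale_coarsen {ν : Measure (BondConfig squareLattice)} {q q' : ℝ}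
    (hν : IsOneIndepModelGE squareLattice (1 - q) ν) {N : ℕ} (hN : 0 < N)
    {R : BondConfig squareLattice → ℤ × ℤ → ℤ × ℤ} (hR : ∀ ω v, R ω v ∈ block N v)
    (hdep : ∀ v, DependsOn (fun ω => R ω v) (edgesIn squareLattice (block N v)))
    (hq : ∀ v w, squareLattice.Adj v w → ν.real {ω | ¬ ConnIn (openSubgraph squareLattice ω)
      (block N v ∪ block N w) (R ω v) (R ω w)} ≤ q') :
    IsScale ν N q' (coarsen N R) R := by
  have := hν.isProbabilityMeasure
  have hU : ∀ v w : ℤ × ℤ, (⋃ x ∈ s(v, w), block N x) = block N v ∪ block N w := by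
    intro v w
    ext x
    simp
  have hmap := hν.isOneIndependent.map_blocks (block N) (block_finite hN)
    (fun v w => block_disjoint N) (coarsen N R) (by
      rintro ⟨e, he⟩
      induction e using Sym2.ind with
      | _ v w =>
      intro ω ω' h
      simp only [hU] at h
      rw [Bool.eq_iff_iff, coarsen_eq_true_iff he, coarsen_eq_true_iff he]
      have h1 : R ω v = R ω' v := hdep v fun e he' => h e (edgesIn_mono Set.subset_union_left he')
      have h2 : R ω w = R ω' w := hdep w fun e he' => h e (edgesIn_mono Set.subset_union_right he')
      rw [h1, h2]
      exact iff_of_eq (dependsOn_connIn (block N v ∪ block N w) (R ω' v) (R ω' w) h))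
  refine ⟨hN, hmap.1, ⟨Measure.isProbabilityMeasure_map hmap.1.aemeasurable, hmap.2, ?_⟩, hR, ?_⟩
  · rintro ⟨e, he⟩
    induction e using Sym2.ind with
    | _ v w =>
    have hms : MeasurableSet {ω : BondConfig squareLattice | ω ⟨s(v, w), he⟩ = true} :=
      measurable_pi_apply (X := fun _ : squareLattice.edgeSet => Bool) (⟨s(v, w), he⟩)
        (measurableSet_singleton true)
    rw [map_measureReal_apply hmap.1 hms]
    have hc := hq v w he
    have hms' : MeasurableSet (coarsen N R ⁻¹' {ω | ω ⟨s(v, w), he⟩ = true}) := hmap.1 hms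
    have heq : {ω | ¬ ConnIn (openSubgraph squareLattice ω) (block N v ∪ block N w) (R ω v) (R ω w)}
        = (coarsen N R ⁻¹' {ω | ω ⟨s(v, w), he⟩ = true})ᶜ := by
      ext ω
      exact (coarsen_eq_true_iff he).not.symm
    rw [heq, probReal_compl_eq_one_sub hms'] at hc
    linarith
  · rintro ω v w ⟨h, ho⟩
    exact (coarsen_eq_true_iff h).1 ho

/-! ### Winding numbers of lattice walks -/

/-- The point of the complex plane with the given coordinates. -/
noncomputable def cpx (z : ℝ × ℝ) : ℂ := Complex.equivRealProdCLM.symm z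

theorem cpx_re (z : ℝ × ℝ) : (cpx z).re = z.1 := by simp [cpx]
theorem cpx_im (z : ℝ × ℝ) : (cpx z).im = z.2 := by simp [cpx]

theorem continuous_cpx : Continuous cpx := Complex.equivRealProdCLM.symm.continuous

/-- The ratio whose argument is the angle under which the segment `[a, b]` is seen from `x`. -/
noncomputable def seenRatio (a b x : ℝ × ℝ) : ℂ := (cpx b - cpx x) / (cpx a - cpx x)

/-- A ratio `-t` with `t ≥ 0` means `b - x = -t (a - x)`, that is, `x = (t a + b) / (1 + t)`, a
point of the segment. Off the segment the principal logarithm is therefore continuous and measures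
the angle swept along the edge. -/
theorem seenRatio_mem_slitPlane {a b x : ℝ × ℝ} (hx : x ∉ segment ℝ a b) :
    seenRatio a b x ∈ Complex.slitPlane := by
  by_contra h
  have hax : cpx a - cpx x ≠ 0 := by
    rw [sub_ne_zero]
    intro he
    exact hx ((Complex.equivRealProdCLM.symm.injective he) ▸ left_mem_segment ℝ a b)
  rw [Complex.mem_slitPlane_iff, not_or, not_lt, not_not] at h
  set t : ℝ := -(seenRatio a b x).re with ht
  have ht0 : 0 ≤ t := by linarith [h.1]
  have he : seenRatio a b x = ((-t : ℝ) : ℂ) := Complex.ext (by simp [ht]) (by simp [h.2])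
  rw [seenRatio, div_eq_iff hax] at he
  have hre := congrArg Complex.re he
  have him := congrArg Complex.im he
  simp only [Complex.sub_re, Complex.sub_im, Complex.mul_re, Complex.mul_im, Complex.ofReal_re,
    Complex.ofReal_im, cpx_re, cpx_im, zero_mul, sub_zero, add_zero] at hre him
  have ht1 : (1 + t) ≠ 0 := by positivity
  refine hx ⟨t / (1 + t), 1 / (1 + t), by positivity, by positivity, by field_simp; ring, ?_⟩
  ext
  · simp only [Prod.fst_add, Prod.smul_fst, smul_eq_mul]
    field_simp
    linarith
  · simp only [Prod.snd_add, Prod.smul_snd, smul_eq_mul]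
    field_simp
    linarith

section
variable {H : SimpleGraph (ℤ × ℤ)}

/-- The total angle swept by a walk, seen from `x`. -/
noncomputable def sweptAngle {u v : ℤ × ℤ} (p : H.Walk u v) (x : ℝ × ℝ) : ℝ :=
  (p.darts.map fun d => (Complex.log (seenRatio (toPlane d.fst) (toPlane d.snd) x)).im).sum

@[simp] theorem sweptAngle_nil {u : ℤ × ℤ} (x : ℝ × ℝ) :
    sweptAngle (.nil : H.Walk u u) x = 0 := by simp [sweptAngle]

@[simp] theorem sweptAngle_cons {u v w : ℤ × ℤ} (h : H.Adj u v) (p : H.Walk v w) (x : ℝ × ℝ) :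
    sweptAngle (.cons h p) x =
      (Complex.log (seenRatio (toPlane u) (toPlane v) x)).im + sweptAngle p x := by
  simp [sweptAngle]

theorem sweptAngle_append {u v w : ℤ × ℤ} (p : H.Walk u v) (p' : H.Walk v w) (x : ℝ × ℝ) :
    sweptAngle (p.append p') x = sweptAngle p x + sweptAngle p' x := by
  simp [sweptAngle, SimpleGraph.Walk.darts_append]

theorem notMem_walkTrace {u v : ℤ × ℤ} {p : H.Walk u v} {x : ℝ × ℝ} :
    x ∉ walkTrace p ↔ ∀ d ∈ p.darts, x ∉ segment ℝ (toPlane d.fst) (toPlane d.snd) := by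
  simp [walkTrace]

theorem walkTrace_subset_of_darts {u v u' v' : ℤ × ℤ} {p : H.Walk u v} {p' : H.Walk u' v'}
    (h : p.darts ⊆ p'.darts) : walkTrace p ⊆ walkTrace p' :=
  Set.biUnion_subset_biUnion_left h

theorem isCompact_walkTrace {u v : ℤ × ℤ} (p : H.Walk u v) : IsCompact (walkTrace p) := by
  refine (List.finite_toSet p.darts).isCompact_biUnion fun d _ => ?_
  rw [segment_eq_image_lineMap]
  exact isCompact_Icc.image (by fun_prop)

theorem continuousOn_sweptAngle {u v : ℤ × ℤ} (p : H.Walk u v) :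
    ContinuousOn (sweptAngle p) (walkTrace p)ᶜ := by
  intro x hx
  refine ContinuousAt.continuousWithinAt ?_
  have hx' := notMem_walkTrace.1 hx
  unfold sweptAngle
  generalize p.darts = l at hx'
  induction l with
  | nil => simpa using continuousAt_const
  | cons d l ih =>
    simp only [List.mem_cons, forall_eq_or_imp] at hx'
    simp only [List.map_cons, List.sum_cons]
    refine ContinuousAt.add ?_ (ih hx'.2)
    refine Complex.continuous_im.continuousAt.comp (ContinuousAt.clog ?_
      (seenRatio_mem_slitPlane hx'.1))
    refine ContinuousAt.div (by have := continuous_cpx; fun_prop)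
      (by have := continuous_cpx; fun_prop) ?_
    rw [sub_ne_zero]
    intro he
    exact hx'.1 ((Complex.equivRealProdCLM.symm.injective he) ▸ left_mem_segment ℝ _ _)

theorem seenRatio_trans {a b c x : ℝ × ℝ} (hb : b ≠ x) :
    seenRatio a b x * seenRatio b c x = seenRatio a c x := by
  have : cpx b - cpx x ≠ 0 := by
    rw [sub_ne_zero]
    exact fun he => hb (Complex.equivRealProdCLM.symm.injective he)
  unfold seenRatio
  field_simp

theorem toPlane_ne_of_notMem {u v w : ℤ × ℤ} {h : H.Adj u v} {p : H.Walk v w} {x : ℝ × ℝ}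
    (hx : x ∉ walkTrace (.cons h p)) : toPlane v ≠ x := by
  rintro rfl
  exact notMem_walkTrace.1 hx ⟨(u, v), h⟩ (by simp) (right_mem_segment ℝ _ _)

theorem notMem_walkTrace_of_cons {u v w : ℤ × ℤ} {h : H.Adj u v} {p : H.Walk v w} {x : ℝ × ℝ}
    (hx : x ∉ walkTrace (.cons h p)) : x ∉ walkTrace p :=
  notMem_walkTrace.2 fun d hd => notMem_walkTrace.1 hx d (by simp [hd])

/-- The ratios of consecutive edges telescope by `seenRatio_trans`. The sum of the imaginary parts
of their logarithms is the swept angle, and `r` absorbs the moduli. -/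
theorem exists_exp_sweptAngle {u v : ℤ × ℤ} (p : H.Walk u v) {x : ℝ × ℝ} (hx : x ∉ walkTrace p)
    (hu : toPlane u ≠ x) : ∃ r : ℝ, Complex.exp (r + sweptAngle p x * Complex.I) =
      seenRatio (toPlane u) (toPlane v) x := by
  induction p with
  | @nil u =>
    refine ⟨0, ?_⟩
    have : cpx (toPlane u) - cpx x ≠ 0 := by
      rw [sub_ne_zero]
      exact fun he => hu (Complex.equivRealProdCLM.symm.injective he)
    simp [seenRatio, this]
  | @cons u v w h p ih =>
    have hv := toPlane_ne_of_notMem hx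
    obtain ⟨r, hr⟩ := ih (notMem_walkTrace_of_cons hx) hv
    have hs := seenRatio_mem_slitPlane (notMem_walkTrace.1 hx ⟨(u, v), h⟩ (by simp))
    refine ⟨(Complex.log (seenRatio (toPlane u) (toPlane v) x)).re + r, ?_⟩
    rw [← seenRatio_trans (a := toPlane u) (c := toPlane w) hv, ← hr]
    nth_rw 2 [← Complex.exp_log (Complex.slitPlane_ne_zero hs)]
    rw [← Complex.exp_add]
    congr 1
    apply Complex.ext <;> simp

/-- For a closed walk the telescoped ratio is 1, so the swept angle is the imaginary part of a
logarithm of 1. -/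
theorem sweptAngle_mem_zmultiples {u : ℤ × ℤ} (c : H.Walk u u) {x : ℝ × ℝ}
    (hx : x ∉ walkTrace c) : sweptAngle c x ∈ AddSubgroup.zmultiples (2 * Real.pi) := by
  by_cases hu : toPlane u = x
  -- The trivial walk has empty trace, so `x` may coincide with its vertex; every other walk
  -- contains its starting point in its trace.
  · cases c with
    | nil => simp
    | cons h p =>
      subst hu
      exact absurd (left_mem_segment ℝ _ _) (notMem_walkTrace.1 hx ⟨(_, _), h⟩ (by simp))
  obtain ⟨r, hr⟩ := exists_exp_sweptAngle c hx hu
  have h1 : seenRatio (toPlane u) (toPlane u) x = 1 := by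
    refine div_self ?_
    rw [sub_ne_zero]
    exact fun he => hu (Complex.equivRealProdCLM.symm.injective he)
  rw [h1, Complex.exp_eq_one_iff] at hr
  obtain ⟨n, hn⟩ := hr
  have := congrArg Complex.im hn
  simp at this
  exact AddSubgroup.mem_zmultiples_iff.2 ⟨n, by simp [this]⟩

/-- The winding number of a closed walk is constant on connected sets that avoid its trace. -/
theorem sweptAngle_eq_of_isPreconnected {u : ℤ × ℤ} (c : H.Walk u u) {S : Set (ℝ × ℝ)}
    (hS : IsPreconnected S) (hSc : S ⊆ (walkTrace c)ᶜ) {x y : ℝ × ℝ} (hx : x ∈ S) (hy : y ∈ S) :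
    sweptAngle c x = sweptAngle c y :=
  hS.constant_of_mapsTo (T := (AddSubgroup.zmultiples (2 * Real.pi) : Set ℝ))
    (isDiscrete_iff_discreteTopology.2
      (inferInstanceAs (DiscreteTopology (AddSubgroup.zmultiples (2 * Real.pi)))))
    ((continuousOn_sweptAngle c).mono hSc) (fun _ hz => sweptAngle_mem_zmultiples c (hSc hz)) hx hy

/-- The ratio equals `1 + (b - a) / (a - x)`. -/
theorem tendsto_seenRatio (a b : ℝ × ℝ) :
    Tendsto (seenRatio a b) (Bornology.cobounded _) (𝓝 1) := by
  have h2 : Tendsto cpx (Bornology.cobounded _) (Bornology.cobounded ℂ) :=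
    Complex.equivRealProdCLM.symm.antilipschitz.tendsto_cobounded
  have h1 : Tendsto (fun x => cpx a - cpx x) (Bornology.cobounded _) (Bornology.cobounded ℂ) := by
    rw [← tendsto_norm_atTop_iff_cobounded] at h2 ⊢
    refine tendsto_atTop_mono (fun x => ?_) (tendsto_atTop_add_const_right _ (-‖cpx a‖) h2)
    linarith [norm_sub_norm_le (cpx x) (cpx a), norm_sub_rev (cpx x) (cpx a)]
  have h3 := ((tendsto_inv₀_cobounded (α := ℂ)).comp h1).const_mul (cpx b - cpx a)
  have h4 := h3.const_add 1
  rw [mul_zero, add_zero] at h4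
  refine h4.congr' ?_
  filter_upwards [(tendsto_norm_atTop_iff_cobounded.2 h1).eventually_gt_atTop 0] with x hx
  have : cpx a - cpx x ≠ 0 := norm_pos_iff.1 hx
  simp only [Function.comp_apply, seenRatio]
  field_simp
  ring

/-- Far away, the winding number vanishes. -/
theorem eventually_sweptAngle_eq_zero {u : ℤ × ℤ} (c : H.Walk u u) :
    ∀ᶠ x in Bornology.cobounded (ℝ × ℝ), x ∉ walkTrace c ∧ sweptAngle c x = 0 := by
  have h1 : ∀ᶠ x in Bornology.cobounded (ℝ × ℝ), x ∉ walkTrace c :=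
    Bornology.isBounded_def.1 (isCompact_walkTrace c).isBounded
  have h2 : Tendsto (sweptAngle c) (Bornology.cobounded (ℝ × ℝ)) (𝓝 0) := by
    unfold sweptAngle
    generalize c.darts = l
    induction l with
    | nil => simp
    | cons d l ih =>
      simp only [List.map_cons, List.sum_cons]
      have h3 : Tendsto (fun x => (Complex.log (seenRatio (toPlane d.fst) (toPlane d.snd) x)).im)
          (Bornology.cobounded (ℝ × ℝ)) (𝓝 0) := by
        have := (Complex.continuous_im.tendsto _).comp
          ((tendsto_seenRatio (toPlane d.fst) (toPlane d.snd)).clog (by simp))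
        simpa [Function.comp_def] using this
      simpa using h3.add ih
  have h3 : ∀ᶠ x in Bornology.cobounded (ℝ × ℝ), |sweptAngle c x| < 1 := by
    have := h2.abs
    rw [abs_zero] at this
    exact this.eventually_lt_const one_pos
  filter_upwards [h1, h3] with x hx hx'
  refine ⟨hx, ?_⟩
  -- Far away the swept angle is a multiple of 2π of absolute value less than 1, hence zero.
  obtain ⟨n, hn⟩ := AddSubgroup.mem_zmultiples_iff.1 (sweptAngle_mem_zmultiples c hx)
  rw [← hn, zsmul_eq_mul] at hx' ⊢
  rcases eq_or_ne n 0 with rfl | hn0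
  · simp
  exfalso
  rw [abs_mul, abs_of_pos Real.two_pi_pos] at hx'
  have : (1 : ℝ) ≤ |(n : ℝ)| := by exact_mod_cast Int.one_le_abs hn0
  nlinarith [Real.pi_gt_three]

/-- Points with nonzero winding number are enclosed. -/
theorem encloses_of_sweptAngle_ne_zero {u : ℤ × ℤ} (c : H.Walk u u) {B : Set (ℝ × ℝ)}
    (h : ∀ x ∈ B, x ∉ walkTrace c ∧ sweptAngle c x ≠ 0) : Encloses c B := by
  intro x hx
  refine ⟨(h x hx).1, ?_⟩
  -- The winding number is constant on the component of `x` and nonzero there, whereas it vanishes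
  -- far away, so the component contains no far point.
  refine Bornology.isBounded_def.2 ?_
  filter_upwards [eventually_sweptAngle_eq_zero c] with y hy hyx
  refine (h x hx).2 ?_
  rw [sweptAngle_eq_of_isPreconnected c isPreconnected_connectedComponentIn
    (connectedComponentIn_subset _ _) (mem_connectedComponentIn (h x hx).1) hyx, hy.2]

/-! ### Extracting a cycle -/

/-- If the path used this edge after its first step, it would return to its starting vertex. This is
the only obstruction to closing a path by an edge into a cycle. -/
theorem isPath_eq_toWalk_of_mem_edges {V : Type*} {G : SimpleGraph V} {u v : V} (h : G.Adj v u)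
    {p : G.Walk v u} (hp : p.IsPath) (he : s(u, v) ∈ p.edges) : p = h.toWalk := by
  cases p with
  | nil => exact absurd h (G.irrefl)
  | @cons _ w _ h' p =>
    rw [SimpleGraph.Walk.cons_isPath_iff] at hp
    rw [SimpleGraph.Walk.edges_cons, List.mem_cons] at he
    rcases he with he | he
    · have hw : w = u := by
        rcases Sym2.eq_iff.1 he with ⟨h1, h2⟩ | ⟨h1, h2⟩
        · exact absurd h1.symm h.ne
        · exact h1.symm
      subst hw
      rw [SimpleGraph.Walk.eq_nil_iff_nil.2 (SimpleGraph.Walk.isPath_iff_nil.1 hp.1)]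
    · exact absurd (p.snd_mem_support_of_mem_edges he) hp.2

/-- The two ratios are inverse to each other and avoid the branch cut, so their arguments cancel. -/
theorem sweptAngle_back_and_forth {u v : ℤ × ℤ} (h : H.Adj u v) {x : ℝ × ℝ}
    (hx : x ∉ segment ℝ (toPlane u) (toPlane v)) :
    sweptAngle (.cons h h.symm.toWalk) x = 0 := by
  have h1 : seenRatio (toPlane v) (toPlane u) x = (seenRatio (toPlane u) (toPlane v) x)⁻¹ := by
    simp [seenRatio]
  have h2 := seenRatio_mem_slitPlane hx
  simp only [SimpleGraph.Adj.toWalk, sweptAngle_cons, sweptAngle_nil, h1]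
  rw [Complex.log_inv _ (Complex.slitPlane_arg_ne_pi h2)]
  simp

/-- Loop erasure, built up from the end of the walk. Whenever the new first vertex already lies on
the erased path, a loop closes. Either the loop has swept angle zero and can be dropped without
changing the total, or it is not a mere back-and-forth step and is the required cycle. -/
theorem exists_path_or_cycle {u v : ℤ × ℤ} (p : H.Walk u v) {x : ℝ × ℝ} (hx : x ∉ walkTrace p) :
    (∃ p' : H.Walk u v, p'.IsPath ∧ p'.darts ⊆ p.darts ∧ sweptAngle p' x = sweptAngle p x) ∨
      ∃ (w : ℤ × ℤ) (c : H.Walk w w), c.IsCycle ∧ c.darts ⊆ p.darts ∧ sweptAngle c x ≠ 0 := by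
  induction p with
  | nil => exact .inl ⟨.nil, by simp⟩
  | @cons u v w h p ih =>
    rcases ih (notMem_walkTrace_of_cons hx) with ⟨p', hp', hd, hs⟩ | ⟨z, c, hc, hd, hs⟩
    swap
    · exact .inr ⟨z, c, hc, List.Subset.trans hd (by simp), hs⟩
    by_cases hu : u ∈ p'.support
    swap
    · refine .inl ⟨.cons h p', (SimpleGraph.Walk.cons_isPath_iff _ _).2 ⟨hp', hu⟩, ?_, by simp [hs]⟩
      simp only [SimpleGraph.Walk.darts_cons]
      exact List.cons_subset_cons _ hd
    · have hx1 : x ∉ segment ℝ (toPlane u) (toPlane v) :=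
        notMem_walkTrace.1 hx ⟨(u, v), h⟩ (by simp)
      have hsum : sweptAngle (.cons h p) x = sweptAngle (.cons h (p'.takeUntil u hu)) x +
          sweptAngle (p'.dropUntil u hu) x := by
        rw [sweptAngle_cons, sweptAngle_cons, add_assoc, ← sweptAngle_append,
          SimpleGraph.Walk.take_spec, hs]
      by_cases h0 : sweptAngle (.cons h (p'.takeUntil u hu)) x = 0
      · refine .inl ⟨p'.dropUntil u hu, hp'.dropUntil hu, ?_, by rw [hsum, h0, zero_add]⟩
        exact List.Subset.trans (List.Subset.trans (p'.darts_dropUntil_subset_darts hu) hd) (by simp)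
      · refine .inr ⟨u, .cons h (p'.takeUntil u hu), ?_, ?_, h0⟩
        · refine (SimpleGraph.Walk.cons_isCycle_iff _ _).2 ⟨hp'.takeUntil hu, fun he => h0 ?_⟩
          rw [isPath_eq_toWalk_of_mem_edges h.symm (hp'.takeUntil hu) he]
          exact sweptAngle_back_and_forth h hx1
        · simp only [SimpleGraph.Walk.darts_cons]
          exact List.cons_subset_cons _ (List.Subset.trans (p'.darts_takeUntil_subset_darts hu) hd)

/-- A closed walk with nonzero winding number contains a cycle with nonzero winding number. -/
theorem exists_cycle_of_sweptAngle_ne_zero {u : ℤ × ℤ} (c : H.Walk u u) {x : ℝ × ℝ}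
    (hx : x ∉ walkTrace c) (h0 : sweptAngle c x ≠ 0) :
    ∃ (w : ℤ × ℤ) (c' : H.Walk w w), c'.IsCycle ∧ c'.darts ⊆ c.darts ∧ sweptAngle c' x ≠ 0 := by
  rcases exists_path_or_cycle c hx with ⟨p', hp', -, hs⟩ | h
  · rw [SimpleGraph.Walk.eq_nil_iff_nil.2 (SimpleGraph.Walk.isPath_iff_nil.1 hp'), sweptAngle_nil]
      at hs
    exact absurd hs.symm h0
  · exact h


/-! ### Walks around a box -/

/-- Along a walk that stays in the half-plane `re ((z - x) * ζ) > 0`, the swept angle is a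
difference of arguments. -/
theorem sweptAngle_eq_arg_sub {u v : ℤ × ℤ} (p : H.Walk u v) (x : ℝ × ℝ) (ζ : ℂ)
    (hp : ∀ w ∈ p.support, 0 < ((cpx (toPlane w) - cpx x) * ζ).re) :
    sweptAngle p x = Complex.arg ((cpx (toPlane v) - cpx x) * ζ) -
      Complex.arg ((cpx (toPlane u) - cpx x) * ζ) := by
  induction p with
  | nil => simp
  | @cons u v w h p ih =>
    simp only [SimpleGraph.Walk.support_cons, List.mem_cons, forall_eq_or_imp] at hp
    rw [sweptAngle_cons, ih hp.2]
    have hu := hp.1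
    have hv := hp.2 _ p.start_mem_support
    set a := (cpx (toPlane u) - cpx x) * ζ with ha
    set b := (cpx (toPlane v) - cpx x) * ζ with hb
    have ha0 : a ≠ 0 := fun h => by simp [h] at hu
    have hb0 : b ≠ 0 := fun h => by simp [h] at hv
    have hζ : ζ ≠ 0 := right_ne_zero_of_mul (ha ▸ ha0)
    have h1 : seenRatio (toPlane u) (toPlane v) x = b / a := by
      rw [ha, hb, mul_div_mul_right _ _ hζ, seenRatio]
    have ha1 := abs_lt.1 (Complex.abs_arg_lt_pi_div_two_iff.2 (.inl hu))
    have hb1 := abs_lt.1 (Complex.abs_arg_lt_pi_div_two_iff.2 (.inl hv))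
    have h2 : Complex.arg a⁻¹ = -Complex.arg a := by
      rw [Complex.arg_inv, if_neg (by linarith)]
    -- Both arguments lie in (-π/2, π/2), so their difference lies in (-π, π) and is the principal
    -- argument of the quotient.
    rw [h1, Complex.log_im, div_eq_mul_inv, Complex.arg_mul hb0 (inv_ne_zero ha0)
      ⟨by linarith, by linarith⟩, h2]
    ring

/-- At a corner of the ring the reference half-plane is rotated by a quarter turn. Both arguments
are within π/2 of zero there, so exactly π/2 is gained. -/
theorem arg_sub_arg_mul_neg_I {z : ℂ} (h : 0 < z.re) (h' : 0 < z.im) :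
    Complex.arg z - Complex.arg (z * -Complex.I) = Real.pi / 2 := by
  have hz : z ≠ 0 := fun h0 => by simp [h0] at h
  have h1 : 0 < (z * -Complex.I).re := by simpa using h'
  have h2 : z * -Complex.I ≠ 0 := fun h0 => by simp [h0] at h1
  have h3 := abs_lt.1 (Complex.abs_arg_lt_pi_div_two_iff.2 (.inl h1))
  have h4 : z = (z * -Complex.I) * Complex.I := by rw [mul_assoc]; simp
  have h5 : Complex.arg z = Complex.arg (z * -Complex.I) + Complex.arg Complex.I := by
    conv_lhs => rw [h4]
    refine Complex.arg_mul h2 Complex.I_ne_zero ?_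
    rw [Complex.arg_I]
    exact ⟨by linarith [Real.pi_pos], by linarith⟩
  rw [h5, Complex.arg_I]
  ring

/-- A closed walk that passes successively to the right of `x`, above, to the left and below
winds once around `x`. -/
theorem sweptAngle_ring {a b c d : ℤ × ℤ} (p₁ : H.Walk a b) (p₂ : H.Walk b c) (p₃ : H.Walk c d)
    (p₄ : H.Walk d a) (x : ℝ × ℝ) (h₁ : ∀ w ∈ p₁.support, x.1 < w.1)
    (h₂ : ∀ w ∈ p₂.support, x.2 < w.2) (h₃ : ∀ w ∈ p₃.support, (w.1 : ℝ) < x.1)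
    (h₄ : ∀ w ∈ p₄.support, (w.2 : ℝ) < x.2) :
    sweptAngle (p₁.append (p₂.append (p₃.append p₄))) x = 2 * Real.pi := by
  -- The factors 1, -i, -1, i rotate the right, upper, left and lower half-planes at `x` onto the
  -- right half-plane. The four argument differences then telescope up to the gains of π/2 at the
  -- four corners.
  have s₁ := sweptAngle_eq_arg_sub p₁ x 1 fun w hw => by
    simpa [cpx_re, cpx_im, toPlane] using h₁ w hw
  have s₂ := sweptAngle_eq_arg_sub p₂ x (-Complex.I) fun w hw => by
    simpa [cpx_re, cpx_im, toPlane] using h₂ w hw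
  have s₃ := sweptAngle_eq_arg_sub p₃ x (-1) fun w hw => by
    simpa [cpx_re, cpx_im, toPlane] using h₃ w hw
  have s₄ := sweptAngle_eq_arg_sub p₄ x Complex.I fun w hw => by
    simpa [cpx_re, cpx_im, toPlane] using h₄ w hw
  have b₁ := h₁ b p₁.end_mem_support
  have b₂ := h₂ b p₂.start_mem_support
  have c₂ := h₂ c p₂.end_mem_support
  have c₃ := h₃ c p₃.start_mem_support
  have d₃ := h₃ d p₃.end_mem_support
  have d₄ := h₄ d p₄.start_mem_support
  have a₄ := h₄ a p₄.end_mem_support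
  have a₁ := h₁ a p₁.start_mem_support
  have j₁ := arg_sub_arg_mul_neg_I (z := (cpx (toPlane b) - cpx x) * 1)
    (by simpa [cpx_re, cpx_im, toPlane] using b₁) (by simpa [cpx_re, cpx_im, toPlane] using b₂)
  have j₂ := arg_sub_arg_mul_neg_I (z := (cpx (toPlane c) - cpx x) * -Complex.I)
    (by simpa [cpx_re, cpx_im, toPlane] using c₂) (by simpa [cpx_re, cpx_im, toPlane] using c₃)
  have j₃ := arg_sub_arg_mul_neg_I (z := (cpx (toPlane d) - cpx x) * -1)
    (by simpa [cpx_re, cpx_im, toPlane] using d₃) (by simpa [cpx_re, cpx_im, toPlane] using d₄)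
  have j₄ := arg_sub_arg_mul_neg_I (z := (cpx (toPlane a) - cpx x) * Complex.I)
    (by simpa [cpx_re, cpx_im, toPlane] using a₄) (by simpa [cpx_re, cpx_im, toPlane] using a₁)
  have r₁ : ∀ z : ℂ, z * 1 * -Complex.I = z * -Complex.I := fun z => by ring
  have r₂ : ∀ z : ℂ, z * -Complex.I * -Complex.I = z * -1 := fun z => by
    rw [mul_assoc, neg_mul_neg, Complex.I_mul_I]
  have r₃ : ∀ z : ℂ, z * -1 * -Complex.I = z * Complex.I := fun z => by ring
  have r₄ : ∀ z : ℂ, z * Complex.I * -Complex.I = z * 1 := fun z => by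
    rw [mul_assoc, mul_neg, Complex.I_mul_I, neg_neg]
  rw [r₁] at j₁
  rw [r₂] at j₂
  rw [r₃] at j₃
  rw [r₄] at j₄
  simp only [sweptAngle_append, s₁, s₂, s₃, s₄]
  linarith

end

/-! ### Crossings of closed walks -/

theorem mem_segment_toPlane {a b : ℤ × ℤ} {x : ℝ × ℝ}
    (hx : x ∈ segment ℝ (toPlane a) (toPlane b)) :
    (∃ t : ℝ, 0 ≤ t ∧ t ≤ 1 ∧ x = (a.1 + t * (b.1 - a.1), a.2 + t * (b.2 - a.2))) := by
  obtain ⟨s, t, hs, ht, hst, rfl⟩ := hx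
  refine ⟨t, ht, by linarith, ?_⟩
  have : s = 1 - t := by linarith
  subst this
  ext <;> simp [toPlane] <;> ring

/-- Two edges of the square lattice that meet in the plane have a common endpoint. -/
theorem disjoint_segments {a b c d : ℤ × ℤ} (hab : squareLattice.Adj a b)
    (hcd : squareLattice.Adj c d) (hac : a ≠ c) (had : a ≠ d) (hbc : b ≠ c) (hbd : b ≠ d) :
    Disjoint (segment ℝ (toPlane a) (toPlane b)) (segment ℝ (toPlane c) (toPlane d)) := by
  rw [Set.disjoint_left]
  intro x hx hx'
  obtain ⟨t, ht0, ht1, rfl⟩ := mem_segment_toPlane hx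
  obtain ⟨s, hs0, hs1, hs⟩ := mem_segment_toPlane hx'
  obtain ⟨a1, a2⟩ := a
  obtain ⟨b1, b2⟩ := b
  obtain ⟨c1, c2⟩ := c
  obtain ⟨d1, d2⟩ := d
  simp only [Prod.mk.injEq] at hs
  obtain ⟨e1, e2⟩ := hs
  have key : ∀ {p1 p2 r1 r2 : ℤ}, squareLattice.Adj (p1, p2) (r1, r2) →
      (r2 = p2 ∧ (r1 = p1 + 1 ∨ r1 = p1 - 1)) ∨ (r1 = p1 ∧ (r2 = p2 + 1 ∨ r2 = p2 - 1)) := by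
    intro p1 p2 r1 r2 h
    have h' : |p1 - r1| + |p2 - r2| = 1 := h
    rcases abs_cases (p1 - r1) with ⟨h1, _⟩ | ⟨h1, _⟩ <;>
      rcases abs_cases (p2 - r2) with ⟨h2, _⟩ | ⟨h2, _⟩ <;> omega
  -- In each coordinate, a common point expresses the integer difference of the two starting points
  -- as `s * d - t * b` with parameters in [0, 1]. This leaves a bounded integer range, and the
  -- directions of the edges leave finitely many cases.
  have bound : ∀ {m b d : ℤ}, (m : ℝ) = s * d - t * b →
      m ≤ max d 0 - min b 0 ∧ min d 0 - max b 0 ≤ m := by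
    intro m b d h
    have hd1 : (d : ℝ) ≤ (max d 0 : ℤ) := by exact_mod_cast le_max_left _ _
    have hd2 : ((min d 0 : ℤ) : ℝ) ≤ d := by exact_mod_cast min_le_left _ _
    have hd3 : (0 : ℝ) ≤ (max d 0 : ℤ) := by exact_mod_cast le_max_right _ _
    have hd4 : ((min d 0 : ℤ) : ℝ) ≤ 0 := by exact_mod_cast min_le_right _ _
    have hb1 : (b : ℝ) ≤ (max b 0 : ℤ) := by exact_mod_cast le_max_left _ _
    have hb2 : ((min b 0 : ℤ) : ℝ) ≤ b := by exact_mod_cast min_le_left _ _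
    have hb3 : (0 : ℝ) ≤ (max b 0 : ℤ) := by exact_mod_cast le_max_right _ _
    have hb4 : ((min b 0 : ℤ) : ℝ) ≤ 0 := by exact_mod_cast min_le_right _ _
    constructor
    · have : (m : ℝ) ≤ ((max d 0 - min b 0 : ℤ) : ℝ) := by
        rw [Int.cast_sub, h]
        nlinarith
      exact_mod_cast this
    · have : ((min d 0 - max b 0 : ℤ) : ℝ) ≤ m := by
        rw [Int.cast_sub, h]
        nlinarith
      exact_mod_cast this
  have h1 := bound (m := a1 - c1) (b := b1 - a1) (d := d1 - c1) (by push_cast; linarith)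
  have h2 := bound (m := a2 - c2) (b := b2 - a2) (d := d2 - c2) (by push_cast; linarith)
  simp only [ne_eq, Prod.mk.injEq, not_and] at hac had hbc hbd
  rcases key hab with ⟨h3, h4⟩ | ⟨h3, h4⟩ <;> rcases key hcd with ⟨h5, h6⟩ | ⟨h5, h6⟩ <;>
    rcases h4 with h4 | h4 <;> rcases h6 with h6 | h6 <;> subst h3 <;> subst h4 <;> subst h5 <;>
    subst h6 <;> omega

variable {H : SimpleGraph (ℤ × ℤ)}

/-- The winding number of a closed lattice walk does not change along a lattice walk that has no
vertex in common with it. -/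
theorem sweptAngle_eq_of_disjoint {a u v : ℤ × ℤ} (hH : H ≤ squareLattice) (c : H.Walk a a)
    (p : H.Walk u v) (hcp : ∀ w ∈ p.support, w ∉ c.support) :
    sweptAngle c (toPlane u) = sweptAngle c (toPlane v) := by
  induction p with
  | nil => rfl
  | @cons u v w h p ih =>
    simp only [SimpleGraph.Walk.support_cons, List.mem_cons, forall_eq_or_imp] at hcp
    rw [← ih hcp.2]
    refine sweptAngle_eq_of_isPreconnected c (convex_segment _ _).isPreconnected ?_
      (left_mem_segment ℝ _ _) (right_mem_segment ℝ _ _)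
    intro x hx
    refine notMem_walkTrace.2 fun d hd hxd => ?_
    have hv := hcp.2 _ p.start_mem_support
    have h1 := c.dart_fst_mem_support_of_mem_darts hd
    have h2 := c.dart_snd_mem_support_of_mem_darts hd
    exact Set.disjoint_left.1 (disjoint_segments (hH h) (hH d.adj) (fun e => hcp.1 (e ▸ h1))
      (fun e => hcp.1 (e ▸ h2)) (fun e => hv (e ▸ h1)) (fun e => hv (e ▸ h2))) hx hxd

/-- The winding number vanishes at points separated from the closed walk by a line parallel to an
axis. -/
theorem sweptAngle_eq_zero_of_lt {a : ℤ × ℤ} (c : H.Walk a a) (f : (ℝ × ℝ) →L[ℝ] ℝ) {x : ℝ × ℝ}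
    (hf : f ≠ 0) (h : ∀ w ∈ c.support, f (toPlane w) < f x) : sweptAngle c x = 0 := by
  have hS : IsPreconnected {y | f x ≤ f y} :=
    (convex_halfSpace_ge f.isLinear (f x)).isPreconnected
  have hSc : {y | f x ≤ f y} ⊆ (walkTrace c)ᶜ := by
    intro y hy
    refine notMem_walkTrace.2 fun d hd hyd => ?_
    have h1 := (convex_halfSpace_lt f.isLinear (f x)).segment_subset
      (h _ (c.dart_fst_mem_support_of_mem_darts hd))
      (h _ (c.dart_snd_mem_support_of_mem_darts hd)) hyd
    exact not_lt.2 hy (show f y < f x from h1)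
  obtain ⟨v, hv⟩ : ∃ v, f v ≠ 0 := by
    by_contra hcon
    push Not at hcon
    exact hf (ContinuousLinearMap.ext hcon)
  obtain ⟨v, hv⟩ : ∃ v, 0 < f v := by
    rcases lt_or_gt_of_ne hv with hv | hv
    · exact ⟨-v, by simpa using hv⟩
    · exact ⟨v, hv⟩
  have hv0 : v ≠ 0 := fun h0 => by simp [h0] at hv
  -- The ray from `x` in the direction `v` stays in the half-plane that avoids the walk and escapes
  -- to infinity, where the winding number is zero.
  have ht : Tendsto (fun t : ℝ => x + t • v) atTop (Bornology.cobounded (ℝ × ℝ)) := by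
    rw [← tendsto_norm_atTop_iff_cobounded]
    refine tendsto_atTop_mono (f := fun t : ℝ => t * ‖v‖ - ‖x‖) (fun t => ?_) ?_
    · have h1 : t * ‖v‖ ≤ ‖t • v‖ := by
        rw [norm_smul]
        gcongr
        exact le_abs_self t
      have h2 := norm_sub_norm_le (t • v) (-x)
      rw [norm_neg, sub_neg_eq_add, add_comm] at h2
      linarith
    · exact tendsto_atTop_add_const_right _ _ (tendsto_id.atTop_mul_const (norm_pos_iff.2 hv0))
  obtain ⟨t, ht1, ht2⟩ := ((ht.eventually (eventually_sweptAngle_eq_zero c)).and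
    (eventually_ge_atTop 0)).exists
  rw [sweptAngle_eq_of_isPreconnected c hS hSc (x := x) (y := x + t • v)
    (show f x ≤ f x from le_rfl) ?_, ht1.2]
  change f x ≤ f (x + t • v)
  rw [map_add, map_smul, smul_eq_mul]
  nlinarith

theorem exists_mem_support_of_sweptAngle_ne {a u v : ℤ × ℤ} (hH : H ≤ squareLattice)
    (c : H.Walk a a) (p : H.Walk u v)
    (h : sweptAngle c (toPlane u) ≠ sweptAngle c (toPlane v)) : ∃ w ∈ p.support, w ∈ c.support := by
  by_contra hcon
  push Not at hcon
  exact h (sweptAngle_eq_of_disjoint hH c p hcon)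

/-! ### Crossings of rectangles -/

/-- A discrete intermediate value theorem: since `f` increases by at most one per step, the level
`M` cannot be skipped, and the walk is cut at its first visit. -/
theorem exists_walk_hitting {V : Type*} {H : SimpleGraph V} (f : V → ℤ)
    (hf : ∀ x y, H.Adj x y → f y ≤ f x + 1) {u v : V} (p : H.Walk u v) {M : ℤ} (hu : f u ≤ M)
    (hv : M ≤ f v) : ∃ (w : V) (p' : H.Walk u w), f w = M ∧
      ∀ z ∈ p'.support, z ∈ p.support ∧ f z ≤ M := by
  induction p with
  | @nil u => exact ⟨u, .nil, le_antisymm hu hv, by simpa using hu⟩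
  | @cons u v w h p ih =>
    rcases hu.eq_or_lt with hu' | hu'
    · exact ⟨u, .nil, hu', by simp [hu]⟩
    · obtain ⟨z, p', hz, hp'⟩ := ih (by have := hf _ _ h; omega) hv
      refine ⟨z, .cons h p', hz, ?_⟩
      simp only [SimpleGraph.Walk.support_cons, List.mem_cons, forall_eq_or_imp, true_or, true_and]
      exact ⟨hu, fun x hx => ⟨.inr (hp' x hx).1, (hp' x hx).2⟩⟩

theorem squareLattice_fst_le {x y : ℤ × ℤ} (h : squareLattice.Adj x y) :
    y.1 ≤ x.1 + 1 ∧ x.1 ≤ y.1 + 1 := by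
  have h' : |x.1 - y.1| + |x.2 - y.2| = 1 := h
  have h1 := abs_nonneg (x.2 - y.2)
  have h2 := abs_le.1 (show |x.1 - y.1| ≤ 1 by omega)
  omega

theorem openSubgraph_le {V : Type*} {G : SimpleGraph V} (ω : BondConfig G) :
    openSubgraph G ω ≤ G := fun _ _ h => h.1

/-- The connection is cut at its first visit to the column `⌈a⌉`. Reversing this piece and cutting
at its first visit to the column 0 leaves a walk between the two columns, and removing its loops
makes it a path. -/
theorem hasLeftRightCrossing_of_connIn {H : SimpleGraph (ℤ × ℤ)} (hH : H ≤ squareLattice)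
    {u v : ℤ × ℤ} {a b : ℝ} (ha : 0 ≤ a) (hu : u.1 ≤ 0) (hv : ⌈a⌉ ≤ v.1)
    (h : ConnIn H {w | 0 ≤ w.2 ∧ (w.2 : ℝ) ≤ b} u v) : HasLeftRightCrossing H a b := by
  classical
  obtain ⟨p, hp⟩ := h
  have ha' : 0 ≤ ⌈a⌉ := Int.ceil_nonneg ha
  obtain ⟨w, p₁, hw, hp₁⟩ := exists_walk_hitting (fun z : ℤ × ℤ => z.1)
    (fun x y hxy => (squareLattice_fst_le (hH hxy)).1) p (hu.trans ha') hv
  obtain ⟨z, p₂, hz, hp₂⟩ := exists_walk_hitting (fun z : ℤ × ℤ => -z.1)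
    (fun x y hxy => by have := (squareLattice_fst_le (hH hxy)).2; omega) p₁.reverse (M := 0)
    (by omega) (by omega)
  refine ⟨z, w, (p₂.reverse.toPath : H.Walk z w), p₂.reverse.toPath.2, by simpa using hz, ?_, ?_⟩
  · rw [hw]
    exact Int.le_ceil a
  · intro y hy
    have h1 := hp₂ y (by simpa using p₂.reverse.support_toPath_subset_support hy)
    have h2 := hp₁ y (by simpa using h1.1)
    have h3 := hp y h2.1
    refine ⟨by have := h1.2; omega, ?_, h3.1, h3.2⟩
    have : ((y.1 : ℤ) : ℝ) ≤ ⌈a⌉ := by exact_mod_cast h2.2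
    linarith [Int.ceil_lt_add_one a]

/-! ### Probabilities at a scale -/

section
variable {μ : Measure (BondConfig squareLattice)} {L : ℕ} {q : ℝ}
  {Φ : BondConfig squareLattice → BondConfig squareLattice}
  {R : BondConfig squareLattice → ℤ × ℤ → ℤ × ℤ}

theorem IsOneIndepModelGE.prob_closed {V : Type*} {G : SimpleGraph V} {ν : Measure (BondConfig G)}
    (h : IsOneIndepModelGE G (1 - q) ν) (e : G.edgeSet) : ν.real {ω | ω e = false} ≤ q := by
  have := h.isProbabilityMeasure
  have h1 := h.le_prob_open e
  have hm : MeasurableSet {ω : BondConfig G | ω e = true} :=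
    measurable_pi_apply (X := fun _ : G.edgeSet => Bool) e (measurableSet_singleton true)
  have h2 : {ω : BondConfig G | ω e = false} = {ω : BondConfig G | ω e = true}ᶜ := by
    ext ω
    simp
  rw [h2, probReal_compl_eq_one_sub hm]
  linarith

/-- The probability that some edge of a finite list is closed at scale `L`. -/
theorem IsScale.prob_exists_closed (h : IsScale μ L q Φ R) (E : List squareLattice.edgeSet) :
    μ.real {ω | ∃ e ∈ E, Φ ω e = false} ≤ E.length * q := by
  have := h.model.isProbabilityMeasure
  have : IsProbabilityMeasure μ := by
    refine ⟨?_⟩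
    have := measure_univ (μ := μ.map Φ)
    rwa [Measure.map_apply h.measurable .univ] at this
  induction E with
  | nil => simp
  | cons e E ih =>
    have h1 : {ω | ∃ f ∈ e :: E, Φ ω f = false} =
        (Φ ⁻¹' {ω | ω e = false}) ∪ {ω | ∃ f ∈ E, Φ ω f = false} := by
      ext ω
      simp
    have hm : MeasurableSet {ω : BondConfig squareLattice | ω e = false} :=
      measurable_pi_apply (X := fun _ : squareLattice.edgeSet => Bool) e (measurableSet_singleton _)
    have h2 := h.model.prob_closed e
    rw [map_measureReal_apply h.measurable hm] at h2
    rw [h1]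
    refine (measureReal_union_le _ _).trans ?_
    rw [List.length_cons]
    push_cast
    linarith

end

theorem adj_right (i j : ℤ) : squareLattice.Adj (i, j) (i + 1, j) := by
  simp [squareLattice]

theorem adj_up (i j : ℤ) : squareLattice.Adj (i, j) (i, j + 1) := by
  simp [squareLattice]

/-- The edges between neighbouring vertices of the box `[-M, M]²`. -/
def boxEdges (M : ℕ) : List squareLattice.edgeSet :=
  (List.range (2 * M + 1)).flatMap fun i : ℕ => (List.range (2 * M + 1)).flatMap fun j : ℕ =>
    [⟨s(((i : ℤ) - M, (j : ℤ) - M), ((i : ℤ) - M + 1, (j : ℤ) - M)), adj_right _ _⟩,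
      ⟨s(((i : ℤ) - M, (j : ℤ) - M), ((i : ℤ) - M, (j : ℤ) - M + 1)), adj_up _ _⟩]

/-- All edges near the box `[-M, M]²` are open. -/
def BoxOpen (M : ℕ) (ω : BondConfig squareLattice) : Prop := ∀ e ∈ boxEdges M, ω e = true

theorem BoxOpen.adj_right {M : ℕ} {ω : BondConfig squareLattice} (h : BoxOpen M ω) {i j : ℤ}
    (hi : |i| ≤ M) (hj : |j| ≤ M) : (openSubgraph squareLattice ω).Adj (i, j) (i + 1, j) := by
  rw [abs_le] at hi hj
  refine ⟨_root_.adj_right i j, h _ ?_⟩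
  simp only [boxEdges, List.mem_flatMap, List.mem_cons, List.not_mem_nil, or_false]
  have hi' : (i + M).toNat < 2 * M + 1 := by omega
  have hj' : (j + M).toNat < 2 * M + 1 := by omega
  refine ⟨(i + M).toNat, List.mem_range.2 hi', (j + M).toNat, List.mem_range.2 hj', .inl ?_⟩
  have h1 : ((i + M).toNat : ℤ) - M = i := by omega
  have h2 : ((j + M).toNat : ℤ) - M = j := by omega
  simp only [h1, h2]

theorem BoxOpen.adj_up {M : ℕ} {ω : BondConfig squareLattice} (h : BoxOpen M ω) {i j : ℤ}
    (hi : |i| ≤ M) (hj : |j| ≤ M) : (openSubgraph squareLattice ω).Adj (i, j) (i, j + 1) := by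
  rw [abs_le] at hi hj
  refine ⟨_root_.adj_up i j, h _ ?_⟩
  simp only [boxEdges, List.mem_flatMap, List.mem_cons, List.not_mem_nil, or_false]
  have hi' : (i + M).toNat < 2 * M + 1 := by omega
  have hj' : (j + M).toNat < 2 * M + 1 := by omega
  refine ⟨(i + M).toNat, List.mem_range.2 hi', (j + M).toNat, List.mem_range.2 hj', .inr ?_⟩
  have h1 : ((i + M).toNat : ℤ) - M = i := by omega
  have h2 : ((j + M).toNat : ℤ) - M = j := by omega
  simp only [h1, h2]

theorem BoxOpen.connIn_row {M : ℕ} {ω : BondConfig squareLattice} (h : BoxOpen M ω) {i j : ℤ}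
    (n : ℕ) (hi : -M ≤ i) (hn : i + n ≤ M) (hj : |j| ≤ M) :
    ConnIn (openSubgraph squareLattice ω) {w | w.2 = j ∧ i ≤ w.1 ∧ w.1 ≤ i + n} (i, j)
      (i + n, j) := by
  induction n with
  | zero => simpa using ConnIn.refl (by simp)
  | succ n ih =>
    push_cast at hn ⊢
    refine ((ih (by omega)).mono ?_).trans (.of_adj ?_ ?_ ?_)
    · rintro w ⟨h1, h2, h3⟩
      exact ⟨h1, h2, by omega⟩
    · rw [← add_assoc]
      exact h.adj_right (abs_le.2 ⟨by omega, by omega⟩) hj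
    · exact ⟨rfl, by simp, by simp⟩
    · exact ⟨rfl, by simp; omega, by simp⟩

theorem BoxOpen.connIn_col {M : ℕ} {ω : BondConfig squareLattice} (h : BoxOpen M ω) {i j : ℤ}
    (n : ℕ) (hj : -M ≤ j) (hn : j + n ≤ M) (hi : |i| ≤ M) :
    ConnIn (openSubgraph squareLattice ω) {w | w.1 = i ∧ j ≤ w.2 ∧ w.2 ≤ j + n} (i, j)
      (i, j + n) := by
  induction n with
  | zero => simpa using ConnIn.refl (by simp)
  | succ n ih =>
    push_cast at hn ⊢
    refine ((ih (by omega)).mono ?_).trans (.of_adj ?_ ?_ ?_)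
    · rintro w ⟨h1, h2, h3⟩
      exact ⟨h1, h2, by omega⟩
    · rw [← add_assoc]
      exact h.adj_up hi (abs_le.2 ⟨by omega, by omega⟩)
    · exact ⟨rfl, by simp, by simp⟩
    · exact ⟨rfl, by simp; omega, by simp⟩

/-! ### Rings of open edges -/

theorem notMem_walkTrace_of_lt {H : SimpleGraph (ℤ × ℤ)} {a b : ℤ × ℤ} (p : H.Walk a b)
    (f : (ℝ × ℝ) →L[ℝ] ℝ) {x : ℝ × ℝ} (h : ∀ w ∈ p.support, f (toPlane w) < f x) :
    x ∉ walkTrace p := by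
  refine notMem_walkTrace.2 fun d hd hx => ?_
  have h1 := (convex_halfSpace_lt f.isLinear (f x)).segment_subset
    (h _ (p.dart_fst_mem_support_of_mem_darts hd)) (h _ (p.dart_snd_mem_support_of_mem_darts hd)) hx
  exact lt_irrefl (f x) h1

theorem walkTrace_append {H : SimpleGraph (ℤ × ℤ)} {a b c : ℤ × ℤ} (p : H.Walk a b)
    (p' : H.Walk b c) : walkTrace (p.append p') = walkTrace p ∪ walkTrace p' := by
  ext x
  simp [walkTrace, SimpleGraph.Walk.darts_append, or_and_right, exists_or]

/-- The points surrounded by the ring of blocks of side `L` at distance two from the origin. -/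
def innerBox (L : ℕ) : Set (ℝ × ℝ) :=
  {x | (-L ≤ x.1 ∧ x.1 < 2 * L) ∧ -L ≤ x.2 ∧ x.2 < 2 * L}

theorem isPreconnected_innerBox (L : ℕ) : IsPreconnected (innerBox L) := by
  have : innerBox L = Set.Ico (-L : ℝ) (2 * L) ×ˢ Set.Ico (-L : ℝ) (2 * L) := rfl
  rw [this]
  exact isPreconnected_Ico.prod isPreconnected_Ico

section
variable {μ : Measure (BondConfig squareLattice)} {L : ℕ} {q : ℝ}
  {Φ : BondConfig squareLattice → BondConfig squareLattice}
  {R : BondConfig squareLattice → ℤ × ℤ → ℤ × ℤ} {ω : BondConfig squareLattice}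

/-- The lattice points of the blocks of side `L` with indices in `[i, i'] × [j, j']`. -/
def blockRect (L : ℕ) (i i' j j' : ℤ) : Set (ℤ × ℤ) :=
  {w | (L * i ≤ w.1 ∧ w.1 < L * i' + L) ∧ L * j ≤ w.2 ∧ w.2 < L * j' + L}

theorem IsScale.connIn_rect (h : IsScale μ L q Φ R) {i i' j j' : ℤ} {v w : ℤ × ℤ}
    (hc : ConnIn (openSubgraph squareLattice (Φ ω))
      {a | (i ≤ a.1 ∧ a.1 ≤ i') ∧ j ≤ a.2 ∧ a.2 ≤ j'} v w) :
    ConnIn (openSubgraph squareLattice ω) (blockRect L i i' j j') (R ω v) (R ω w) := by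
  refine (h.connIn hc).mono fun x hx => ?_
  simp only [Set.mem_iUnion] at hx
  obtain ⟨a, ha, hx⟩ := hx
  obtain ⟨⟨h1, h2⟩, h3, h4⟩ := ha
  obtain ⟨⟨h5, h6⟩, h7, h8⟩ := (mem_block_iff h.pos).1 hx
  have hL : (0 : ℤ) ≤ L := by positivity
  have := mul_le_mul_of_nonneg_left h1 hL
  have := mul_le_mul_of_nonneg_left h2 hL
  have := mul_le_mul_of_nonneg_left h3 hL
  have := mul_le_mul_of_nonneg_left h4 hL
  exact ⟨⟨by linarith, by linarith⟩, by linarith, by linarith⟩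

theorem IsScale.connIn_row (h : IsScale μ L q Φ R) {M : ℕ} (hb : BoxOpen M (Φ ω)) {i i' j : ℤ}
    (hi : -M ≤ i) (hii : i ≤ i') (hi' : i' ≤ M) (hj : |j| ≤ M) :
    ConnIn (openSubgraph squareLattice ω) (blockRect L i i' j j) (R ω (i, j)) (R ω (i', j)) := by
  have h1 := hb.connIn_row (i' - i).toNat hi (by omega) hj
  have h2 : i + (i' - i).toNat = i' := by omega
  rw [h2] at h1
  exact h.connIn_rect (h1.mono fun w hw => ⟨hw.2, hw.1.ge, hw.1.le⟩)

theorem IsScale.connIn_col (h : IsScale μ L q Φ R) {M : ℕ} (hb : BoxOpen M (Φ ω)) {i j j' : ℤ}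
    (hj : -M ≤ j) (hjj : j ≤ j') (hj' : j' ≤ M) (hi : |i| ≤ M) :
    ConnIn (openSubgraph squareLattice ω) (blockRect L i i j j') (R ω (i, j)) (R ω (i, j')) := by
  have h1 := hb.connIn_col (j' - j).toNat hj (by omega) hi
  have h2 : j + (j' - j).toNat = j' := by omega
  rw [h2] at h1
  exact h.connIn_rect (h1.mono fun w hw => ⟨⟨hw.1.ge, hw.1.le⟩, hw.2⟩)

/-- If all edges near the origin are open at scale `L`, there is an open closed walk that winds
around the inner box. -/
theorem IsScale.exists_ring (h : IsScale μ L q Φ R) (hb : BoxOpen 9 (Φ ω)) :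
    ∃ c : (openSubgraph squareLattice ω).Walk (R ω (2, -2)) (R ω (2, -2)),
      (∀ w ∈ c.support, w ∈ blockRect L (-2) 2 (-2) 2) ∧
      ∀ x ∈ innerBox L, x ∉ walkTrace c ∧ sweptAngle c x = 2 * Real.pi := by
  have hL : (0 : ℤ) < L := by exact_mod_cast h.pos
  -- The four sides of the square of blocks are run through counterclockwise: right, top, left,
  -- bottom.
  obtain ⟨p₁, hp₁⟩ := h.connIn_col hb (i := 2) (j := -2) (j' := 2) (by simp) (by simp) (by simp)
    (by simp)
  obtain ⟨p₂, hp₂⟩ := (h.connIn_row hb (j := 2) (i := -2) (i' := 2) (by simp) (by simp) (by simp)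
    (by simp)).symm
  obtain ⟨p₃, hp₃⟩ := (h.connIn_col hb (i := -2) (j := -2) (j' := 2) (by simp) (by simp) (by simp)
    (by simp)).symm
  obtain ⟨p₄, hp₄⟩ := h.connIn_row hb (j := -2) (i := -2) (i' := 2) (by simp) (by simp) (by simp)
    (by simp)
  refine ⟨p₁.append (p₂.append (p₃.append p₄)), ?_, ?_⟩
  · intro w hw
    simp only [SimpleGraph.Walk.mem_support_append_iff] at hw
    rcases hw with hw | hw | hw | hw
    · obtain ⟨⟨_, _⟩, _, _⟩ := hp₁ w hw
      exact ⟨⟨by linarith, by linarith⟩, by linarith, by linarith⟩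
    · obtain ⟨⟨_, _⟩, _, _⟩ := hp₂ w hw
      exact ⟨⟨by linarith, by linarith⟩, by linarith, by linarith⟩
    · obtain ⟨⟨_, _⟩, _, _⟩ := hp₃ w hw
      exact ⟨⟨by linarith, by linarith⟩, by linarith, by linarith⟩
    · obtain ⟨⟨_, _⟩, _, _⟩ := hp₄ w hw
      exact ⟨⟨by linarith, by linarith⟩, by linarith, by linarith⟩
  · rintro x ⟨⟨hx1, hx2⟩, hx3, hx4⟩
    -- Blocks with an index 2 begin at `2 * L` and blocks with an index -2 end before `-L`, which
    -- are the limits of `innerBox L`.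
    have h₁ : ∀ w ∈ p₁.support, x.1 < (w.1 : ℝ) := fun w hw => by
      have h0 := (hp₁ w hw).1.1
      have : ((L * 2 : ℤ) : ℝ) ≤ w.1 := by exact_mod_cast h0
      push_cast at this
      linarith
    have h₂ : ∀ w ∈ p₂.support, x.2 < (w.2 : ℝ) := fun w hw => by
      have h0 := (hp₂ w hw).2.1
      have : ((L * 2 : ℤ) : ℝ) ≤ w.2 := by exact_mod_cast h0
      push_cast at this
      linarith
    have h₃ : ∀ w ∈ p₃.support, (w.1 : ℝ) < x.1 := fun w hw => by
      have : (w.1 : ℝ) < ((-L : ℤ) : ℝ) := by exact_mod_cast (by linarith [(hp₃ w hw).1.2])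
      push_cast at this
      linarith
    have h₄ : ∀ w ∈ p₄.support, (w.2 : ℝ) < x.2 := fun w hw => by
      have : (w.2 : ℝ) < ((-L : ℤ) : ℝ) := by exact_mod_cast (by linarith [(hp₄ w hw).2.2])
      push_cast at this
      linarith
    refine ⟨?_, sweptAngle_ring p₁ p₂ p₃ p₄ x h₁ h₂ h₃ h₄⟩
    simp only [walkTrace_append, Set.mem_union, not_or]
    exact ⟨notMem_walkTrace_of_lt p₁ (-ContinuousLinearMap.fst ℝ ℝ ℝ) fun w hw =>
        neg_lt_neg (h₁ w hw),
      notMem_walkTrace_of_lt p₂ (-ContinuousLinearMap.snd ℝ ℝ ℝ) fun w hw => neg_lt_neg (h₂ w hw),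
      notMem_walkTrace_of_lt p₃ (ContinuousLinearMap.fst ℝ ℝ ℝ) h₃,
      notMem_walkTrace_of_lt p₄ (ContinuousLinearMap.snd ℝ ℝ ℝ) h₄⟩

/-- A cycle with nonzero winding number around the origin is extracted from the ring. It uses only
edges of the ring, so it avoids the inner box, and as this box is connected the winding number is
the same nonzero one at all its points. -/
theorem IsScale.exists_cycle (h : IsScale μ L q Φ R) (hb : BoxOpen 9 (Φ ω)) :
    ∃ (v : ℤ × ℤ) (c : (openSubgraph squareLattice ω).Walk v v), c.IsCycle ∧
      Encloses c (innerBox L) := by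
  obtain ⟨c, -, hc⟩ := h.exists_ring hb
  have h0 : (0 : ℝ × ℝ) ∈ innerBox L := by
    have : (0 : ℝ) < L := by exact_mod_cast h.pos
    simp [innerBox, this]
  obtain ⟨w, c', hc', hd, hs⟩ := exists_cycle_of_sweptAngle_ne_zero c (hc 0 h0).1 (by
    rw [(hc 0 h0).2]
    positivity)
  have hsub : innerBox L ⊆ (walkTrace c')ᶜ := fun x hx hx' =>
    (hc x hx).1 (walkTrace_subset_of_darts hd hx')
  refine ⟨w, c', hc', encloses_of_sweptAngle_ne_zero c' fun x hx => ⟨hsub hx, ?_⟩⟩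
  rwa [sweptAngle_eq_of_isPreconnected c' (isPreconnected_innerBox L) hsub hx h0]

/-- An open path from the inside to the outside of the ring meets the ring. -/
theorem IsScale.reachable_ring (h : IsScale μ L q Φ R) (hb : BoxOpen 9 (Φ ω)) {u v : ℤ × ℤ}
    (hu : toPlane u ∈ innerBox L) (hv : v ∉ blockRect L (-2) 2 (-2) 2)
    (huv : (openSubgraph squareLattice ω).Reachable u v) :
    (openSubgraph squareLattice ω).Reachable u (R ω (2, -2)) := by
  obtain ⟨c, hc, hc'⟩ := h.exists_ring hb
  obtain ⟨p⟩ := huv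
  -- A point outside the bounding square of the ring is separated from the ring by a horizontal or
  -- vertical line.
  have hzero : sweptAngle c (toPlane v) = 0 := by
    have hne : ∀ f : (ℝ × ℝ) →L[ℝ] ℝ, ∀ z, f z ≠ 0 → f ≠ 0 := fun f z hf h => by simp [h] at hf
    simp only [blockRect, Set.mem_ofPred_eq, not_and_or, not_le, not_lt] at hv
    rcases hv with (hv | hv) | (hv | hv)
    · refine sweptAngle_eq_zero_of_lt c (-ContinuousLinearMap.fst ℝ ℝ ℝ) (hne _ (1, 0) (by simp))
        fun w hw => neg_lt_neg ?_
      have : v.1 < w.1 := hv.trans_le (hc w hw).1.1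
      simpa [toPlane] using this
    · refine sweptAngle_eq_zero_of_lt c (ContinuousLinearMap.fst ℝ ℝ ℝ) (hne _ (1, 0) (by simp))
        fun w hw => ?_
      have : w.1 < v.1 := (hc w hw).1.2.trans_le hv
      simpa [toPlane] using this
    · refine sweptAngle_eq_zero_of_lt c (-ContinuousLinearMap.snd ℝ ℝ ℝ) (hne _ (0, 1) (by simp))
        fun w hw => neg_lt_neg ?_
      have : v.2 < w.2 := hv.trans_le (hc w hw).2.1
      simpa [toPlane] using this
    · refine sweptAngle_eq_zero_of_lt c (ContinuousLinearMap.snd ℝ ℝ ℝ) (hne _ (0, 1) (by simp))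
        fun w hw => ?_
      have : w.2 < v.2 := (hc w hw).2.2.trans_le hv
      simpa [toPlane] using this
  obtain ⟨w, hwp, hwc⟩ := exists_mem_support_of_sweptAngle_ne (openSubgraph_le ω) c p (by
    rw [hzero, (hc' _ hu).2]
    positivity)
  exact (p.takeUntil w hwp).reachable.trans (c.takeUntil w hwc).reachable.symm

end

/-! ### Consequences of good scales -/

section
variable {μ : Measure (BondConfig squareLattice)} {L : ℕ → ℕ} {q : ℕ → ℝ}
  {Φ : ℕ → BondConfig squareLattice → BondConfig squareLattice}
  {R : ℕ → BondConfig squareLattice → ℤ × ℤ → ℤ × ℤ}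

theorem IsScale.prob_not_boxOpen {L : ℕ} {q : ℝ}
    {Φ : BondConfig squareLattice → BondConfig squareLattice}
    {R : BondConfig squareLattice → ℤ × ℤ → ℤ × ℤ} (h : IsScale μ L q Φ R) (M : ℕ) :
    μ.real {ω | ¬ BoxOpen M (Φ ω)} ≤ (boxEdges M).length * q := by
  refine le_trans (le_of_eq ?_) (h.prob_exists_closed (boxEdges M))
  congr 1
  ext ω
  simp [BoxOpen]

theorem lt_scale (h : ∀ k, IsScale μ (L k) (q k) (Φ k) (R k)) (hL : ∀ k, L (k + 1) = 3 * L k)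
    (k : ℕ) : k < L k := by
  induction k with
  | zero => exact (h 0).pos
  | succ k ih =>
    rw [hL]
    omega

/-- The row of blocks with indices -1, …, `M` and ordinate 0 has height `L ≤ n`. Its first
representative has negative abscissa, and its last one has abscissa at least `M * L ≥ 3 * C * L ≥ C
* n`. -/
theorem IsScale.hasLeftRightCrossing {L : ℕ} {q : ℝ}
    {Φ : BondConfig squareLattice → BondConfig squareLattice}
    {R : BondConfig squareLattice → ℤ × ℤ → ℤ × ℤ} (h : IsScale μ L q Φ R)
    {ω : BondConfig squareLattice} {C : ℝ} (hC : 0 < C) {M n : ℕ} (hM : 3 * C + 1 ≤ M)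
    (hn : L ≤ n) (hn' : n < 3 * L) (hb : BoxOpen M (Φ ω)) :
    HasLeftRightCrossing (openSubgraph squareLattice ω) (C * n) n := by
  have hL : (0 : ℤ) < L := by exact_mod_cast h.pos
  have hL' : (1 : ℝ) ≤ L := by exact_mod_cast h.pos
  have hM1 : 1 ≤ M := by
    have : (1 : ℝ) ≤ M := by linarith
    exact_mod_cast this
  have hc := h.connIn_row hb (i := -1) (i' := M) (j := 0) (by omega) (by omega) le_rfl (by simp)
  refine hasLeftRightCrossing_of_connIn (openSubgraph_le ω) (by positivity) ?_ ?_
    (hc.mono fun w hw => ⟨by have := hw.2.1; omega, ?_⟩)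
  · have := ((mem_block_iff h.pos).1 (h.mem_block ω (-1, 0))).1.2
    omega
  · have h1 := ((mem_block_iff h.pos).1 (h.mem_block ω (M, 0))).1.1
    refine le_trans (Int.ceil_le.2 ?_) h1
    have h2 : (n : ℝ) ≤ 3 * L := by exact_mod_cast hn'.le
    push_cast
    nlinarith [mul_le_mul_of_nonneg_left h2 hC.le, mul_le_mul_of_nonneg_left hM (zero_le_one.trans hL')]
  · have h1 : w.2 ≤ n := by
      have := hw.2.2
      omega
    exact_mod_cast h1

/-- Long rectangles are crossed with high probability. -/
theorem tendsto_prob_crossing [IsProbabilityMeasure μ]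
    (h : ∀ k, IsScale μ (L k) (q k) (Φ k) (R k)) (hL : ∀ k, L (k + 1) = 3 * L k)
    (hq : Tendsto q atTop (𝓝 0)) {C : ℝ} (hC : 0 < C) :
    Tendsto
      (fun n : ℕ => μ.real {ω | HasLeftRightCrossing (openSubgraph squareLattice ω) (C * n) n})
      atTop (𝓝 1) := by
  have hmono : Monotone L := monotone_nat_of_le_succ fun k => by rw [hL]; omega
  obtain ⟨M, hM⟩ := exists_nat_ge (3 * C + 1)
  refine tendsto_order.2 ⟨fun a ha => ?_, fun a ha => .of_forall fun n =>
    measureReal_le_one.trans_lt ha⟩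
  have h0 : Tendsto (fun k => (boxEdges M).length * q k) atTop (𝓝 0) := by
    simpa using hq.const_mul ((boxEdges M).length : ℝ)
  obtain ⟨K, hK⟩ := eventually_atTop.1 ((tendsto_order.1 h0).2 (1 - a) (by linarith))
  filter_upwards [eventually_ge_atTop (L K)] with n hn
  -- The least such `k` is the scale with `L k ≤ n < 3 * L k`. It tends to infinity with `n`, so a
  -- single bound `M` on the number of blocks serves for all `n`.
  have hex : ∃ k, n < L (k + 1) := ⟨n, (lt_scale h hL _).trans' n.lt_succ_self⟩
  have hk1 := Nat.find_spec hex
  have hk2 := fun m => Nat.find_min (m := m) hex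
  set k := Nat.find hex
  have hKk : K ≤ k := by
    by_contra hlt
    have := hmono (show k + 1 ≤ K by omega)
    omega
  have hkn : L k ≤ n := by
    rcases k with _ | k
    · exact (hmono (Nat.zero_le K)).trans hn
    · have := hk2 k (by omega)
      omega
  have h1 := (h k).prob_not_boxOpen M
  -- Subadditivity applied to a cover of the whole space gives the lower bound without any
  -- measurability of the crossing event.
  have h2 : {ω | HasLeftRightCrossing (openSubgraph squareLattice ω) (C * n) n} ∪
      {ω | ¬ BoxOpen M (Φ k ω)} = Set.univ := by
    refine Set.eq_univ_of_forall fun ω => ?_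
    by_cases hb : BoxOpen M (Φ k ω)
    · exact .inl ((h k).hasLeftRightCrossing hC hM hkn (by rwa [← hL]) hb)
    · exact .inr hb
  have h3 := measureReal_union_le (μ := μ)
    {ω | HasLeftRightCrossing (openSubgraph squareLattice ω) (C * n) n} {ω | ¬ BoxOpen M (Φ k ω)}
  rw [h2, probReal_univ] at h3
  have := hK k hKk
  linarith

/-- The Borel–Cantelli lemma; no independence between different scales is needed. -/
theorem ae_eventually_boxOpen [IsProbabilityMeasure μ]
    (h : ∀ k, IsScale μ (L k) (q k) (Φ k) (R k)) (hq : Summable q) (M : ℕ) :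
    ∀ᵐ ω ∂μ, ∀ᶠ k in atTop, BoxOpen M (Φ k ω) := by
  have h1 : ∑' k, μ {ω | ¬ BoxOpen M (Φ k ω)} ≠ ⊤ := by
    refine ne_top_of_le_ne_top (hq.mul_left ((boxEdges M).length : ℝ)).tsum_ofReal_ne_top
      (ENNReal.tsum_le_tsum fun k => ?_)
    rw [← ofReal_measureReal]
    exact ENNReal.ofReal_le_ofReal ((h k).prob_not_boxOpen M)
  filter_upwards [ae_eventually_notMem h1] with ω hω
  filter_upwards [hω] with k hk
  simpa using hk

theorem exists_subset_innerBox (h : ∀ k, IsScale μ (L k) (q k) (Φ k) (R k))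
    (hL : ∀ k, L (k + 1) = 3 * L k) {B : Set (ℝ × ℝ)} (hB : Bornology.IsBounded B) :
    ∀ᶠ k in atTop, B ⊆ innerBox (L k) := by
  obtain ⟨r, hr⟩ := hB.subset_closedBall 0
  obtain ⟨K, hK⟩ := exists_nat_ge r
  filter_upwards [eventually_ge_atTop K] with k hk x hx
  have h1 := hr hx
  rw [mem_closedBall_zero_iff, Prod.norm_def, max_le_iff, Real.norm_eq_abs, Real.norm_eq_abs,
    abs_le, abs_le] at h1
  have h2 : ((k : ℕ) : ℝ) + 1 ≤ L k := by exact_mod_cast lt_scale h hL k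
  have h3 : (K : ℝ) ≤ k := by exact_mod_cast hk
  exact ⟨⟨by linarith, by linarith⟩, by linarith, by linarith⟩

theorem ae_exists_cycle [IsProbabilityMeasure μ] (h : ∀ k, IsScale μ (L k) (q k) (Φ k) (R k))
    (hL : ∀ k, L (k + 1) = 3 * L k) (hq : Summable q) :
    ∀ᵐ ω ∂μ, ∀ B : Set (ℝ × ℝ), Bornology.IsBounded B →
      ∃ (v : ℤ × ℤ) (c : (openSubgraph squareLattice ω).Walk v v), c.IsCycle ∧ Encloses c B := by
  filter_upwards [ae_eventually_boxOpen h hq 9] with ω hω B hB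
  obtain ⟨k, hk, hkB⟩ := (hω.and (exists_subset_innerBox h hL hB)).exists
  obtain ⟨v, c, hc, he⟩ := (h k).exists_cycle hk
  exact ⟨v, c, hc, fun x hx => he x (hkB hx)⟩

theorem blockRect_finite (L : ℕ) (i i' j j' : ℤ) : (blockRect L i i' j j').Finite :=
  ((Set.finite_Ico _ _).prod (Set.finite_Ico _ _)).subset fun _ hw => ⟨hw.1, hw.2⟩

/-- A vertex of an infinite component is joined to the rings at all large open scales. -/
theorem eventually_reachable_ring (h : ∀ k, IsScale μ (L k) (q k) (Φ k) (R k))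
    (hL : ∀ k, L (k + 1) = 3 * L k) {ω : BondConfig squareLattice}
    (hω : ∀ᶠ k in atTop, BoxOpen 9 (Φ k ω)) {u : ℤ × ℤ}
    (hu : ((openSubgraph squareLattice ω).connectedComponentMk u).supp.Infinite) :
    ∀ᶠ k in atTop, (openSubgraph squareLattice ω).Reachable u (R k ω (2, -2)) := by
  filter_upwards [hω, exists_subset_innerBox h hL (Bornology.isBounded_singleton (x := toPlane u))]
    with k hk hku
  obtain ⟨v, hv, hv'⟩ := hu.exists_notMem_finite (blockRect_finite (L k) (-2) 2 (-2) 2)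
  refine (h k).reachable_ring hk (hku rfl) hv' ?_
  exact (SimpleGraph.ConnectedComponent.exact hv).symm

/-- The row of blocks from (2, -2) to (9, -2) at scale `k` starts inside the next ring. It ends
beyond it, because that ring lies left of the abscissa `3 * L (k + 1) = 9 * L k`. Hence the row
meets the next ring, and this explains the box size 9. -/
theorem reachable_ring_succ (h : ∀ k, IsScale μ (L k) (q k) (Φ k) (R k))
    (hL : ∀ k, L (k + 1) = 3 * L k) {ω : BondConfig squareLattice} {k : ℕ}
    (hk : BoxOpen 9 (Φ k ω)) (hk' : BoxOpen 9 (Φ (k + 1) ω)) :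
    (openSubgraph squareLattice ω).Reachable (R k ω (2, -2)) (R (k + 1) ω (2, -2)) := by
  have hc := (h k).connIn_row hk (i := 2) (i' := 9) (j := -2) (by simp) (by simp) (by simp)
    (by simp)
  have hLk := (h k).pos
  refine (h (k + 1)).reachable_ring hk' (v := R k ω (9, -2)) ?_ ?_ ?_
  · obtain ⟨⟨h1, h2⟩, h3, h4⟩ := (mem_block_iff hLk).1 ((h k).mem_block ω (2, -2))
    generalize R k ω (2, -2) = z at h1 h2 h3 h4 ⊢
    simp only at h1 h2 h3 h4
    have e1 : (-(3 * L k : ℤ) : ℝ) ≤ z.1 := by exact_mod_cast (by omega)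
    have e2 : (z.1 : ℝ) < (4 * (L k : ℤ) : ℤ) := by exact_mod_cast (by omega)
    have e3 : ((-2 * (L k : ℤ) : ℤ) : ℝ) ≤ z.2 := by exact_mod_cast (by omega)
    have e4 : (z.2 : ℝ) < (4 * (L k : ℤ) : ℤ) := by exact_mod_cast (by omega)
    push_cast at e1 e2 e3 e4
    simp only [innerBox, toPlane, hL, Set.mem_ofPred_eq]
    push_cast
    exact ⟨⟨by linarith, by linarith⟩, by linarith, by linarith⟩
  · rintro ⟨⟨-, h1⟩, -⟩
    have h2 := ((mem_block_iff hLk).1 ((h k).mem_block ω (9, -2))).1.1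
    rw [hL] at h1
    push_cast at h1
    omega
  · exact hc.elim fun p _ => p.reachable

/-- From some scale on all rings lie in one component. It is infinite because the representative of
block (2, -2) has abscissa at least `2 * L k`, and every infinite component meets all sufficiently
large rings. -/
theorem ae_existsUnique_infinite_component [IsProbabilityMeasure μ]
    (h : ∀ k, IsScale μ (L k) (q k) (Φ k) (R k)) (hL : ∀ k, L (k + 1) = 3 * L k)
    (hq : Summable q) :
    ∀ᵐ ω ∂μ, ∃! K : (openSubgraph squareLattice ω).ConnectedComponent, K.supp.Infinite := by
  filter_upwards [ae_eventually_boxOpen h hq 9] with ω hω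
  obtain ⟨K, hK⟩ := eventually_atTop.1 hω
  have hreach : ∀ k, K ≤ k →
      (openSubgraph squareLattice ω).Reachable (R K ω (2, -2)) (R k ω (2, -2)) := by
    intro k hk
    induction k, hk using Nat.le_induction with
    | base => exact .refl _
    | succ k hk ih => exact ih.trans (reachable_ring_succ h hL (hK k hk) (hK _ (by omega)))
  refine ⟨(openSubgraph squareLattice ω).connectedComponentMk (R K ω (2, -2)), ?_, ?_⟩
  · intro hfin
    obtain ⟨b, hb⟩ := (hfin.image fun w : ℤ × ℤ => w.1).bddAbove
    have hk := (mem_block_iff (h _).pos).1 ((h (K + b.toNat)).mem_block ω (2, -2))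
    have h1 := hb ⟨R (K + b.toNat) ω (2, -2),
      SimpleGraph.ConnectedComponent.sound (hreach _ (by omega)).symm, rfl⟩
    have h2 := lt_scale h hL (K + b.toNat)
    have h3 := hk.1.1
    simp only at h1 h3
    omega
  · intro K' hK'
    induction K' using SimpleGraph.ConnectedComponent.ind with
    | _ u =>
    obtain ⟨k, hk, hk'⟩ := ((eventually_reachable_ring h hL hω hK').and
      (eventually_ge_atTop K)).exists
    exact SimpleGraph.ConnectedComponent.sound (hk.trans (hreach k hk').symm)

end

/-! ### Boundary patterns of a `3 × 3` block

The vertices of a block are numbered `v = 3 y + x`. The edges `{v, v + 3}` have the numbers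
`v < 6`, and the edges from `(x, y)` to `(x + 1, y)` the numbers `6 + 2 y + x`. A set of closed
edges is encoded by the binary digits of a number. -/

/-- Whether `f` holds on `[b, b + 2 ^ k)`. -/
def allBelow (f : ℕ → Bool) : ℕ → ℕ → Bool
  | 0, b => f b
  | k + 1, b => and (allBelow f k b) (allBelow f k (Nat.add b (Nat.pow 2 k)))

theorem of_allBelow {f : ℕ → Bool} {k : ℕ} : ∀ {b : ℕ}, allBelow f k b = true →
    ∀ s, b ≤ s → s < b + 2 ^ k → f s = true := by
  induction k with
  | zero =>
    intro b h s h1 h2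
    obtain rfl : s = b := by omega
    exact h
  | succ k ih =>
    intro b h s h1 h2
    rw [allBelow, Bool.and_eq_true] at h
    rcases lt_or_ge s (b + 2 ^ k) with h3 | h3
    · exact ih h.1 s h1 h3
    · exact ih h.2 s h3 (by rw [pow_succ] at h2; change s < b + 2 ^ k + 2 ^ k; omega)

/-- The vertices `v` such that the edge from `v` to `v + 1` is open. -/
def openRight (s : ℕ) : ℕ :=
  let h := Nat.xor 63 (Nat.shiftRight s 6)
  Nat.lor (Nat.lor (Nat.land h 3) (Nat.shiftLeft (Nat.land h 12) 1))
    (Nat.shiftLeft (Nat.land h 48) 2)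

/-- The vertices `v` such that the edge from `v` to `v + 3` is open. -/
def openUp (s : ℕ) : ℕ := Nat.xor 63 (Nat.land s 63)

/-- Add to the set `c` of vertices the neighbours of its elements. -/
def floodStep (E N c : ℕ) : ℕ :=
  Nat.lor (Nat.lor (Nat.lor c (Nat.shiftLeft (Nat.land c E) 1)) (Nat.land (Nat.shiftRight c 1) E))
    (Nat.lor (Nat.shiftLeft (Nat.land c N) 3) (Nat.land (Nat.shiftRight c 3) N))

/-- Iteration of `floodStep`. -/
def flood (E N : ℕ) : ℕ → ℕ → ℕ
  | 0, c => c
  | n + 1, c => flood E N n (floodStep E N c)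

/-- The number of elements of a set of vertices. -/
def bitCount : ℕ → ℕ → ℕ
  | 0, _ => 0
  | n + 1, c => Nat.add (Nat.mod c 2) (bitCount n (Nat.shiftRight c 1))

/-- Whether the component of `v` contains a majority of the vertices of the block. -/
def inMajority (s v : ℕ) : Bool :=
  Nat.ble 5 (bitCount 9 (flood (openRight s) (openUp s) 8 (Nat.pow 2 v)))

/-- The set of the indices `i` such that the vertex `(2, i)` lies in the majority component. -/
def pattern (s : ℕ) : ℕ :=
  Nat.add (inMajority s 2).toNat (Nat.add (Nat.mul 2 (inMajority s 5).toNat)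
    (Nat.mul 4 (inMajority s 8).toNat))

/-- The values of `pattern`. -/
def patternTable : ℕ :=
  0x1b00001b00003f00003f00003f00003f0010db0410db0090db0490db001fff041fff009fff049fff00000000000000000000000000000000000000000000000000000000000000000000000000000000000000000000000000101b00901b00901b00901b00103f00903f00903f00903f0490db0490db0490db0490db049fff049fff049fff049fff00000000000000001b00001b00003f00003f036fff036fff00201b00201b01201b01201b03603f03603f036fff036fff00000000000001b6db01b6db03ffff03ffff03ffff03ffff01b6db05b6db01b6db05b6db03ffff07ffff03ffff07ffff0020db0926db0926db4926db1b6fffdb6fffdb6fffdb6fff0920db0926db0926db4926db1b6fffdb6fffdb6fffdb6fff01b6db09b6db09b6db49b6db1bffffdbffffdbffffdbffff0db6db0db6db0db6db4db6db1fffffdfffffdfffffdfffff00000000000000000000000000000000000000000000000000000000000000000000000000000000000000000000000000000000000000901b00901b00003f00003f00903f00903f0010db0410db0090db0490db001fff041fff009fff049fff00000000000000000000000000000000000000000000000000000000000000000000000000000000000000000000000000101b00901b00901b00901b00103f00903f00903f00903f0490db0490db0490db0490db049fff049fff049fff049fff0000000000000126db4926db00003f00003fdb6fffdb6fff00201b0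0201b0126db4926db03603f03603fdb6fffdb6fff00000000000001b6db49b6db03ffff03ffffdbffffdbffff01b6db05b6db01b6db4db6db03ffff07ffffdbffffdfffff0020db4926db4926db4926db1b6fffdb6fffdb6fffdb6fff0920db4926db4926db4926db1b6fffdb6fffdb6fffdb6fff01b6db49b6db49b6db49b6db1bffffdbffffdbffffdbffff0db6db4db6db4db6db4db6db1fffffdfffffdfffffdfffff000000000000000000000000000000000000036fff036fff000000000000024024024024000000000000036fff036fff00000000000002d03f02d03f000fff000fff03ffff03ffff0010db0410db02d0ff06d0ff001fff041fff03ffff07ffff000000000000124124924924000000000000db6fffdb6fff000000000000124124924924000000000000db6fffdb6fff00101b00901b12d13f92d93f001fff009fffdbffffdbffff0490db0490db16d1ff96d9ff049fff049fffdfffffdfffff000000000000036fff036fff036fff036fff036fff036fff00201b00201b036fff036fff036fff036fff036fff036fff00000000000003ffff03ffff03ffff03ffff03ffff03ffff01b6db05b6db03ffff07ffff03ffff07ffff03ffff07ffff0020db0926dbdb6fffdb6fffdb6fffdb6fffdb6fffdb6fff0920db0926dbdb6fffdb6fffdb6fffdb6fffdb6fffdb6fff01b6db09b6dbdbffffdb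ffffdbffffdbffffdbffffdbffff0db6db0db6dbdfffffdfffffdfffffdfffffdfffffdfffff000000104104024024924924000fffdb6fffdb6fffdb6fff000000104104024024924924000fffdb6fffdb6fffdb6fff00000010410402d03f92d93f000fffdb6fffdbffffdbffff0010db1451df02d0ff96d9ff001fffdf7fffdbffffdfffff000000924924924924924924000fffdb6fffdb6fffdb6fff000000924924924924924924000fffdb6fffdb6fffdb6fff00101b92d93f92d93f92d93f001fffdbffffdbffffdbffff0490db96d9ff96d9ff96d9ff049fffdfffffdfffffdfffff000000104104db6fffdb6fffdb6fffdb6fffdb6fffdb6fff00201b10611fdb6fffdb6fffdb6fffdb6fffdb6fffdb6fff000000104104dbffffdbffffdbffffdbffffdbffffdbffff01b6db15f7dfdbffffdfffffdbffffdfffffdbffffdfffff0020dbdb6fffdb6fffdb6fffdb6fffdb6fffdb6fffdb6fff0920dbdb6fffdb6fffdb6fffdb6fffdb6fffdb6fffdb6fff01b6dbdbffffdbffffdbffffdbffffdbffffdbffffdbffff0db6dbdfffffdfffffdfffffdfffffdfffffdfffffdfffff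

/-- The flood fill is run once for each of the 4096 sets of closed edges. Afterwards patterns are
looked up as three-bit digits of `patternTable`. -/
theorem pattern_check : allBelow (fun s => Nat.beq (pattern s)
    (Nat.mod (Nat.shiftRight patternTable (Nat.mul 3 s)) 8)) 12 0 = true := by
  decide +kernel

/-! ### Evaluation of polynomials on all sets of edges at once -/

/-- The value of a polynomial at the set `x` of variables: every term consists of a set of variables
and a coefficient. -/
def monoEval (l : List (ℕ × ℕ)) (x : ℕ) : ℕ :=
  (l.map fun t => if t.1 &&& x = t.1 then t.2 else 0).sum

@[simp] theorem monoEval_nil (x : ℕ) : monoEval [] x = 0 := rfl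

@[simp] theorem monoEval_cons (t : ℕ × ℕ) (l : List (ℕ × ℕ)) (x : ℕ) :
    monoEval (t :: l) x = (if t.1 &&& x = t.1 then t.2 else 0) + monoEval l x := by
  simp [monoEval]

@[simp] theorem monoEval_append (l l' : List (ℕ × ℕ)) (x : ℕ) :
    monoEval (l ++ l') x = monoEval l x + monoEval l' x := by
  simp [monoEval]

/-- The sum of the coefficients. -/
def coefSum : List (ℕ × ℕ) → ℕ
  | [] => 0
  | t :: l => Nat.add t.2 (coefSum l)

theorem monoEval_le_coefSum (l : List (ℕ × ℕ)) (x : ℕ) : monoEval l x ≤ coefSum l := by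
  induction l with
  | nil => simp [coefSum]
  | cons t l ih =>
    rw [monoEval_cons]
    refine Nat.add_le_add ?_ ih
    split <;> simp

/-- The terms without the variable `k`, for polynomials in the variables up to `k`. -/
def lowTerms (k : ℕ) (l : List (ℕ × ℕ)) : List (ℕ × ℕ) :=
  l.filter fun t => Nat.blt t.1 (Nat.pow 2 k)

/-- The cofactor of the variable `k`, for polynomials in the variables up to `k`. -/
def highTerms (k : ℕ) (l : List (ℕ × ℕ)) : List (ℕ × ℕ) :=
  (l.filter fun t => Nat.ble (Nat.pow 2 k) t.1).map fun t => (Nat.sub t.1 (Nat.pow 2 k), t.2)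

/-- All values of a polynomial in `k` variables, as digits in base `2 ^ w`. -/
def packPoly (w : ℕ) : ℕ → List (ℕ × ℕ) → ℕ
  | _, [] => 0
  | 0, t :: l => coefSum (t :: l)
  | k + 1, t :: l =>
    Nat.add (packPoly w k (lowTerms k (t :: l)))
      (Nat.shiftLeft (Nat.add (packPoly w k (lowTerms k (t :: l)))
        (packPoly w k (highTerms k (t :: l)))) (Nat.mul w (Nat.pow 2 k)))

theorem two_pow_add_eq_or {k x : ℕ} (hx : x < 2 ^ k) : 2 ^ k + x = 2 ^ k ||| x := by
  simpa using Nat.two_pow_add_eq_or_of_lt hx 1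

theorem and_two_pow_add_eq {k M x : ℕ} (hM : M < 2 ^ k) (hx : x < 2 ^ k) :
    M &&& (2 ^ k + x) = M &&& x := by
  refine Nat.eq_of_testBit_eq fun i => ?_
  rw [two_pow_add_eq_or hx]
  simp only [Nat.testBit_and, Nat.testBit_or, Nat.testBit_two_pow]
  by_cases hi : k = i
  · subst hi
    simp [Nat.testBit_lt_two_pow hM]
  · simp [hi]

theorem two_pow_add_and_two_pow_add {k M x : ℕ} (hM : M < 2 ^ k) (hx : x < 2 ^ k) :
    (2 ^ k + M) &&& (2 ^ k + x) = 2 ^ k + (M &&& x) := by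
  rw [two_pow_add_eq_or hx, two_pow_add_eq_or hM, two_pow_add_eq_or (Nat.and_lt_two_pow _ hx)]
  refine Nat.eq_of_testBit_eq fun i => ?_
  simp only [Nat.testBit_and, Nat.testBit_or, Nat.testBit_two_pow]
  by_cases hi : k = i <;> simp [hi]

theorem monoEval_eq_low {k : ℕ} {l : List (ℕ × ℕ)} {x : ℕ} (hx : x < 2 ^ k) :
    monoEval l x = monoEval (lowTerms k l) x := by
  induction l with
  | nil => rfl
  | cons t l ih =>
    by_cases ht : t.1 < 2 ^ k
    · have : lowTerms k (t :: l) = t :: lowTerms k l := by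
        rw [lowTerms, List.filter_cons_of_pos (by simpa using ht), lowTerms]
      rw [this, monoEval_cons, monoEval_cons, ih]
    · have : lowTerms k (t :: l) = lowTerms k l := by
        rw [lowTerms, List.filter_cons_of_neg (by simpa using ht), lowTerms]
      rw [this, monoEval_cons, ← ih, if_neg, zero_add]
      intro h
      have := Nat.and_le_right (n := t.1) (m := x)
      omega

theorem monoEval_two_pow_add {k : ℕ} {l : List (ℕ × ℕ)} {x : ℕ} (hx : x < 2 ^ k)
    (hl : ∀ t ∈ l, t.1 < 2 ^ (k + 1)) :
    monoEval l (2 ^ k + x) = monoEval (lowTerms k l) x + monoEval (highTerms k l) x := by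
  induction l with
  | nil => rfl
  | cons t l ih =>
    have ih' := ih fun u hu => hl u (by simp [hu])
    by_cases ht : t.1 < 2 ^ k
    · have h1 : lowTerms k (t :: l) = t :: lowTerms k l := by
        rw [lowTerms, List.filter_cons_of_pos (by simpa using ht), lowTerms]
      have h2 : highTerms k (t :: l) = highTerms k l := by
        rw [highTerms, List.filter_cons_of_neg (by simpa using ht), highTerms]
      rw [h1, h2, monoEval_cons, monoEval_cons, ih', and_two_pow_add_eq ht hx, add_assoc]
    · have h1 : lowTerms k (t :: l) = lowTerms k l := by
        rw [lowTerms, List.filter_cons_of_neg (by simpa using ht), lowTerms]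
      have h2 : highTerms k (t :: l) = (t.1 - 2 ^ k, t.2) :: highTerms k l := by
        rw [highTerms, List.filter_cons_of_pos (by simpa using ht), List.map_cons, highTerms]
        rfl
      have h3 : t.1 < 2 ^ (k + 1) := hl t (by simp)
      have h4 : t.1 = 2 ^ k + (t.1 - 2 ^ k) := by omega
      have h5 : (t.1 &&& (2 ^ k + x) = t.1) = ((t.1 - 2 ^ k) &&& x = t.1 - 2 ^ k) := by
        rw [pow_succ] at h3
        rw [h4, two_pow_add_and_two_pow_add (by omega) hx]
        simp
      rw [h1, h2, monoEval_cons, monoEval_cons, ih']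
      simp only [h5]
      ring

/-- Split on the highest variable `k`: arguments without it only see the terms free of it; arguments
with it see, in addition, its cofactor, and their digits are shifted by `w * 2 ^ k` bits. -/
theorem packPoly_eq (w k : ℕ) (l : List (ℕ × ℕ)) (hl : ∀ t ∈ l, t.1 < 2 ^ k) :
    packPoly w k l = ∑ x ∈ Finset.range (2 ^ k), monoEval l x * 2 ^ (w * x) := by
  induction k generalizing l with
  | zero =>
    cases l with
    | nil => simp [packPoly]
    | cons t l =>
      simp only [packPoly, pow_zero, Finset.range_one, Finset.sum_singleton, mul_zero, mul_one]
      generalize t :: l = l at hl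
      induction l with
      | nil => rfl
      | cons t l ih =>
        have h0 : t.1 = 0 := by
          have := hl t (by simp)
          omega
        rw [coefSum, monoEval_cons, ← ih fun u hu => hl u (by simp [hu])]
        simp [h0]
  | succ k ih =>
    cases l with
    | nil => simp [packPoly]
    | cons t l =>
      rw [packPoly]
      generalize t :: l = l at hl
      have h1 : ∀ u ∈ lowTerms k l, u.1 < 2 ^ k := fun u hu => by
        simpa [lowTerms] using (List.mem_filter.1 hu).2
      have h2 : ∀ u ∈ highTerms k l, u.1 < 2 ^ k := fun u hu => by
        obtain ⟨v, hv, rfl⟩ := List.mem_map.1 hu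
        have h3 := hl v (List.mem_filter.1 hv).1
        have h4 : 2 ^ k ≤ v.1 := by simpa using (List.mem_filter.1 hv).2
        rw [pow_succ] at h3
        change v.1 - 2 ^ k < 2 ^ k
        omega
      rw [ih _ h1, ih _ h2]
      change _ + (_ + _) <<< (w * 2 ^ k) = _
      rw [Nat.shiftLeft_eq, pow_succ, mul_two, Finset.sum_range_add, ← Finset.sum_add_distrib,
        Finset.sum_mul]
      congr 1
      · refine Finset.sum_congr rfl fun x hx => ?_
        rw [← monoEval_eq_low (Finset.mem_range.1 hx)]
      · refine Finset.sum_congr rfl fun x hx => ?_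
        rw [monoEval_two_pow_add (Finset.mem_range.1 hx) hl, mul_add w, pow_add]
        ring

/-- The values of `f` on `[b, b + 2 ^ k)`, as digits in base `2 ^ w`. -/
def packFun (w : ℕ) (f : ℕ → ℕ) : ℕ → ℕ → ℕ
  | 0, b => f b
  | k + 1, b => Nat.add (packFun w f k b)
      (Nat.shiftLeft (packFun w f k (Nat.add b (Nat.pow 2 k))) (Nat.mul w (Nat.pow 2 k)))

theorem packFun_eq (w : ℕ) (f : ℕ → ℕ) (k b : ℕ) :
    packFun w f k b = ∑ x ∈ Finset.range (2 ^ k), f (b + x) * 2 ^ (w * x) := by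
  induction k generalizing b with
  | zero => simp [packFun]
  | succ k ih =>
    rw [packFun, ih, ih]
    change _ + _ <<< (w * 2 ^ k) = _
    rw [Nat.shiftLeft_eq, pow_succ, mul_two, Finset.sum_range_add, Finset.sum_mul]
    congr 1
    refine Finset.sum_congr rfl fun x _ => ?_
    rw [mul_add w, pow_add, show Nat.add b (Nat.pow 2 k) + x = b + (2 ^ k + x) from add_assoc _ _ _]
    ring

theorem sum_digits_div_mod {w n : ℕ} {d : ℕ → ℕ} (hd : ∀ i < n, d i < 2 ^ w) {i : ℕ} (hi : i < n) :
    (∑ j ∈ Finset.range n, d j * 2 ^ (w * j)) / 2 ^ (w * i) % 2 ^ w = d i := by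
  induction n generalizing d i with
  | zero => omega
  | succ n ih =>
    rw [Finset.sum_range_succ']
    have h1 : ∑ j ∈ Finset.range n, d (j + 1) * 2 ^ (w * (j + 1)) =
        2 ^ w * ∑ j ∈ Finset.range n, d (j + 1) * 2 ^ (w * j) := by
      rw [Finset.mul_sum]
      refine Finset.sum_congr rfl fun j _ => ?_
      rw [mul_add, pow_add]
      ring
    rw [h1]
    cases i with
    | zero =>
      simp only [mul_zero, pow_zero, mul_one, Nat.div_one]
      rw [Nat.mul_add_mod, Nat.mod_eq_of_lt (hd 0 (by omega))]
    | succ i =>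
      have h2 := ih (d := fun j => d (j + 1)) (fun j hj => hd (j + 1) (by omega)) (i := i) (by omega)
      rw [← h2, mul_add w, mul_one, add_comm (w * i), pow_add, ← Nat.div_div_eq_div_mul]
      simp only [mul_zero, pow_zero, mul_one]
      rw [Nat.mul_add_div (by positivity), Nat.div_eq_of_lt (hd 0 (by omega)), add_zero]

/-- Comparison of all digits of two numbers. -/
theorem digits_le {v n : ℕ} {x y : ℕ → ℕ} (hx : ∀ i < n, x i < 2 ^ v) (hy : ∀ i < n, y i ≤ 2 ^ v)
    (h : ((∑ i ∈ Finset.range n, x i * 2 ^ ((v + 1) * i)) +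
        (∑ i ∈ Finset.range n, 2 ^ v * 2 ^ ((v + 1) * i)) -
        (∑ i ∈ Finset.range n, y i * 2 ^ ((v + 1) * i))) &&&
      (∑ i ∈ Finset.range n, 2 ^ v * 2 ^ ((v + 1) * i)) =
      ∑ i ∈ Finset.range n, 2 ^ v * 2 ^ ((v + 1) * i)) {i : ℕ} (hi : i < n) : y i ≤ x i := by
  -- Adding `2 ^ v` to every digit prevents borrows, so the subtraction is performed digit by digit.
  -- Bit `v` of the resulting digit `x i + 2 ^ v - y i` is set exactly when `y i ≤ x i`, and the
  -- mask tests these bits for all `i` together.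
  have h1 : (∑ i ∈ Finset.range n, x i * 2 ^ ((v + 1) * i)) +
        (∑ i ∈ Finset.range n, 2 ^ v * 2 ^ ((v + 1) * i)) -
        (∑ i ∈ Finset.range n, y i * 2 ^ ((v + 1) * i)) =
      ∑ i ∈ Finset.range n, (x i + 2 ^ v - y i) * 2 ^ ((v + 1) * i) := by
    rw [← Finset.sum_add_distrib, Nat.sub_eq_iff_eq_add, ← Finset.sum_add_distrib]
    · refine Finset.sum_congr rfl fun j hj => ?_
      have := hy j (Finset.mem_range.1 hj)
      rw [← add_mul, ← add_mul]
      congr 1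
      omega
    · refine Finset.sum_le_sum fun j hj => ?_
      rw [← add_mul]
      have := hy j (Finset.mem_range.1 hj)
      exact Nat.mul_le_mul_right _ (by omega)
  have hd : ∀ j < n, x j + 2 ^ v - y j < 2 ^ (v + 1) := fun j hj => by
    have := hx j hj
    rw [pow_succ]
    omega
  have hv : ∀ j < n, 2 ^ v < 2 ^ (v + 1) := fun j _ => Nat.pow_lt_pow_right (by norm_num) (by simp)
  have key : ∀ Z : ℕ, Z.testBit ((v + 1) * i + v) =
      (Z / 2 ^ ((v + 1) * i) % 2 ^ (v + 1)).testBit v := fun Z => by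
    rw [Nat.testBit_mod_two_pow, Nat.testBit_div_two_pow]
    simp [add_comm]
  have h2 := congrArg (fun Z => Z.testBit ((v + 1) * i + v)) h
  simp only [Nat.testBit_and] at h2
  rw [h1, key, key, sum_digits_div_mod hd hi, sum_digits_div_mod hv hi,
    Nat.testBit_two_pow_self, Bool.and_true] at h2
  have h3 : 2 ^ v ≤ x i + 2 ^ v - y i := Nat.ge_two_pow_of_testBit h2
  have h4 := Nat.sub_add_cancel ((hy i hi).trans (Nat.le_add_left _ (x i)))
  have h5 := hx i hi
  generalize 2 ^ v = p at h3 h4 h5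
  omega

/-! ### Verification of certificates -/

/-- The pattern of `s`, read off the table. -/
def patternAt (s : ℕ) : ℕ := Nat.mod (Nat.shiftRight patternTable (Nat.mul 3 s)) 8

theorem pattern_eq {s : ℕ} (hs : s < 4096) : pattern s = patternAt s := by
  have h := of_allBelow pattern_check s (Nat.zero_le _) (by simpa using hs)
  exact Nat.eq_of_beq_eq_true h

/-- The sets of edges with pattern `σ`, as digits in base `2 ^ 40`. -/
def packPattern (σ : ℕ) : ℕ := packFun 40 (fun s => (Nat.beq (patternAt s) σ).toNat) 12 0

/-- The entry `(τ, l, σ)` of a table of bounds, encoded by its digits in base `2 ^ 32`. -/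
def bound (m τ l σ : ℕ) : ℕ :=
  Nat.mod (Nat.shiftRight m (Nat.mul 32 (Nat.add (Nat.mul 64 τ) (Nat.add (Nat.mul 8 l) σ))))
    (Nat.pow 2 32)

/-- The values `g (x / 4096) (patternAt (x % 4096))` for `x < 4096 n`, as digits in base `2 ^ 40`. -/
def packTable (g : ℕ → ℕ → ℕ) (n : ℕ) : ℕ :=
  ((List.range 8).map fun σ => Nat.mul (packPattern σ) ((List.range n).map fun l =>
    Nat.mul (g l σ) (Nat.pow 2 (Nat.mul 163840 l))).sum).sum

/-- Check that `P + off ≥ N + bound m τ` at all points. -/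
def checkLanes (P N : List (ℕ × ℕ)) (m off τ : ℕ) : Bool :=
  and (P.all fun t => Nat.blt t.1 (Nat.pow 2 15)) <| and (N.all fun t => Nat.blt t.1 (Nat.pow 2 15)) <|
  and (Nat.blt (Nat.add (coefSum P) off) (Nat.pow 2 39)) <|
  and (Nat.ble (coefSum N) (Nat.pow 2 38)) <|
  Nat.beq (Nat.land (Nat.sub (Nat.add (packPoly 40 15 ((0, off) :: P))
      (packPoly 40 15 [(0, Nat.pow 2 39)])) (Nat.add (packPoly 40 15 N) (packTable (bound m τ) 8)))
    (packPoly 40 15 [(0, Nat.pow 2 39)])) (packPoly 40 15 [(0, Nat.pow 2 39)])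

theorem bound_lt (m τ l σ : ℕ) : bound m τ l σ < 2 ^ 32 := Nat.mod_lt _ (by norm_num)

theorem patternAt_lt (s : ℕ) : patternAt s < 8 := Nat.mod_lt _ (by norm_num)

theorem sum_range_mul_eq (f : ℕ → ℕ) (a b : ℕ) :
    ∑ x ∈ Finset.range (a * b), f x =
      ∑ l ∈ Finset.range b, ∑ s ∈ Finset.range a, f (a * l + s) := by
  induction b with
  | zero => simp
  | succ b ih => rw [mul_add, mul_one, Finset.sum_range_add, ih, Finset.sum_range_succ]

/-- Write `x = 4096 * l + s`. The product of the indicator digits of a pattern and the shifted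
values `g l σ` has no cross terms, and exactly one `σ` contributes for each `s`. The shift 163840 is
40 · 4096. -/
theorem packTable_eq (g : ℕ → ℕ → ℕ) (n : ℕ) : packTable g n = ∑ x ∈ Finset.range (4096 * n),
    g (x / 4096) (patternAt (x % 4096)) * 2 ^ (40 * x) := by
  have hr : ∀ (f : ℕ → ℕ) (n : ℕ), ((List.range n).map f).sum = ∑ i ∈ Finset.range n, f i :=
    fun f n => rfl
  rw [sum_range_mul_eq, packTable]
  simp only [hr, packPattern, packFun_eq, Nat.mul_eq, zero_add]
  have e : (2 : ℕ) ^ 12 = 4096 := by norm_num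
  rw [e]
  simp only [Finset.sum_mul_sum]
  refine (Finset.sum_congr rfl fun σ _ => Finset.sum_comm).trans (Finset.sum_comm.trans ?_)
  refine Finset.sum_congr rfl fun l _ => Finset.sum_comm.trans (Finset.sum_congr rfl fun s hs => ?_)
  have hs' := Finset.mem_range.1 hs
  rw [Nat.mul_add_div (by norm_num), Nat.div_eq_of_lt hs', Nat.mul_add_mod,
    Nat.mod_eq_of_lt hs', add_zero,
    Finset.sum_eq_single_of_mem (patternAt s) (Finset.mem_range.2 (patternAt_lt s))]
  · have h2 : (Nat.beq (patternAt s) (patternAt s)).toNat = 1 := by simp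
    rw [h2]
    change 1 * 2 ^ (40 * s) * (g l (patternAt s) * 2 ^ (163840 * l)) = _
    rw [mul_add, pow_add, ← mul_assoc 40]
    ring
  · intro σ _ hσ
    have h2 : (Nat.beq (patternAt s) σ).toNat = 0 := by
      rw [Bool.eq_false_iff.2 fun h => hσ (Nat.eq_of_beq_eq_true h).symm, Bool.toNat_false]
    rw [h2, zero_mul, zero_mul]

/-- One comparison of large numbers proves all 2^15 inequalities. The conditions on the coefficient
sums, together with `bound_lt`, keep the two digits below 2^39 and at most 2^39, so that `digits_le`
applies with digits in base 2^40. -/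
theorem of_checkLanes {P N : List (ℕ × ℕ)} {m off τ : ℕ}
    (h : checkLanes P N m off τ = true) {s l : ℕ} (hs : s < 4096) (hl : l < 8) :
    monoEval N (4096 * l + s) + bound m τ l (patternAt s) ≤ monoEval P (4096 * l + s) + off := by
  rw [checkLanes, Bool.and_eq_true, Bool.and_eq_true, Bool.and_eq_true, Bool.and_eq_true] at h
  obtain ⟨h1, h2, h4, h5, h6⟩ := h
  replace h1 : ∀ t ∈ P, t.1 < 2 ^ 15 := fun t ht => Nat.le_of_ble_eq_true (List.all_eq_true.1 h1 t ht)
  replace h2 : ∀ t ∈ N, t.1 < 2 ^ 15 := fun t ht => Nat.le_of_ble_eq_true (List.all_eq_true.1 h2 t ht)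
  replace h4 : coefSum P + off < 2 ^ 39 := Nat.le_of_ble_eq_true h4
  replace h5 : coefSum N ≤ 2 ^ 38 := Nat.le_of_ble_eq_true h5
  replace h6 := Nat.eq_of_beq_eq_true h6
  simp only [Nat.add_eq, Nat.sub_eq, Nat.pow_eq] at h6
  have e : (2 : ℕ) ^ 15 = 4096 * 8 := by norm_num
  rw [packPoly_eq 40 15 _ (by simpa using h1), packPoly_eq 40 15 _ h2, packTable_eq, ← e,
    packPoly_eq 40 15 [(0, 2 ^ 39)] (by simp)] at h6
  simp only [add_mul, Finset.sum_add_distrib, monoEval_cons, monoEval_nil, Nat.zero_and, if_true,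
    add_zero] at h6
  have hx : 4096 * l + s < 2 ^ 15 := by omega
  have := digits_le (v := 39) (n := 2 ^ 15) (x := fun x => off + monoEval P x)
    (y := fun x => monoEval N x + bound m τ (x / 4096) (patternAt (x % 4096)))
    (fun i _ => by have := monoEval_le_coefSum P i; omega)
    (fun i _ => by
      have := monoEval_le_coefSum N i
      have := bound_lt m τ (i / 4096) (patternAt (i % 4096))
      omega) (by
      simp only [add_mul, Finset.sum_add_distrib, Nat.reduceAdd]
      exact h6) hx
  rw [Nat.mul_add_div (by norm_num), Nat.div_eq_of_lt hs, Nat.mul_add_mod,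
      Nat.mod_eq_of_lt hs, add_zero] at this
  omega

/-- The edges that share a vertex with the edge `e`. The edges of a block have the numbers `e < 12`,
and `12 + i` is the number of the edge from the vertex `(2, i)` to the other block. -/
def neighbourMask (e : ℕ) : ℕ :=
  Nat.mod (Nat.shiftRight 0x1208111210849860306119b031b218c030f5120f120a12ca901e90149 (Nat.mul 15 e)) (Nat.pow 2 15)

/-! An entry of a certificate consists of a coefficient, a set of edges of a block and its links,
one such edge, and a set of patterns of the other block. -/

/-- The coefficient of an entry. -/
def entryCoef (c : ℕ) : ℕ := Nat.shiftRight c 27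

/-- The set of edges of an entry. -/
def entryMono (c : ℕ) : ℕ := Nat.mod (Nat.shiftRight c 12) (Nat.pow 2 15)

/-- The distinguished edge of an entry. -/
def entryEdge (c : ℕ) : ℕ := Nat.mod (Nat.shiftRight c 8) 16

/-- Whether the entry is used for the pattern `τ`. -/
def entryHas (c τ : ℕ) : Bool := Nat.testBit c τ

/-- The distinguished edge has to be far from the other edges. -/
def validEntry (c : ℕ) : Bool :=
  and (Nat.blt (entryEdge c) 15) <|
  and (Nat.beq (Nat.land (entryMono c) (neighbourMask (entryEdge c))) 0) <|
  or (Nat.blt (entryEdge c) 12) (Nat.beq (Nat.mod c 256) 255)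

/-- The terms of the entries for `τ`, times the variable of the distinguished edge. -/
def edgeTerms (k τ : ℕ) (l : List ℕ) : List (ℕ × ℕ) :=
  (l.filter fun c => entryHas c τ).map fun c =>
    (Nat.lor (entryMono c) (Nat.pow 2 (entryEdge c)), Nat.mul k (entryCoef c))

/-- The terms of the entries for `τ`. -/
def monoTerms (k τ : ℕ) (l : List ℕ) : List (ℕ × ℕ) :=
  (l.filter fun c => entryHas c τ).map fun c => (entryMono c, Nat.mul k (entryCoef c))

/-- The polynomial of an entry: a multiple of the product of the centered variable of the
distinguished edge and the variables of the other edges. -/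
def entryVal (num den c τ x : ℕ) : ℤ :=
  if entryHas c τ = true ∧ entryMono c &&& x = entryMono c then
    (entryCoef c : ℤ) * (den * (x.testBit (entryEdge c)).toNat - num) else 0

/-- The sum of the polynomials of the entries. -/
def entriesVal (num den : ℕ) (l : List ℕ) (τ x : ℕ) : ℤ :=
  (l.map fun c => entryVal num den c τ x).sum

theorem lor_two_pow_and_eq_iff (M e x : ℕ) :
    (M ||| 2 ^ e) &&& x = M ||| 2 ^ e ↔ M &&& x = M ∧ x.testBit e = true := by
  simp only [Nat.eq_iff_testBit_eq, Nat.testBit_and, Nat.testBit_or, Nat.testBit_two_pow]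
  constructor
  · intro h
    refine ⟨fun i => ?_, ?_⟩
    · have := h i
      cases hM : M.testBit i <;> simp_all
    · simpa using h e
  · rintro ⟨h1, h2⟩ i
    have := h1 i
    by_cases hi : e = i
    · subst hi
      simp [h2]
    · simpa [hi] using this

/-- The product of `den * x_e - num` and a monomial is a difference of two monomials with natural
coefficients, so signed certificates are checked within the natural numbers. -/
theorem entriesVal_eq (num den : ℕ) (l : List ℕ) (τ x : ℕ) : entriesVal num den l τ x =
    (monoEval (edgeTerms den τ l) x : ℤ) - monoEval (monoTerms num τ l) x := by
  induction l with
  | nil => rfl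
  | cons c l ih =>
    rw [entriesVal, List.map_cons, List.sum_cons, ← entriesVal, ih]
    by_cases h : entryHas c τ = true
    · have h1 : edgeTerms den τ (c :: l) = (entryMono c ||| 2 ^ entryEdge c, den * entryCoef c) ::
          edgeTerms den τ l := by
        rw [edgeTerms, List.filter_cons_of_pos (p := fun c => entryHas c τ) h, List.map_cons, edgeTerms]
        rfl
      have h2 : monoTerms num τ (c :: l) = (entryMono c, num * entryCoef c) ::
          monoTerms num τ l := by
        rw [monoTerms, List.filter_cons_of_pos (p := fun c => entryHas c τ) h, List.map_cons, monoTerms]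
        rfl
      rw [h1, h2, monoEval_cons, monoEval_cons, entryVal]
      simp only [lor_two_pow_and_eq_iff, h, true_and]
      by_cases hM : entryMono c &&& x = entryMono c
      · cases he : x.testBit (entryEdge c) <;> simp [hM] <;> ring
      · simp [hM]
    · have h1 : edgeTerms den τ (c :: l) = edgeTerms den τ l := by
        rw [edgeTerms, List.filter_cons_of_neg (p := fun c => entryHas c τ) h, edgeTerms]
      have h2 : monoTerms num τ (c :: l) = monoTerms num τ l := by
        rw [monoTerms, List.filter_cons_of_neg (p := fun c => entryHas c τ) h, monoTerms]
      rw [h1, h2, entryVal, if_neg (fun h' => h h'.1), zero_add]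

/-- Two blocks with patterns `σ`, `τ` and the set `l` of closed links are not connected. -/
def isSeparated (σ τ l : ℕ) : Bool := Nat.beq (Nat.land (Nat.land σ τ) (Nat.xor 7 l)) 0

/-- Check of a certificate with lists `cp`, `cn` of positive and negative entries. -/
def checkCertificate (num den K c₀ off m : ℕ) (cp cn : List ℕ) : Bool :=
  and (cp.all validEntry) <| and (cn.all validEntry) <|
  and (allBelow (fun τ => checkLanes (edgeTerms den τ cp ++ monoTerms num τ cn)
    (monoTerms num τ cp ++ edgeTerms den τ cn) m off τ) 3 0) <|
  allBelow (fun σ => allBelow (fun τ => allBelow (fun l => Nat.ble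
    (Nat.add (Nat.mul (isSeparated σ τ l).toNat K) (Nat.add off off))
    (Nat.add c₀ (Nat.add (bound m τ l σ) (bound m σ l τ)))) 3 0) 3 0) 3 0

/-- The two blocks interact only through their patterns and the links. For a fixed pattern `τ` of
the other block, `bound m τ l σ - off` bounds the polynomial of one block from below over all its
configurations with pattern `σ`. Adding the bounds for both blocks leaves 8³ inequalities; `off`
only keeps the bounds nonnegative. -/
theorem le_of_checkCertificate {num den K c₀ off m : ℕ} {cp cn : List ℕ}
    (h : checkCertificate num den K c₀ off m cp cn = true) {a b l : ℕ} (ha : a < 4096)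
    (hb : b < 4096) (hl : l < 8) :
    ((isSeparated (patternAt a) (patternAt b) l).toNat * K : ℤ) ≤ c₀ +
      (entriesVal num den cp (patternAt b) (4096 * l + a) -
        entriesVal num den cn (patternAt b) (4096 * l + a)) +
      (entriesVal num den cp (patternAt a) (4096 * l + b) -
        entriesVal num den cn (patternAt a) (4096 * l + b)) := by
  rw [checkCertificate, Bool.and_eq_true, Bool.and_eq_true, Bool.and_eq_true] at h
  obtain ⟨-, -, h1, h2⟩ := h
  have key : ∀ τ < 8, ∀ s < 4096, (bound m τ l (patternAt s) : ℤ) ≤ off +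
      (entriesVal num den cp τ (4096 * l + s) - entriesVal num den cn τ (4096 * l + s)) := by
    intro τ hτ s hs
    have := of_checkLanes (of_allBelow h1 τ (Nat.zero_le _) (by simpa using hτ)) hs hl
    rw [monoEval_append, monoEval_append] at this
    rw [entriesVal_eq, entriesVal_eq]
    zify at this
    linarith
  have h3 := Nat.le_of_ble_eq_true (of_allBelow (of_allBelow (of_allBelow h2 (patternAt a)
    (Nat.zero_le _) (by simpa using patternAt_lt a)) (patternAt b) (Nat.zero_le _)
    (by simpa using patternAt_lt b)) l (Nat.zero_le _) (by simpa using hl))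
  have h4 := key _ (patternAt_lt b) a ha
  have h5 := key _ (patternAt_lt a) b hb
  simp only [Nat.add_eq, Nat.mul_eq] at h3
  zify at h3
  linarith

/-- The digits in base `2 ^ 40`. -/
def unpackDigits : ℕ → ℕ → List ℕ
  | 0, _ => []
  | n + 1, x => Nat.mod x (Nat.pow 2 40) :: unpackDigits n (Nat.shiftRight x 40)

/-! ### The certificates -/

/-- The positive entries of the certificate for the closing probability `1543 / 10000`. -/
def positiveEntriesOne : List ℕ := unpackDigits 605
  0x14f3000eff06e2310eff0192301eff09a2210eff151a084eff0bca080eff0bea046eff0c0a007eff1bda006eff090a004eff06c2000eff03d9212eff1af1204eff07e9200eff1c19016eff0431000eff0430600eff01c0310eff0bd0280eff05f0242eff08e8200eff0590084eff01a0080eff0628000eff14ed000dff0b14080dff06ac000dff0af1800dff06b1000dff0a70900dff0950800dff0a38180dff0110100dff0948080dff05a8000dff14f6000cff1ae4220cff0414212cff07ec200cff1bb4032cff0434000cff1512820cff0ba2800cff0bc2430cff0232308cff072a302cff09ba202cff0ba2038cff1bca030cff093a020cff06c2000cff0bd8a00cff05e0820cff0198800cff05a8610cff0128302cff0418240cff0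8f8200cff0628000cff0bdb000bff382b000b80031a200b080092105bff0a4a100bff019a100b081f62084b8014ea080b800aca046b800632000b55097a000bff2cea000b401591204bff1809204b800ba9200bff12b1200b8010f9106bff0199106b8003c1006bff00d1004bff0141004b8001d1000bff02f1000b8005a9000b200218301bff2000280bff0ca8280b801858242bff0818242b801588240bff0848240b8013f8204b5504d8204bff1090204b400428204b100400204b081208203bff0118203b800cd0202bff0670200bff0990200b4024a0182bff0db0180bff0418144b800380104bff0158100bff0478082bff03e0080bff07d8080b200ba0006bff1110006b800798004b5502f8004bff01d0004b400d58004b200310004b1000a8002bff0100002b8006c8000bff01e8000b400210000b2004b8000b10035d220aff093c200a0f0464200aff04ec121aff02dc121a8003a3200a800552301aff021a200aff0382120a801211204aff0c01204a801a81200a800b91106aff04e9106a800411000a8008b0320aff0488301aff02b0284a8015f0280aff06e8280a800a88260a800928244aff05f0244a8004a8224a801080222aff0d68222a800030221aff0370204a550a88204aff0470204a100828200aff0778200a4003a0200a200748160aff0350144aff1c88106aff0638106a8004e0105aff09f0104aff04b0102aff00d0101aff0c000a2aff01c00a2a8003500a0a801118086aff0350080aff1350062a800188042a8007d8022a8008e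8006aff06d8006a800340004aff0618004a400158000aff0108000a4008250009ff192d000980001c40090f002c4009ff0adc0809ff1344080980003c0489801a7c04098006c4000955091c0009ff08240009801f3c0009400ae18009ff131180098000414019801a3940098000390409ff07b100090f09290009ff08110009801f590009081f688809ff04f888098014788409ff00d884098006d08009ff098080094014804809ff00b048098008284009ff065840094006c00809ff099808090800180489ff08380409ff002004098005d004090808e80009ff00d000094000a80009080070000901054a80080f092a8008ff0352800808051208085508ea0808ff037a080840022a0008ff0da08808ff0ff88448ff07b084488002208048ff064880488003388008ff0f984a08ff07884a088001004608ff01304448ff00b04208ff09d84048ff02580a08ff05880a088003500808ff0a400608ff00b80448ff05500208ff04c00048ff00d00008ff0c0e0007ff37ce000780156c2207ff17c42207800bac2007ff12d420078010d41307ff015c130780037c0307ff00cc0207ff01a402078001cc0007ff02f400078005ec0007201f1282078014ca8007800d1243078002c220074001421287ff0a121007ff01ca100740061a00070f09720007ff2d9a0007081ff8a007ff0ce8a0078024d89107ff0db09007ff031082073304808107ff03d88007ff07e080072018d86107ff087861078015906007ff0810600780065052078001d03087ff13e822070f05602207ff04302207401048220708041822070212282187ff01802187800ca02107ff06602007ff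09c020070804101207ff01681007ff0b700307ff10e003078007c802070f02f80207ff0d48020720023002070802f802070200b00107ff00f001078006b00007ff020800072001f00007080490000702034e200680041d2246ff11dc2206ff0bf42206801ac42006800b541306ff05ac130680041c00068005da3086ff02b22006ff093920065504512006ff042910c6ff01e910c68003d8a2068015e8a006ff0750a0068010c88306ff0be88146ff01f8814680036080468003508006ff09b06206ff06486206800a2060468002485206ff08185046ff1370414680017841068004103086ff09a83046ff0548224680035022060f0ae82206ff046022060210702146ff0df821468000202086ff08302006ff041020062007002006081c981306ff05a813068005301286ff0a501206ff04a01106ff00e01086ff09100306ff066803068003500206ff066802060808d001468001580006ff00f0000608001901058002d10005802989000520168900050800f85805ff00105405ff095044258004204105ff004819058003781805ff1d381505ff00b815058005a01485ff01981105ff009010a5ff01a010a54000a00985ff00b00915ff0b000905ff0b08090580035808050f0b680805ff08980805200228080508035005258000700505ff002804250f00480185ff064001358005200115ff06800105ff05780105400bc800a5ff03d800a580015800a54000680035ff14b00025ff0798002508027000050f03800005550d180005ff12f800051001280005080abc0a04ff04bc0204ff071400440f1bf30204ff245b020480048a0a44ff0a9208448001020604ff044a02c4800a1a0204550b6a0204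ff1b32020440061200443307c10854ff06410844ff03f108448004990244800be902048001400a84ff01200a848003900a44ff02800a448000100a14ff0a780a04ff15180a0480002008c4ff06a808448000e00804ff00d808048008100604ff0390060480029802448009280214ff0d78020440060002042004a000c4ff0c800054ff0960005480049800445514780044ff08f800444003b800441005780004ff01e8000440075c8223ff028c8203ff00540143ff06732003ff0bb320038002aa20034002220343800dc92143ff12a1214380068921038004c08063ff12482903ff01d829038001c82843ff05382403ff02102403800b882223ff1500222380048822234027482143ff18c821438003102103ff10482063ff055820638008d80a23ff06100943ff03a009438005d00303ff09b00223ff0fa8022380031002234003400203ff06480163ff090001638002280043ff03a00023ff002400228002f4000280166c0002402a6400022001789402ff00b090228003189002ff0b288022ff0b2080228003c08002550bc88002ff021880024008b880022000c85402ff1d505022ff012050228005885012ff092845028002d8412280000841025500a84022ff00a81112ff016811120802881022ff00081012ff04880422ff05f801a2800bc80112ff03b8011280014801120814c00102ff070801024004e800a2ff00f80032ff06700022ff0570002208038000020f02700002550d000002ff00e800024012d80002021bee0041ff243600418008148281ff059c8201ff02dc82018004f40241800bbc00418005ea8241ff0afa82018000ca4041ff044a025180065a0201330a9200410f0aa2004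1ff1b920041080a698041ff071102015504790041ff04108241ff02b082418000288211ff0678820180007080c1ff01788051ff01908051800a988041ff152880418000d88001ff00e880018007f04041ff03a04041800c880281ff088802818002e002418004100211ff041802010f14680201ff09700201080358020102095800c1ff06200041200d8000410805900001ff0200000108061e2000ff0b862000800dac2220ff128422208006c4202080027a200008023a02608006f10940ff02310840ff02b0a200ff1220a020ff01b8a0208006188220ff037082208009f08140ff05286000ff02086000800fe02300ff054823008027502220ff18902220800b482140ff149021408004c821400803082020ff04600b00ff06500320ff087803208001300300ff02080200ff09b80140ff0f70014080032001400803b00100ff05b80060ff03600040ff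

/-- The negative entries of the certificate for the closing probability `1543 / 10000`. -/
def negativeEntriesOne : List ℕ := unpackDigits 465
  0x1a33200eff037a302eff08fa280eff0b22202eff050a200eff0392182eff25f2086eff03ea016eff0c71610eff0d61414eff2591214eff0569046eff0e58610eff02e8406eff0120308eff0070302eff1668290eff0a48284eff0730282eff07a8214eff0df0210eff01c0182eff0410086eff066001ceff0b44182dff0aa9910dff1d58910dff0628890dff05b0882dff1c18182dff1a36200cff05d4430cff0cc4242cff2594222cff0d64062cff0932a00cff031a910cff25fa830cff039a310cff0a72210cff0562200cff0432032cff0a50a20cff0748a10cff1638a02cff01a0910cff03b8830cff0068310cff0150301cff0eb8242cff0768222cff0de8202cff02c0070cff0640023cff08fb200bff132b000b0f0e9b000b0801f2300bff05f2240bff04e2204bff0372204b80050a202bff049a200bff0d1a182bff046a182b8003f2106bff051a106b8000f2100b550cb2086bff1262086b80121a082b80013a004bff0582004b08005a002b800e52000b0f06ba000b0406f9304bff0251304b8008d1300b8004a9242bff0ad9242b8016d1206bff11e9206b800b79202bff0c91202b8007f9046bff0641046b801280380bff02c0380b8003c8308bff0318302bff0140301b800918284bff07d8282bff19a0244bff0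710244b8012e0206bff05e0206b800270204b030598204b050298204b8003c8204b010258202b550070200b0307c0184bff0648106b800050103bff12a8086bff0ec0086b8001d0084b8002f0046bff0950004b030328004b0503d8004b0f0510004b800150004b010070000b0f00c0000b800dcd224a800d9d220a800bf5204a800955200a800b142a0aff02042a0a8008bc260aff0f44260a80037c240a80080c222aff1304222a8008ec220aff0484220a40034c200a550484200a40066c062aff10e4062a800954022a80074c006aff077c006a8002ba304a80025a046aff085a006aff02d1242a801081224aff0771224a800259206aff0df1206a800349201a800361046a800600304aff0268304a8022102a0aff0dd8224aff0578220aff05a0206aff0010201aff0938200a0f0710200a8003c0184aff05b8124aff05a8026aff0108024a5501d0024aff0350024a4002d0006a0f0c7d0009330f9d000920002440098002bc000933098400091001e90809ff003104098002f100093309f10009020230c009ff00184009030008400980004040092002300c09ff0020040911002804092001100009030318000905009000091103d0000980043e0848ff041b8208ff05828248ff096a82488019228208ff03ca800855020240488005ba0a48ff09d20a488018820848ff03b208080f022a0608800cf88a08ff0cf88848ff01188608ff04008208ff01104848ff06284248ff04400848ff05200648ff04280248ff08e62007ff13360007550eae00074004ac6107ff0af4610780072c4307ff054c430780063c3207ff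034c320780097c30078016d42307ff11fc2307800bac2107ff0c7c2107800cfa9107ff041a9107800cca8307ff124a83078011da81078005726007ff02da3007ff050a2207ff03aa22078004da2107ff04da2007ff03a21307ff04ba13078000e210070f014a0207ff052a020740005a0107800e32000755069a0007041280b007ff02b0b007800938a207ff0758a107ff08209207ff12a88307ff0ec0830780019882078019a06207ff075062078002604307ff03003107ff011030878003c03017ff12f82307ff05882307800530220705027022071102b82207800390220701024021070f0080200711060813078000381187ff02b80207050ad002071103c002075504f802078000e8020701006800075500c00007800e3d2246800c0d2206800df520468008fd200680032c610680038c430680032c2306ff0e5423068010d42246ff083c22468003e420868001aa4306ff032232068008e20306ff0af1a046ff0239a0468008e96046ff0f41604680036960068006a14146ff107141468007f92146ff12d121468008512046ff045920460802f120060f046120060807a90306ff073903068009a10146802220a046ff03889206ff06703206ff029832068005502306ff0dd82246ff0110220680003820c6ff05f02046ff08f0200655077020068004a81246ff04a80346ff0280030655016802460f01480246ff034802460801210005550539000502006058058001285105ff03704125ff03681825ff01f818258000a01405ff00601125ff00601085ff03901025ff0048102580028009258003000835ff02680825ff0300080580035808050103a00435ff0370042580059801a5ff00080135ff008000251106e0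002580020000053307c000058002e80005400a1800050106360204ff02e6020480004400c4ff00d30284800a320044ff0329044480004008c48012a80854ff09d80854801ba00844ff04780644ff072002c4ff10c802445501d00244ff03b0024440020002040f00a00054080a18004403051800448000500014ff013800048006142423ff0dd424238010ac24038014b42223ff112422238006842143ff043c21438002c40303ff092c0223ff07c40223800432214380014a21038001aa204380016a0863ff07610063ff03f900638010488223ff126882238004388203ff04b02443ff035024438007982423ff08c022230f02780863ff0e680463ff051c000210008894028003709102ff01e891028002788182ff02e881228002c08102ff001880a2ff00908032ff02b8800280036880020100e85002ff04084182ff036041028001a81422ff00981122ff02e01102ff007811028001781032ff03900522ff006801a2ff00280182ff06300132ff0100010203070001028001e800023307d000028002e00002080a4000020100ee0051800214420180060b0041ff03730041800a820201ff00110211ff12b08281ff091882818000588211801c008201ff05604241ff009002814007500251ff108802410f02700241ff03a8024108098802011104d802018000580081ff0210004155013800018007ac0300ff044c030080027a8300ff04c2222080028a22008000a220208006716100ff0e1161008010c160008006a12220ff043122208014492140ff112921408000210220ff09190140ff07d901408002710060ff02f08300ff04b86200ff02f062008007286100ff0f884300ff08c021405510600940ff123809408004680840ff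

/-- The bounds of the certificate for the closing probability `1543 / 10000`. -/
def boundsOne : ℕ :=
  0x20608490329df500371c74c03415ea1033ad3cc075b560703471482043b704900d4b3270347aa7900fc53ad030de2a500d3d54304888cc900e57b4b02ed5ab700d4d3ec01016f67034948aa031dda2b01018bed012aff69031d312c0322688c00d4a007010d124b00fb771903455adc00dfb7270117348300eaba810330e11a00d4e13c00d211c200f4ff1000d7981c0348c940048041d7030dfcbb02ef527a00d4c91301078b0500e62c5a00f162950107fbd00336bfd100f0b077032e58f600d4b21c00deeb9a00fa43ef00eb3e2f010eb65d0117e6e50345442c0330a71800d48f8d00ed557c00e6e98200f9107600ed488201042d5500f8e804033b673302411c3c036da1ea047b3f6d0374389603bc8f5b06bf2b5e0480ee6904227d7600c42cf3020668bf025ecb8a02a95b970203d73404149cae039e3aa9032c645100bdc120014f818003ca673b03109dad00fc065f0284e48f034927af03255843009c4898014d3344023440ca03220bd900c87bcb025e49fd02ee505f03010a2900d76b430103bf5f0130bc7d0165acc602a51a0404581afb02f8376a03179c1f00a1d8e400d51a8500d026c100ee124f0204e29802ed2bc7025a21cc02f1f6a700ca864c00d99bcd01207dd20192c93601130f7702177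ee30314e52f0310cdfe00bc131d00e1be8700f5bbf00157744f00f28a3c0203e9aa02954e740312a77101576fc0030d9bc0044f3a580306121003041a2f084a2e8303098a8503a64f8000d13fdc02cc60b001faa30c028f4e1c0120df7804b0b32a02c44dda02da245800c2a6d001cc475303929854026ca37501c77768046aea95027139a302ae35d800ae396e01d79cb701badba20294695100c4119d037425c60254afc102c6f0ea00d1943e0121e6ed01f55ad002c6468902ca02d304a9d92c0289e2dd02e7905400c46f0f012a61ce00e8c01901d36ca0012835cf02c20dea01d8f8150303e9ab00aefd6e00c8bb7d01b65fde0253e02801d2810e037e3039029054f002c7f13100c293a900e534f100ea95fe01b20d6400e2f71802bf968401b45e0c030031d601ddb9540253da0e03a6eb320323b62c0334c8a4062eba7e02d5dd9f036387d500fe2ddd0162fa5c01ca15a4028b7a1701ea802103a9d7bf0232c83402983edc00ef77f500fb22c902a36383027d669c01950efe0273019c022910f30294a05800c6010c00eae45d017d6d45025c36f20168cfb6024dfb0001aeae51025f4c8900ed6aa300fe66c201c6a5ca01bc544c029bfda403fa655802de2fea02fd949f00b7f49100e321220172315c0150db2301c02947028ceea002120f5e02ca101000bdcbad00c8801601893e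ad01a95a2301712c95025a598902d7987202bc704700b0597f00dc3ffa016a19f5017a268a01757f0b02448dbe02085d6a02c45f0f023ed2c603c014ec048440f004834362037133ab06b8b214037d1ae80428b12700d568f602ab64810136768d02ef537b00fb0e53045b9f65017340a5030a3bbb00bbe9fb00ffce3d03d91736034c3bc9014f6d930289fc9303112cf30323c11200c9ac4d011676e50126446603192f5900dc38f802199e2c019e2b7c03142f4500c2f5000205b4e10262128703a4fa19020692f904172fde02a9d6ce032da22700a162aa0206f68400d02091025939a100d5035e02eddacd00ef03a202f2c7ff009b335600c91efe02393f5002f1586b014f605802620449032159ed0302fa6d00bbfb0100f2ccff00f3d0760295fa2c00deb85c0204ab3b0156e25e0313c84b026d79f40319eb4a043c876a039b6130031a95790593dc3703a36a6403f50a020114716e01eac52d01efaf8c02eb34fa01562cc6033840610261bf0d02b8604700ded1b8012338cc031b3a4502ece46d011dc6240255ec7b02ed3d1e02bc48a600c31963012211e701916ab90287fb58010df77a02351ca301e8e3ec02c19e660114d987015b09ac01ed8bc002596c3c01e8ce020334d73402eec97f02c1880700d4c146011f39eb015c920901b16dca011eae45021ecd4701b0b4c902a9780100c32ff8010fdd4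10190196c01e8314f011e491d02330a190288bb1102c24cf600ba7cfc010ff1bb014c5e2201c7779b010f9eff02253f9a01c53aa502abc49c01e2b96f0338ce2a03aa9a4302d08d840252dba80624a3c2032369330369ff3500eb84440298c8bc01cb0d4402d00b6300f55b4d03f2fba701d1bf8a02eaf3a300ee814c0199390b029fb43702227ef500fad7ca02679e51027cf141028fba6d00beaa75017373b8018d09e702cea96100ca975e02534f2401bbd2e802ba897200ffb3f801e7572001c722f00232ef440162fec603ac5f1c0293611b029d9fe500b8bb7801bc0569016f8e3c021082f200e12c13028442af0158bc9602c9758f00c613f10169db95017b7d4801abe8ef00ea90f3025356ee026248970264138700b0f6350176d2bf01656ceb0203a56000d7edb602476e98017fc3d902c267110248140b02aff2d5039ecc23031721e102b5c82b050f5b080318c8b703cf40fe011fb74301c0cb7d0191929a029cc0160141957d02a823b701ecc6e702a7bd72010220880118c447026044df0235244a0114609f01a3cb2d022d14ed0205d10500dad73f010d91a00146ae48020c202300f865d201775fda01685a1002260835012032b5013c72ab018e878f01df13f901c378aa02a4e4bb02a2dee802a8335300dd9fdf011ac3270109af26014336d501190f79018ca43c0146f6b2020590ca00db0d7e00fc0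3d3014475bc016b6edb0109a28601757781020749f60225b26800d02e7700f9e1bb010c78a5014840c400f800f6016576700149cb3602261cc1

/-- The resulting bound is 5720000 / 40000000 = 0.143, the closing probability from which the next
certificate starts. -/
theorem certificateOne : checkCertificate 1543 10000 40000000 5720000 16777216 boundsOne
    positiveEntriesOne negativeEntriesOne = true := by
  decide +kernel

/-- The positive entries of the certificate for the closing probability `143 / 1000`. -/
def positiveEntriesTwo : List ℕ := unpackDigits 376
  0x152b000eff1412084eff0bba080eff23b2006eff0b8a004eff06ca000eff1da9204eff05b1200eff13a9016eff04e9000eff0928310eff0c38280eff0c68242eff09d0200eff0558084eff0170080eff0538000eff1495000dff0814080dff06e4000dff0799800dff06a9000dff06f8800dff0678080dff0510000dff1526000cff1cc4220cff05b4200cff1354032cff04fc000cff165a820cff0b32800cff2012030cff09a2020cff06a2000cff0cd0a00cff03e8820cff0110800cff0ae0610cff0920302cff0028222cff0988200cff0568000cff0b3b000bff3cab000b8002b2084bff2302084b80118a080b800e52046b80005a004b800062002b800162000b55074a000bff035a000b802b22000b401d11204bff20c1204b800cf9200bff0c81200b800601106bff00f9000bff01e1000b800231000b202570280bff0858280b8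01338242bff1b48240bff08c0240b802478204b550158204bff1338204b400c98203bff0bd0202bff0700200bff32a0182bff04a8182b8006a8180bff0008108bff0308080bff0530080b200130040bff0fe0006bff1300006b800610004b400868004b200170002bff0718000bff00b0000b200350000b1007c1204aff07a1204a8022b1200a8001b9106aff04a1000a8007e8320aff1c00280aff0668280a800bd0260a800f10244aff10a0222aff1150222a801570204aff0318200a5507f0200aff08e81a0a802810106aff0ee8106a800c80104aff0688102aff0078101aff11680a2aff08e00a2a800268080aff1bd8062a8001f0042a800018024aff0b18006aff00e8000aff052d0009ff2b4500098008b40809ff0a9c080980215c04098009740009ff07a40009801f4c00094009618009ff0a59800980206940098009190009ff06f90009801d2900090823c88809ff17c08409ff06b08009ff055880094018304809ff05284009ff06700809ff04e808090805800409ff06400009ff01d28208ff06ba80080f00920a48ff001a0a4880013202488006688808ff0d308448ff029084488009b880488007908008ff0d704a08ff02084a088002a84048ff08800a088008880808ff01d00608ff03b80208ff03780048ff01500008ff0bae0007ff3d060007801cd42207ff214c2207800c4c2007ff0c5420078007641307ff015c0007ff011c00078001428207ff22ca82078011aa8007800e7a430780019a1007ff001a020780029200070f06ca0007ff03e2000780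2a620007082568a007ff0a18a0078033309107ff06d09007ff02f88007ff054880072012c06107ff03186107801bf06007ff077860078001404007ff234022070f02b02207ff13d02207080c782187ff0b482107ff06b82007ff00181117800fc80307ff13780307800928020720043802070801680107ff06f00007ff00b00007200358000702067c2206ff0934220680238c20068002841306ff04cc0006801b58a006ff08e0a0068009509046ff09a890468010d88146ff07b881468002708006ff10006206ff0c406046801bf0414680021841068007303046ff14002206ff0da02146ff0fc0214680022820060f08182006ff27d01306ff0f301306800cf01206ff06501106ff00781086ff0bd80306ff00f00006ff02a1000580272900052014c100050806d05805ff01305805800e1044258000684105ff26581505ff06d015058000781125ff07f010a5ff00101085ff04381005ff0da00905ff08a009058001a008a5ff10480805ff020008058001a808052002f004250f00c00135ff0bb00105ff0e6800a5ff00380085ff00500035ff17000025ff066800250805d800055512600005ff13980005101f5b0204ff273b02048001b208448001fa02045506a20204ff1d1a02044004a10244800e1102048006910044ff0e580a04ff21000a0480092008448001900804ff02e802448004580204ff0db8020440061800c4ff11d80054ff052800548016a00044ff11d800444005e00004ff01200004400cc12143ff0d5121438007208123ff0fd02903ff00302903800a202223ff1a182223802ac82143ff2c3821438001e82103ff11e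82063ff09900a23ff06a00223ff138002238003300203ff04f00163ff02e801638007080063ff03480023ff005c002280129c00024023e400022006089402ff01309402800da88022ff08f880228011588002ff02b0800280025880022027305022ff06805022800e9045028002f841025509481112ff00a01012ff04201002ff00d00422ff008001a2ff019801a2800f000112ff16980102ff06c80102400b700022ff00280012ff049800020f12e80002ff123800020222c60041ff29fe004180099c02418008940201ff03d400418001c2820180012200410f07020041ff1d1200410808b88201800e588041ff20e880418001888001ff11980281ff065002818003c002418006300211ff17200201ff115802010804700041ff0e9800410805f00001ff01180001080b342220ff0c442220801000a020ff0b108140ff12802300ff2a382220ff2dd822208009002140ff17c821408001c82020ff06280920ff00d80820ff07080320ff06c00300ff06e80140ff125801408003680100ff03200040ff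

/-- The negative entries of the certificate for the closing probability `143 / 1000`. -/
def negativeEntriesTwo : List ℕ := unpackDigits 204
  0x1303200eff0602202eff0452200eff0f62086eff1611610eff1441414eff1d89214eff0128610eff08d8302eff1b60290eff0d80284eff0020214eff0c08210eff04d8910dff0010810dff01b0182dff00f8082dff128e200cff1724242cff19c4222cff14ec062cff0ffa830cff05ba210cff0282200cff0e10a20cff1ca0a02cff0a28310cff0d68202cff110b000b0f0dcb000b080672204bff0522204b80020a106bff01c2100bff09da046bff0362004bff0af2000b0f0271242bff0341242b8012d1206bff0a61206b800799202bff0e39202b800409046bff03a1046b800ba0380bff08a0284bff04e8282bff1f10244bff12a0206bff0e80206b8000e0200b40042810abff01d010ab800260106b8017b0086bff04e8086b8000d0084b800900004b0f0a78004b8003c4260aff0614222aff046c022aff030c022a800ec9224aff04b8304aff2e302a0aff1168224aff0620220aff0558204a800490200a0f02f8200a800a5d000933031d00092004f400093301490009330080400980009804098001d40848ff009c08488000728248ff00aa8248800422404880037a0848ff01f98208ff006182088009d88a08ff09708848ff0a788208ff0a800848ff04f80248ff013002488010a60007550e8e00074000f46107ff046c61078002e44307ff015c43078011442307ff0864230780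07342107ff0eec210780001c00072009fa4307ff03ea2207ff054222078000da1307ff02520207ff0aca0007550c18b007ff0908a207ff0488a107ff01509207ff17988307ff047883078000488207801f086207ff13a02307ff0eb8230780003020070802a013078005d01117ff00c01017ff08e802075509900207800dcc2246ff03f16046ff05f12146ff06190146ff05610146802e18a046ff03d03206ff0dd02246ff07a022068006002046ff055820065503582006800d6100050204104825ff02781405ff04401025ff07f80925ff0b8009258000780505ff0ff00005800a8000050102b60204ff03f602048003e20044ff01b10444ff00b904448010380854ff05680854801eb00844ff0d500644ff01a80604ff0090044480054802445506e00244ff05e00214ff0fd800448000a00014ff0b442223ff0fd40223ff0e488223ff109082238003688203ff01780463ff00680423ff0dfc00021004488502ff07688122ff09b881228001b05002ff00a84022ff00c01122ff04301102ff00400182ff10400002800718000201047c4201ff034442018006a300418005020201ff11588281ff06708281801ea88201ff0df84241ff00e042018001c04041ff04c002410f06100241ff05a8020155107802018005d800c1ff00a80081ff12592140ff10690140ff00d84300ff00984100ff0d980940ff106009408002b00840ff0068084080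

/-- The bounds of the certificate for the closing probability `143 / 1000`. -/
def boundsTwo : ℕ :=
  0x11aa7a101524755014799bb014fb96a0153979b01c30ee701507b080175be1100fc1ffe0139b59a00ff55560136a35900fb52f2016f16b500fbc20e0139d57e00fc1f5100fdab6e013a6b49014312ef00fd253701077a0c013ddc62013afe3600fc1d0d01018e1100ffb54e013b3cfd00fe102e0105dfe700ff063c0139b02800fc1c1400fb8d9a00ff67a300fc39d40139a235016d5da5013644030137f73a00fc1c2e0100ab6d00ff75d100ff677b0100a1c1013a714200ff2fb401394a7000fc180000fe1696010028be01001e2c01015846010637fc013b24020139c4b600fc167100ff090500ff00950100a05700fef7b601049f66010070e0013afcbf0122a53a014150650163f7ee014889100151f069018e54290160310e015b4d4c00fb946b011ab4e401244bef0137b2ac011d0609014ac2dd014401db0146dc8600faa312010e5591014bd0e00138336d01031c7e01295ac30140abd4013581d600f6ac98010ae6a8011f58600137c4e1010266ea0124c436013cac60013257ad00fcbd730101e191010cfb010113185d0129a95d0150bb2c0139cba0013746bf00f78a0700fc209a010148e90103550d011b0c0e012edfff0123026d0130dea700fa200300fd2e6b010a52780112bf7801087da1011e527c0137148d01343c8900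f9303000fd7df3010577cf0109d39701058255011cc2960126214501336cb8010b39200148e36e0169b1b9014697a0014be04901b2eb460145b26a0155dc4d00fb37920138f3fd011ff2f6012f1a460104145b0163e535012f477d0138097400fad7060115c1a3014f319f0133e8f101168baf0150dce00131d4450132dbd000f88b850115f3ef0118a65b0128852800ff9020013d1a6701266e4701312f1b00fbc49e01067de701226c360132af9a013b85e00164cbb701318eb701395e0000fa48bd010676ec010707dc01133a08010645ca01318cb001127127013310de00f8100c01001ffd011b3db601288d160116e569013e53e8012a7a2c01323b6600f95e360102be120106b0cb010feef301028643012b602801105d7101329a710111a2ba0130de6f01524de50143c27b014d29d40183d0400135defe01444ea700fec10d0118d98c01177f3a013a9e0a01168466013f6f28011e8d1f01379b4d00fe9f960103ab3e01361fad012f65ae0113b8700128c5e801202f8a012e2a5800fa0faf00fd9fab010e8481012d5c28010f5bf501235f8f0116c3770127206800fd8eaa0105c90d011d70fb01208b7b01371c7b014a828e0131dd900135881c00f8fbc201009157011248240111516c011413610128907a011b59a1012da22200f8fdf300fe130b0115bd89011b27ad0112afae01281d950130760d013249f800f79d1a00feebd401116c210112c50d01107396012676c8011b05fb012f91ba0121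f3160150c68501632967015ee10d014162b60190c116014a4da901590c2c00fcf4e4012ae415010c746d0138736d0100284a0152a3160110e8600138b9dc00fb11940106c043014afde1014160a3010e957f0128a5590138c4180138180e00fa65c4010892b60109a32c0136931300fd519e011d691f011259cd013628c700fba112011d8fc1012338410142373a011abb63014afee70134d8850144f89500f79be7011a364a01007d2e01212fe000fc23d4012e6cbf010105e50132478d00f6e6ae0101e061011e5e55013cf0df010b2ebf012335c60136f9a80133afe100f93f7d0104ae2c0104a1770124df5b00fd6dd7011b003301093cd20133db2601196e7d0144e8e00159659e0143306e01445967017581a501466ecf01558276010155ea012442070118893001349569010cffdf0138450101287a0b01394be900fe27ea010c8205013b855f012d0d7e0108e96d01225d4f012f0d54012d6d5000fa0007010995d4010f0cdf01303fe101053195011dc6c2011fbba3013023ad01015067010d06aa01184b4c01255d6f01230b990136b46a01386a49013ab18100fad3c10106a4b0010b68c50119c8b90106dc6a011b039e01176e640130b43600fa29570103c6c3010ee5d3011d93050109945e011cedbc01308b7c0130c9f500f9081b0104164b010a0b2a0119665601054dce011b5dd60119545c0131b4f70111ab20014c86770151234d01353a4b013452950185583201460d9b0146099b00fc832d0136491301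1abcff012f65b001027f29014d2f7f011c4d5e0135820e00fea6d60116c9770134f12c0120c579010243f801277703012f1e8f012f4ecc00f93fe00111ba750112eecc012f520100fcb3090127a9760118c1d90132527100ffcce60117596601179728011ef57901176123013ecfcd01391846013a0efd00f9133501124fe30110d6ae0119e8b801008ba10128a0e6010e7bd1012ecfac00fa16e9010ebcd5010eb6a10117b00100fe92f40120f649012d789501284af900f7ce42010f242b010ffe05011a419f00fee0300124e8480111b5cc01307c460113bab8013bbe63014b1aa101385c29013abc4b016f4cf8013d4452014aae31010109e601225e0e010f1b87012e9e780107a56f01314088011fa37f0135be2800ffc12c010b6dd8012d3a620122393901062b78011c28a20125e2d7012738a300fb92c601058d4801059f360126d23800ff3aa40116c24901164dfa0129eb05010201a3010aa632011065500120097f011eec15012f6e960135a4cd01388c2d00fc0e3e0104687501040c0a0115e2b60102f6670113a6e3011532290129577b00fb7abb010101470106ffd70116801b010565b40115a7e80128a580012c1b6400fa42980101da100102ae6f01158053010167cb0114011b01171821012b54bc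

/-- The resulting bound is 516000 / 4000000 = 0.129. -/
theorem certificateTwo : checkCertificate 143 1000 4000000 516000 16777216 boundsTwo
    positiveEntriesTwo negativeEntriesTwo = true := by
  decide +kernel

/-- The positive entries of the certificate for the closing probability `129 / 1000`. -/
def positiveEntriesThree : List ℕ := unpackDigits 300
  0x153b000eff27d2084eff070a080eff2412006eff03ea004eff062a000eff1a61204eff0059104eff0009012eff05d1000eff0dd8280eff0350240eff0a18200eff0090110eff0030084eff0040004eff0528000eff1455000dff0634000dff0639000dff0288800dff0298080dff0648000dff03b6020cff153e000cff19bc220cff05e4000cff267a820cff075a800cff248a030cff048a020cff0632000cff0e08a00cff00f0820cff0478600cff09e8200cff00e8102cff0538000cff087b000bff447b000b800372084bff20da084b8015ea080b800702006b800452000b5502fa000bff0e02000b803dfa000b401131204bff2009204b800de9200bff1699200b800289000b800469000b202250280bff1000280b801eb8240bff0a60240b802440204b550888204bff0d00202bff0810200bff0680200b4023d8180bff00d8180b801680084b200470082bff04d0080bff0108080b2015b0006bff11a8006b800118002bff05a8000bff0260000b100751200aff3269200a800619000a802158280aff0b18280a801848240a8011e8104aff03c0080aff11b0006aff1308006a8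000d8002aff0310000a5502c8000aff465d000980017c0809ff14e4080980324c04098009740009ff025400098033ec00094001618009ff14618009802f8140098009490009ff02a9000980353100090821408809ff1d088409ff06988009ff1d204809ff000844098017704009550c804009ff06800809ff19d004090f0c980409ff04200009ff0c250248ff0c0d02488026688808ff096088088004a88008ff14604048ff083040488002704008ff04b00808ff13700608ff09b806088002680408ff0b4002488002400208ff02d00048ff08260007ff445e00078011242207ff1fa42207800dac2007ff171420078002a400078004ec00072002f28207ff215a82078015da8007800652030780048200070f03120007ff0e020007803d1a0007082250a007ff1000a0078023e89007ff0048900780185082072004608107ff04c88007ff00808007201ed86007ff0aa8600780242822070f08b02207ff0cd02107ff07f82007ff06b020070815e00307ff131003078001200107ff05d00007ff027000070201942106ff06342006ff3514200680063c0006802138a006ff0b58a0068003c08006ff18c860068011501206ff12580306ff0df003068000e802065500e00106ff03a800060f02980006ff0719102580000901058007b100058028a900052014e900050810f01405ff12d80905ff001009058014e00805ff0f080505ff00f804250f05f80405ff0c200105ff173800a5ff009800a5801cd80035ff006000255518980025ff00200015ff05b800050f01a80005330f9000055503a00005ff2650000510061d0244ff06dd024480001c0204ff23fb0204ff2cab0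204800bfa0a048006fa08448003e2020455068a0204ff02ba02048028c2020440048902048004410044ff14780a04ff1ab80a0480158008448001580804ff11300604ff00680444ff01100404ff10b00204401c9000c4ff001800c48000200084ff17300054ff09480054801a900044ff03d000444005d00004ff19c00223ff195802238003a00203ff01180203801fa80143ff18c801438003880103ff03b00043ff03180023ff046c110280001c00228007240002801394000240286400022012d08022ff13d88002ff11d05002ff00904102550e704022ff05604002ff1c380182ff001001828016a80112ff0010011280004001020f17b80102ff00080082ff0c900022ff0fa800020f01e0000233061000025503d00002ff264000020223960041ff2c56004180061d0241ff06d502418004d40201ff058c00418006828201800cca80418003ba00410f06020041ff034a00418028da00410813a882018014788041ff1c3080418001508001ff00684201ff10a84041ff01004001ff17f80281ff08900281801d000211ff1b700201ff03c8020108107000410800200011ff06080001ff067a2100ff20200220ff170002208003a00200ff19400140ff199801408003080100ff03800040ff013000408003900020ff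

/-- The negative entries of the certificate for the closing probability `129 / 1000`. -/
def negativeEntriesThree : List ℕ := unpackDigits 95
  0x222200eff0ce8210eff04a0204eff01fc080dff0201800dff0498810dff04e0082dff01ec120cff0202200cff03f8220cff0cf0202cff00f8020cff09fb000b0f03fb000b080d22204bff003a002b8025c1202bff2de9202b800070084b801190004b0f0cf8004b800734022aff078a006a8003a1204a800241202aff07e8200a0f06f8200a550320200a800020100aff022c0409ff084c00093300514009ff08910009330690880980001080094000404009800038080908026804098000180248ff09be000755039600074025cc2107ff2dc42107800d622207ff000a010780005082078012980207550e78020780051422068007ba03068008010146ff051020060f0820200655014820068000381006ff0071012580022804055500800085ff0068003580152800258007b80005400fa8000501048e0204ff054b0044ff06f200448027280844ff10900244550af80244ff040800440f00180014ff027000048013640223ff003c0122800040802280003080028000781002ff12d001028000800012ff0858000208107800020106960201ff047b0041ff0183004180065202018000790041ff24e08201ff037040418010a802410f0bf00241ff0010021180062002010f01f802015500080081ff02c800018011910140ff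

/-- The bounds of the certificate for the closing probability `129 / 1000`. -/
def boundsThree : ℕ :=
  0x11b4c640157b1d60152c5a80186e8850159673e01d0a8550184e8b7019303d000fcc6b7013bd69800fbbd5c0136a3d700fccc150172848900fa9a6c0136cc1800fcc38301014fe70138336501411bcb010091f3010372dc0142f439013c232c00fcc19901018af600fe8a0b013ccf9300fd07c30103617201020c7a0139d8dc00fcc6b800fc6d2800fbaf3200fa5f1b013bd2600171baa70136d8880136817800fcc4440100797d00fecdb700ffd88a010069a8013bf0ab00ffe610013a1e6f00fcc15900fd07eb00fe9f8d0101719a0101a0bf01038e5c013cc5870139ccb900fcbe8a00fe303400fd97be0101784100fe2bd6010055cd010180f5013b7dc60123381c01442c440167d146016b234901603874018e61f901829ad90185298300fac236011b561f01236d73013239d3011afd9c014bc7310141da11014b9c2e00fda441010bf3010143f616013e8ad101026e11011ad54e0140f50a0138e52a00f8022d01068de60123c8a60136b5b400fd83210116f211013b2ec80132c2bd00fdf66a0101cb2f01043b530105c78001267bd2014c57920129a4f70134d8ea00f914d700fcca3100fc9d4400fc00da011b529d012d12d6011c849801325c7f00fc8d7201010d510104ed6c010bb68d010263af0111c6a8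012a9ba60136019c00fb58c400ff10bd010115100104e2c6010128d50110c8c7011eba690134a57101254145015747bd0166d0dd0165c82f0157f3d201b5830e016507ed0167ec3000ffac22012f6b9c01150de20120cc0700ffb850015863c4011d91ce01351a9e00fe5c2e0115e4d6013ccf79013f7710011460630155b12f01405f10013ab33600fb04b30112d503010f42e1011e141300fb876c013b56c9011e92050132721d00fff9ce01004bd101151f24011e44180130a7b70158d3e90121a4a8013497d400fdb58600fe637c010021ed0109199a00fe0c6b01277c610108a5d9013136ac00faf1e400fb9f5a010ed4e0011ee97501122a32013bdf03011e6e8e0132a0c100fbf01100fd821e00fd9d5c010aff2900fd388901266a0e010aba1a01327c17012818680142ea8f015f2257016ad9d00163fdb1018b7f10015d283c0168553300fff81e011893b6011e62c20136e10e011cf01601485a3601200bb2013d941700ffeecd0105d8170135084201447000011df86e012e3848013828320138687900f9c2a700ffe8ea01187f1001331bc30116c2210129caf9011aee8a012d117c00ff5a110100595c011db09e011e4a8d01393ab6014c7823012656940132726d00f9b69800fe93cc0119b6cd0117f2890119cc27012ca955011b260b0132c3b400f9d20600fbf26f0117ea60011d8ba70118a0530129b0fa01236604012d83de00f8134600fd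5be90117b642011a5c1e011755a101282907011b20c9012fcbf1012327fc015d0b790169012f018405980144ed22018ef0f6016a3cdc0184c09a00fe480d01261e16010439a90128b52601015428014cb91b0105ba5f0135495000fd7e760103704c0144a0b2013ffeeb010b68d8011bf596014076a80138c3e800fc87250102b5f401055eed012a1ee50100f0d4011287d4010c0b380135b28100fabf31011ab5530124a68e01440174011b4c67014c505f0132ec7f01495d7400f92476011b419200fca4cc011d6daf00fcc848012d6e9000fbfa4a01326d3100f7e73800fd9a4e01246bd1013b11880106de070117f6bf013708a00132d54800fb5d4d01014d5c01011080011f3eb800fecd3301116e590104bad3013489fd0129ae6f014bc20b015ef4e001697b47014c0daf0178263f0168d2b9016cb512010097ca012490f10119f04e01313d88010cdc3a0139c8d00125bed30140e4dc01001498010e14bd0134be930140f988010cdcf0011d6ed7014316c6013b507700fa72840108afa201149123012eb5730107f20001198b9a012249e201352e0a0100a8ed010d8e060119fd8801258a060123e0c50139a7c9013229d50141abb000faa36e010990d70111beba011aed05010939a1011ea066011b02b40139494800fa7d5a01083ebf01141b12012240710108521f01197000012f1b6e013566f100f948ac0107470a011042b6011b6caa010717450118721f011b81f90130b7450127f39f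0161ae1b015f5c07015d418701426fbd018c5a690169c0fb0167d0cb00ff2c8a013a15b4011dfbb30125584700ffcff1014d72e8011ecfbb013544fc00ffe942011f6ed001353e6b013698390104aa5d012f17ea0144fbe60138245500f9bd1c0119ba3b0118b5390122e8e300fbe79d012aaa9b011e5583012d4db700ffd1ff011d6b66011e87050120c3020116bccd0149344901373a6d013d843b00f9ae07011a6df00119ec75011b806200fe5dda012da2d4011835f2013295f100f9cc7b0116d1df01182089011af1ae00ff9a03012a938a0132ea7d012cb45c00f80dbb0117dcb90117ec6b011b7c0100fcf57801290b97011a8abd012faad2012c402701477e81014ba1de015d487d0148145d016d0cb5015c55b7016e34330102ea66011fc355010a418a0128aefc01070395012e2534011823490135d6310102f1460109d13301216b910136867e0108e39e0112554d01373975013ac2c400fcc5200103e2060104e25f011f137101011e30010de7fe01129b1e012af66201030012010710a7010a30250118e68e011f61ea012e08b6012932720132451c00fc708101043db2010595950115e418010430b4011277410115af8f0133742f00fcd47f0100bcaa01044daf0112b95a0103d344010dd0ed011f4e0b012b3bd100fb15bf0101f3e501041991011663bd01020e58010c48fa0115cbd9012f7ed5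

/-- The resulting bound is 428000 / 4000000 = 0.107. -/
theorem certificateThree : checkCertificate 129 1000 4000000 428000 16777216 boundsThree
    positiveEntriesThree negativeEntriesThree = true := by
  decide +kernel

/-- The positive entries of the certificate for the closing probability `107 / 1000`. -/
def positiveEntriesFour : List ℕ := unpackDigits 280
  0x15b3000eff2862084eff0492080eff288a006eff03c2004eff053a000eff1b69204eff0079104eff02d1014eff0211012eff03d9006eff0141004eff0459000eff0720200eff0088110eff0410000eff1335000dff05ac000dff05c9000dff0218800dff01a8080dff0478000dff15ae000cff1bf4220cff0024120cff047c030cff04a4020cff020c012cff0484000cff2752820cff0372800cff2882030cff03f2020cff0512000cff0648200cff0090102cff0420000cff0b5b000bff4483000b8022da084b80162a080b8006da000bff0892000b803e6a000b401209204bff2fa9204b801ef1200b8002d9000b8024b0280bff0b08280b802240240bff05d0240b8022b8204b550860204bff0650202bff0920200bff24e8180bff01b0100bff1b38084b2004d8080bff0178040bff1638006bff1348006b8007e0004bff0728004b200110002bff02a0000bff06d8000b100149204a803db9200a800601000a802500280aff0ec0280a801af0240a801318104aff0100100aff01c0080aff14e0006aff02b8006a8001b8002aff0298000a5501a8000aff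3f7d0009801a3c08098034ac040980032c0009ff0c4c00098042fc0009401aa9800980394940098002810009ff0be9000980422900090821d08809ff1e788409ff02188009ff00388009401df04809ff183840095507504009ff02280809ff005808090819e804090f07300409ff03780009ff03c50248ff03c502488003c50208ff03c5020880029d0048ff029d00488028788808ff0d9088088002408008ff13484048ff077840488001004008ff02380808ff12f80608ff07d806088001000408ff01500208ff01480048ff00d00008ff0c1e0007ff445e000780137c2207ff2f0c2207801eb4200780028c00078022e2820780163a80078006b20007ff08b20007803f0200070824b8a007ff09c8a0078024d89007ff1ad882072004888007ff21c86007ff05c060078001704007ff20a022070f07f82207ff07782107ff09382007ff01b81007ff1d000307ff17b00307800ae80207ff086802072002b00007ff03d000070202ec22068013dc2006ff3964200680049c0006802580a006ff0e48a0068001d08006ff1c8860068013101206ff01001006ff14580306ff078003068001b80106ff02c800060f01980006ff053910258004d90005ff32b100052012901405ff00b81005ff0be00805ff0ff80505ff04e80405ff0a400105ff146800a5ff048000a58016d80035ff066800358014f80025ff00080015ff081000050f06d80005330e8800055500500005ff0188000580303800051003c50244ff03c502448003c50204ff03c5020480029d0044ff029d004480063402048026f30204ff2b2302048009ba0204ff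346a020440033200448004690044ff1dc00a04ff22500a04800f580604ff03a006048004e0020455175800c4ff052000c48000300084ff14e00054ff11f800548019a80044ff04200004ff15680223ff200002238002d00203ff02000203801dc00143ff202801438002f00103ff03180043ff02c00023ff04f411028005140002ff31e400022014d88022ff0a188002ff011880022012a85002ff10184022ff05504002ff00c01002ff17000182ff063001828014500112ff041001128014700102ff08900022ff0eb800020f056000023306b800025501b80002ff0048000280353800020227160041ff2b4600418003c50241ff03c502418003c50201ff03c5020180029d0041ff029d004180022202018009ba0041ff367a00410805b900418017188041ff1ef880418001288001ff10004041ff06f840418015200281ff125802818017880211ff06f80211801a300201ff03a800410f00300011ff04200001ff1da00220ff21c002208003380200ff15600140ff20c801408002c00100ff02c80040ff01f000408002f80020ff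

/-- The negative entries of the certificate for the closing probability `107 / 1000`. -/
def negativeEntriesFour : List ℕ := unpackDigits 53
  0x502204eff0738210eff0148204eff029c080dff07d0810dff07c0082dff02fc022cff0522220cff0120220cff06f8202cff09d2204bff0102004bff0be0004b8009ac0409ff01194009ff001044098009ca2207ff00620207ff0fa802078001410125ff00d101258000200905ff001809058000c808053300900085ff00c8000540097800050103ae0204ff03ae02048004cb0044ff04cb004480037a0044ff09380844ff0378004455185800448000200014ff014c0122ff00dc0122800058802280038880023300080082ff00900012ff0300000208083000020103c60201ff03c602018002f30041ff02f3004180030a0201ff08b08201ff056002010f19d802018000180081ff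

/-- The bounds of the certificate for the closing probability `107 / 1000`. -/
def boundsFour : ℕ :=
  0x11c9936015c12b601521afb0188d976015beaa801d328d40188704a01a1081f00fe0eed013d79f300fc5b3b013ab93400fd75c80175fbf500ff7800013a4a4300fe10100100e520013b769c014ce9a8010210600103fde3014907c0013f5e1d00fe0bac0101acc601003613013ec2f800fe3110010280e00104df1b013d5a8d00fe137d00fed0aa00fc6e4a00ff5a8b013d5ca401773615013b07ec013a9dd800fe117b010186bf00feeecd0101dbad0101897b013cb20e01020b92013d0bf500fe0da200fe22840100320001048f960101896001025e7d013ee3eb013d59ec00fe092f00ff310d00fea0740102c09400ff2884010095c50102f11f013d4c200122319701436dd301630a5f016ee1c20162c36d019492a501732e29018b1c0f00fbacb1011c992a011efd020138952e011be3e5014ffe36013b3897015224bd00fede1f01041296014661750147b4bd01076b9f011ddef201409cb6013ace7f00fa734e00ffbf3f012238300139389200fef7ae011618f301378a9c0134288400ff460a0101920001024390010eb50a01213acd01533e0d011fae6e01343b3a00fa9a6200fe8c6000fc5ec60108d0df011cacbe0131cc390119cbd70132ed0600fe06f200fe6c6001056b5f01151873010526a6011960c30121c19b0137775d00fcecf7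00ff2b670100e245011017060101af33011634f7011b4846013577f5012443fe015b42ec01754cb301682f6d015d07e601c506980163601601670b070100650a0132fa48011b2558011bc8db0101ba73016a582b0126c3420136529500fdadd70118a5000152a42b0146e4d2011a29420166cc0f0142c2ea013989de00fbe8f80116f79b011860e80119fb1b00fb9b530148ec12012724fa0133acb5010073d001017ba6011bf9fb012ac2fb012e834c016a72ff011754720132790700fe6e1a00ffc86a00fffb33010ec4d200fff6a10132e72d010b991d0131b1fd00fbf20900fbbf240119222c012b26c60116ffa801490edf011624f0013017f800fd7e0000fd96c200fe7f140110844d00fd6e37012fc915010d4326013222dc012565a501494c3401662c9c016f641f016909ba019b683501584eff017221fe00fee0bf01196f9c01221f3f0139178b012241df0156d3c60120596d013f379b00fecf7e0106ae4801438414014d394501262b16013d2dac0137b1d3013e53f100fa64ad01025af1011f5acf0133641c011c4c57013567ad011fe7eb0137adf600fefa630103e63901229930012eb375013ef08d015693e8012202a70139642000fa4ebb0100eb0c011cb466012784be011f775f01352214011c20100135413f00fa789c00fd7dea011fc161012eaa6e0120666801352fc80120d3250137574f00f95ea100fe4764011b3847012775f3011ceef5013203fc011c0eb001355ac401223b3401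616f06016282b30177581b0144d64601949d140169b9b7018b6e3800ff2b2501267cb701019ca5012432d60100f43901537d7c010c33260132ac7000feefad0106313f0145fd500143283c01054242011dc2b0014488b5013ade6100fdf0ed010552bf0104fb5a0125afb600fe4951011971880112b8030136245700fbcff2011c337d011eef47013bc6ea011c9a29014fc8c701336d5f0153004f00fa9921011c82b500fc31cc011a2c6300feb8c20131cbca0106c84d01328c0000fa98cb00ff0aaf01223a9d0136f5b800ff7d940115c4cc0136839f01342cb600fcf3a70101b1320100d8d2011c400100ff0dae01160dd7010e24c4013585ff012793a2014fcecf01545a3201633a35015105e80189d411015edc0d0172083f01010ebc0128fa2601104cd5012ceda1010c106401453fa20126e67b014004b00100fd7b010d30e30131b1aa0141ef9a010e2744012b9988013e3ee1013cf0c800fc92aa0108dd8c010d8865012b1fe10105b3530123d389012674f901364acd01012860010c34e50110c6c60127a90401261f320144ffc401288fb50141afc300fc7cb801076da7010ae1fc012198980107738d01238df00120f3f1013645a200fca6990105d400010deef7012701180108629601239ba40127603301363f1d00fb8c9e0104c9ff010965dd012189cd01047dd901206fd80120ce730133ff310125345301687c7e0169717f015d5b2a014b5618019d162f016d510b0169d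7ec00feaf6d0141a7d50125642201270e960103cff9015881c0012e70760137f38000fe9e2c0125de920146c8f7013c108f01087774013edba6014a2edf013c56c300fa335b01218b3b01229fb2012540d600fdda71013715a7012dc1ea013521ac00fec9110124d3580125de130121c9f901146c84015841e2013704b3013a011200fa1d6901201b56011ff949011d08230101c3bd0136d00e01270cf50134f1d400fa474a011e6b09012306440121220d0102b2c60136ddc201326da10135721900f92d4f011de9ae011e7d2a011d301d00fece090133b1f60126e777013383880127dc5c014ec26c0151fb3c01623acf015035bd018593b9015dc53701728aa7010157760127edc3010deddf012bee3b010b10fe0140ff4a0125cfa5013f348501014635010c2480012f52b40140f034010d571901275930013d280b013d733000fcdb640107d129010b296f012a207b0104e328011f9331012507e30136cd350101711a010b2579010e67d00126a99e01251fcc0140bf6c012778df013f88a200fcc5720106614401088306012041fd0106a362011f4d98011e52ee0136c80a00fcef530104bd2a010b9001012601b20107926b011f5b4c0126495d0136c18500fbd5580103bd9c010706e7012033320103adae011c2f80011e2d7001348199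

/-- The resulting bound is 260000 / 4000000 = 0.065, which is small enough for the matching bound to
contract. -/
theorem certificateFour : checkCertificate 107 1000 4000000 260000 16777216 boundsFour
    positiveEntriesFour negativeEntriesFour = true := by
  decide +kernel

/-! ### Independent modification of finitely many coordinates -/

section Thin

variable {ι : Type*} [Fintype ι] [DecidableEq ι]

/-- The expectation of `g` after every coordinate `i` of `x` has been modified independently
according to the transition probabilities `κ i`. -/
def thin (κ : ι → Bool → Bool → ℝ) (g : (ι → Bool) → ℝ) (x : ι → Bool) : ℝ :=
  ∑ S : ι → Bool, g S * ∏ i, κ i (x i) (S i)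

/-- The `κ i` are transition probabilities that keep the value `true`. -/
structure IsRaising (κ : ι → Bool → Bool → ℝ) : Prop where
  nonneg : ∀ i a b, 0 ≤ κ i a b
  sum_eq_one : ∀ i a, κ i a true + κ i a false = 1
  true_false : ∀ i, κ i true false = 0

variable {κ : ι → Bool → Bool → ℝ} {x : ι → Bool} {g g' : (ι → Bool) → ℝ}

theorem sum_prod_bool (f : ι → Bool → ℝ) :
    ∑ S : ι → Bool, ∏ i, f i (S i) = ∏ i, (f i true + f i false) := by
  have := Finset.prod_univ_sum (fun _ : ι => (Finset.univ : Finset Bool)) f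
  rw [Fintype.piFinset_univ] at this
  rw [← this]
  simp

theorem IsRaising.sum_weights (hκ : IsRaising κ) (x : ι → Bool) :
    ∑ S : ι → Bool, ∏ i, κ i (x i) (S i) = 1 := by
  rw [sum_prod_bool fun i b => κ i (x i) b]
  exact Finset.prod_eq_one fun i _ => hκ.sum_eq_one i (x i)

theorem IsRaising.thin_mono (hκ : IsRaising κ) (h : ∀ S, g S ≤ g' S) (x : ι → Bool) :
    thin κ g x ≤ thin κ g' x :=
  Finset.sum_le_sum fun S _ => mul_le_mul_of_nonneg_right (h S)
    (Finset.prod_nonneg fun _ _ => hκ.nonneg _ _ _)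

theorem thin_add (g g' : (ι → Bool) → ℝ) (x : ι → Bool) :
    thin κ (fun S => g S + g' S) x = thin κ g x + thin κ g' x := by
  simp only [thin, add_mul, Finset.sum_add_distrib]

theorem thin_const_mul (c : ℝ) (g : (ι → Bool) → ℝ) (x : ι → Bool) :
    thin κ (fun S => c * g S) x = c * thin κ g x := by
  simp only [thin, mul_assoc, Finset.mul_sum]

theorem IsRaising.thin_const (hκ : IsRaising κ) (c : ℝ) (x : ι → Bool) :
    thin κ (fun _ => c) x = c := by
  rw [thin, ← Finset.mul_sum, hκ.sum_weights, mul_one]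

/-- A transition that loses a value `true` has weight zero, so `g x` is averaged against values at
larger configurations only. -/
theorem IsRaising.le_thin (hκ : IsRaising κ)
    (hg : ∀ S S' : ι → Bool, (∀ i, S i = true → S' i = true) → g S ≤ g S') (x : ι → Bool) :
    g x ≤ thin κ g x := by
  rw [← hκ.thin_const (g x) x, thin, thin]
  refine Finset.sum_le_sum fun S _ => ?_
  by_cases h : ∀ i, x i = true → S i = true
  · exact mul_le_mul_of_nonneg_right (hg _ _ h) (Finset.prod_nonneg fun _ _ => hκ.nonneg _ _ _)
  · push Not at h
    obtain ⟨i, h1, h2⟩ := h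
    have : ∏ i, κ i (x i) (S i) = 0 :=
      Finset.prod_eq_zero (Finset.mem_univ i) (by rw [h1, Bool.eq_false_of_not_eq_true h2, hκ.true_false])
    rw [this, mul_zero, mul_zero]

theorem IsRaising.thin_coord (hκ : IsRaising κ) (e : ι) (x : ι → Bool) :
    thin κ (fun S => ((S e).toNat : ℝ)) x = κ e (x e) true := by
  have h : ∀ S : ι → Bool, ((S e).toNat : ℝ) * ∏ i, κ i (x i) (S i) =
      ∏ i, (if i = e then ((S i).toNat : ℝ) else 1) * κ i (x i) (S i) := fun S => by
    rw [Finset.prod_mul_distrib, Finset.prod_ite_eq' Finset.univ e]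
    simp
  simp only [thin, h]
  rw [sum_prod_bool fun i b => (if i = e then (b.toNat : ℝ) else 1) * κ i (x i) b,
    Finset.prod_eq_single_of_mem e (Finset.mem_univ e)]
  · simp
  · intro i _ hi
    simp [hi, hκ.sum_eq_one]

/-- Functions of complementary sets of coordinates are modified separately. -/
theorem thin_mul_eq {p : ι → Prop} [DecidablePred p] {F G : (ι → Bool) → ℝ}
    (hF : DependsOn F {i | ¬ p i}) (hG : DependsOn G {i | p i}) (x : ι → Bool) :
    thin κ (fun S => F S * G S) x =
      (∑ T : {i // ¬ p i} → Bool, F (fun i => if h : p i then false else T ⟨i, h⟩) *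
        ∏ i : {i // ¬ p i}, κ i (x i) (T i)) *
      (∑ T : {i // p i} → Bool, G (fun i => if h : p i then T ⟨i, h⟩ else false) *
        ∏ i : {i // p i}, κ i (x i) (T i)) := by
  rw [thin, ← (Equiv.piEquivPiSubtypeProd p fun _ => Bool).symm.sum_comp, Fintype.sum_prod_type_right,
    Finset.sum_mul_sum]
  refine Finset.sum_congr rfl fun T _ => Finset.sum_congr rfl fun T' _ => ?_
  rw [← Fintype.prod_subtype_mul_prod_subtype p]
  have h1 : F ((Equiv.piEquivPiSubtypeProd p fun _ => Bool).symm (T', T)) =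
      F (fun i => if h : p i then false else T ⟨i, h⟩) := by
    refine hF fun i (hi : ¬ p i) => ?_
    simp [hi]
  have h2 : G ((Equiv.piEquivPiSubtypeProd p fun _ => Bool).symm (T', T)) =
      G (fun i => if h : p i then T' ⟨i, h⟩ else false) := by
    refine hG fun i (hi : p i) => ?_
    simp [hi]
  have h3 : ∏ i : {i // p i}, κ i (x i) ((Equiv.piEquivPiSubtypeProd p fun _ => Bool).symm (T', T) i)
      = ∏ i : {i // p i}, κ i (x i) (T' i) :=
    Finset.prod_congr rfl fun i _ => by simp [i.2]
  have h4 : ∏ i : {i // ¬ p i}, κ i (x i)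
      ((Equiv.piEquivPiSubtypeProd p fun _ => Bool).symm (T', T) i)
      = ∏ i : {i // ¬ p i}, κ i (x i) (T i) :=
    Finset.prod_congr rfl fun i _ => by simp [i.2]
  rw [h1, h2, h3, h4]
  ring

theorem IsRaising.thin_eq (hκ : IsRaising κ) {p : ι → Prop} [DecidablePred p]
    {G : (ι → Bool) → ℝ} (hG : DependsOn G {i | p i}) (x : ι → Bool) :
    thin κ G x = ∑ T : {i // p i} → Bool, G (fun i => if h : p i then T ⟨i, h⟩ else false) *
        ∏ i : {i // p i}, κ i (x i) (T i) := by
  have h := thin_mul_eq (κ := κ) (F := fun _ => 1) (p := p) (fun _ _ _ => rfl) hG x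
  simp only [one_mul] at h
  rw [h, sum_prod_bool (fun (i : {i // ¬ p i}) b => κ i (x i) b),
    Finset.prod_eq_one fun i _ => hκ.sum_eq_one _ _, one_mul]

theorem IsRaising.dependsOn_thin (hκ : IsRaising κ) {p : ι → Prop}
    {G : (ι → Bool) → ℝ} (hG : DependsOn G {i | p i}) : DependsOn (thin κ G) {i | p i} := by
  classical
  intro x y h
  rw [hκ.thin_eq hG, hκ.thin_eq hG]
  refine Finset.sum_congr rfl fun T _ => ?_
  rw [Finset.prod_congr rfl fun (i : {i // p i}) _ => by rw [h i i.2]]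

/-- Given `x`, the coordinates are modified independently, so functions of complementary sets of
coordinates are conditionally independent. -/
theorem IsRaising.thin_mul (hκ : IsRaising κ) {p : ι → Prop} {F G : (ι → Bool) → ℝ}
    (hF : DependsOn F {i | ¬ p i}) (hG : DependsOn G {i | p i}) (x : ι → Bool) :
    thin κ (fun S => F S * G S) x = thin κ F x * thin κ G x := by
  classical
  have h := thin_mul_eq (κ := κ) (G := fun _ => 1) (p := p) hF (fun _ _ _ => rfl) x
  simp only [mul_one, one_mul] at h
  rw [thin_mul_eq hF hG, ← hκ.thin_eq hG]
  congr 1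
  change _ = thin κ (fun S => F S) x
  rw [h, sum_prod_bool (fun (i : {i // p i}) b => κ i (x i) b),
    Finset.prod_eq_one fun i _ => hκ.sum_eq_one _ _, mul_one]

/-! ### The modification with prescribed marginals -/

variable {Ω : Type*} [MeasurableSpace Ω] {P : Measure Ω} [IsProbabilityMeasure P]
  {X : Ω → ι → Bool} {q : ℝ}

theorem integrable_comp_bool (hX : Measurable X) (f : (ι → Bool) → ℝ) :
    Integrable (fun ω => f (X ω)) P := by
  have := Measure.isProbabilityMeasure_map (μ := P) hX.aemeasurable
  exact (Integrable.of_finite (f := f)).comp_measurable hX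

/-- The transition probabilities that raise the probability `r i` of the value `true` to `q`. -/
noncomputable def raiseTo (q : ℝ) (r : ι → ℝ) (i : ι) : Bool → Bool → ℝ
  | true, true => 1
  | true, false => 0
  | false, true => 1 - (1 - q) / (1 - r i)
  | false, false => (1 - q) / (1 - r i)

theorem isRaising_raiseTo {r : ι → ℝ} (hr : ∀ i, r i ≤ q) (hq : q < 1) :
    IsRaising (raiseTo q r) where
  nonneg := fun i a b => by
    have h1 : 0 < 1 - r i := by linarith [hr i]
    have h2 : (1 - q) / (1 - r i) ≤ 1 := by
      rw [div_le_one h1]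
      linarith [hr i]
    have h3 : 0 ≤ (1 - q) / (1 - r i) := div_nonneg (by linarith) h1.le
    cases a <;> cases b <;> simp only [raiseTo] <;> linarith
  sum_eq_one := fun i a => by cases a <;> simp [raiseTo]
  true_false := fun i => rfl

/-- With `r` the original probability of `true`, the new one is `r + (1 - r) * (1 - (1 - q) / (1 -
r)) = q`. -/
theorem integral_raiseTo (hX : Measurable X) (hr : ∀ i, P.real {ω | X ω i = true} ≤ q) (hq : q < 1)
    (e : ι) : ∫ ω, raiseTo q (fun i => P.real {ω | X ω i = true}) e (X ω e) true ∂P = q := by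
  have h1 : 1 - P.real {ω | X ω e = true} ≠ 0 := by linarith [hr e]
  set r : ι → ℝ := fun i => P.real {ω | X ω i = true} with hrd
  have hm : MeasurableSet {ω | X ω e = true} := (measurable_pi_iff.1 hX e) (measurableSet_singleton true)
  have h2 : ∀ ω, raiseTo q r e (X ω e) true =
      (1 - (1 - q) / (1 - r e)) + (1 - q) / (1 - r e) * {ω | X ω e = true}.indicator (1 : Ω → ℝ) ω := by
    intro ω
    cases h : X ω e <;> simp [raiseTo, h]
  simp only [h2]
  have h4 : Integrable ({ω | X ω e = true}.indicator (1 : Ω → ℝ)) P :=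
    (integrable_const (1 : ℝ)).indicator hm
  rw [integral_add (integrable_const _) (h4.const_mul _), integral_const_mul,
    integral_indicator_one hm]
  simp only [integral_const, probReal_univ, one_smul]
  change _ + _ * r e = _
  have h3 : 1 - r e ≠ 0 := h1
  field_simp
  ring

/-- The expectation of `h` vanishes after the modification. -/
def IsBalanced (P : Measure Ω) (X : Ω → ι → Bool) (q : ℝ) (h : (ι → Bool) → ℝ) : Prop :=
  ∫ ω, thin (raiseTo q fun i => P.real {ω | X ω i = true}) h (X ω) ∂P = 0

theorem IsBalanced.add (hX : Measurable X) (h : IsBalanced P X q g) (h' : IsBalanced P X q g') :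
    IsBalanced P X q fun S => g S + g' S := by
  rw [IsBalanced] at *
  simp only [thin_add]
  rw [integral_add (integrable_comp_bool hX _) (integrable_comp_bool hX _), h, h', add_zero]

theorem IsBalanced.const_mul (h : IsBalanced P X q g) (c : ℝ) :
    IsBalanced P X q fun S => c * g S := by
  rw [IsBalanced] at *
  simp only [thin_const_mul]
  rw [integral_const_mul, h, mul_zero]

theorem isBalanced_zero : IsBalanced P X q fun _ => 0 := by
  simp [IsBalanced, thin]

theorem isBalanced_list_sum (hX : Measurable X) {α : Type*} {f : α → (ι → Bool) → ℝ} {l : List α}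
    (h : ∀ a ∈ l, IsBalanced P X q (f a)) : IsBalanced P X q fun S => (l.map fun a => f a S).sum := by
  induction l with
  | nil => exact isBalanced_zero
  | cons a l ih =>
    simp only [List.map_cons, List.sum_cons]
    exact (h a (by simp)).add hX (ih fun b hb => h b (by simp [hb]))

/-- The centered variable of a coordinate is orthogonal to the functions of the coordinates that are
independent of it. -/
theorem isBalanced_centered (hX : Measurable X) (hr : ∀ i, P.real {ω | X ω i = true} ≤ q)
    (hq : q < 1) {e : ι} {p : ι → Prop} (he : ¬ p e)
    (hi : IndepFun (fun ω => X ω e) (fun ω (i : {i | p i}) => X ω i) P) (hG : DependsOn g {i | p i}) :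
    IsBalanced P X q fun S => (((S e).toNat : ℝ) - q) * g S := by
  have hκ := isRaising_raiseTo hr hq
  rw [IsBalanced]
  have h1 : ∀ x, thin (raiseTo q fun i => P.real {ω | X ω i = true})
      (fun S => (((S e).toNat : ℝ) - q) * g S) x =
      (raiseTo q (fun i => P.real {ω | X ω i = true}) e (x e) true - q) *
        thin (raiseTo q fun i => P.real {ω | X ω i = true}) g x := fun x => by
    rw [hκ.thin_mul (p := p) (fun S S' h => by rw [h e he]) hG]
    congr 1
    have := thin_add (κ := raiseTo q fun i => P.real {ω | X ω i = true})
      (fun S => ((S e).toNat : ℝ)) (fun _ => -q) x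
    simp only [← sub_eq_add_neg] at this
    rw [this, hκ.thin_coord, hκ.thin_const, sub_eq_add_neg]
  simp only [h1]
  -- After the modification is averaged out, the second factor still depends only on the coordinates
  -- in `p`, so its independence of coordinate `e` survives and the expectation factorizes.
  obtain ⟨G', hG', h2⟩ := (hκ.dependsOn_thin hG).exists_measurable_comp (measurable_of_finite _)
  have hXm := measurable_pi_iff.1 hX
  have h3 : IndepFun (fun ω => raiseTo q (fun i => P.real {ω | X ω i = true}) e (X ω e) true - q)
      (fun ω => thin (raiseTo q fun i => P.real {ω | X ω i = true}) g (X ω)) P := by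
    rw [h2]
    exact hi.comp (φ := fun b => raiseTo q (fun i => P.real {ω | X ω i = true}) e b true - q)
      (ψ := G') (measurable_of_finite _) hG'
  rw [h3.integral_fun_mul_eq_mul_integral
    (integrable_comp_bool hX fun x => raiseTo q _ e (x e) true - q).aestronglyMeasurable
    (integrable_comp_bool hX _).aestronglyMeasurable,
    integral_sub (integrable_comp_bool hX fun x => raiseTo q _ e (x e) true) (integrable_const _),
    integral_raiseTo hX hr hq]
  simp

/-- Weak duality: the modification increases the expectation of the monotone `g`, and preserves `g ≤
c + h`, whose last term then has expectation zero. -/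
theorem integral_le_of_isBalanced (hX : Measurable X) (hr : ∀ i, P.real {ω | X ω i = true} ≤ q)
    (hq : q < 1) {h : (ι → Bool) → ℝ} {c : ℝ} (hb : IsBalanced P X q h)
    (hg : ∀ S S' : ι → Bool, (∀ i, S i = true → S' i = true) → g S ≤ g S')
    (hgh : ∀ S, g S ≤ c + h S) : ∫ ω, g (X ω) ∂P ≤ c := by
  have hκ := isRaising_raiseTo hr hq
  have h1 : ∀ ω, g (X ω) ≤ c + thin (raiseTo q fun i => P.real {ω | X ω i = true}) h (X ω) := by
    intro ω
    refine (hκ.le_thin hg _).trans ((hκ.thin_mono hgh _).trans_eq ?_)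
    rw [thin_add, hκ.thin_const]
  refine (integral_mono (integrable_comp_bool hX g) ((integrable_const c).add
    (integrable_comp_bool hX _)) h1).trans_eq ?_
  rw [integral_add' (integrable_const c) (integrable_comp_bool hX _), hb]
  simp

end Thin

/-! ### The meaning of the patterns -/

/-- The vertices of the edge with number `e < 12` of a block. -/
def edgeEnds (e : ℕ) : ℕ × ℕ :=
  if e < 6 then (e, e + 3) else (3 * ((e - 6) / 2) + (e - 6) % 2, 3 * ((e - 6) / 2) + (e - 6) % 2 + 1)

theorem testBit_openUp {s v : ℕ} (h : (openUp s).testBit v = true) :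
    v < 6 ∧ s.testBit v = false := by
  have h63 : (63 : ℕ) = 2 ^ 6 - 1 := rfl
  change (63 ^^^ (s &&& 63)).testBit v = true at h
  rw [h63, Nat.testBit_xor, Nat.testBit_and, Nat.testBit_two_pow_sub_one] at h
  by_cases hv : v < 6 <;> simp_all

theorem testBit_openRight {s v : ℕ} (h : (openRight s).testBit v = true) :
    ∃ e < 12, edgeEnds e = (v, v + 1) ∧ s.testBit e = false := by
  change (((63 ^^^ (s >>> 6)) &&& 3) ||| (((63 ^^^ (s >>> 6)) &&& 12) <<< 1) |||
    (((63 ^^^ (s >>> 6)) &&& 48) <<< 2)).testBit v = true at h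
  have h63 : (63 : ℕ) = 2 ^ 6 - 1 := rfl
  have key : ∀ j, (63 ^^^ (s >>> 6)).testBit j = true → j < 6 → s.testBit (6 + j) = false := by
    intro j hj hj6
    rw [h63, Nat.testBit_xor, Nat.testBit_two_pow_sub_one, Nat.testBit_shiftRight] at hj
    simpa [hj6] using hj
  generalize 63 ^^^ (s >>> 6) = t at h key
  simp only [Nat.testBit_or, Nat.testBit_and, Nat.testBit_shiftLeft, Bool.or_eq_true,
    Bool.and_eq_true, decide_eq_true_eq] at h
  have h48 : ∀ j, (48 : ℕ).testBit j = true → j = 4 ∨ j = 5 := fun j hj => by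
    have : j < 6 := by
      by_contra hc
      rw [Nat.testBit_lt_two_pow (lt_of_lt_of_le (by norm_num) (Nat.pow_le_pow_right two_pos (not_lt.1 hc)))] at hj
      cases hj
    interval_cases j <;> simp_all +decide
  have h12 : ∀ j, (12 : ℕ).testBit j = true → j = 2 ∨ j = 3 := fun j hj => by
    have : j < 4 := by
      by_contra hc
      rw [Nat.testBit_lt_two_pow (lt_of_lt_of_le (by norm_num) (Nat.pow_le_pow_right two_pos (not_lt.1 hc)))] at hj
      cases hj
    interval_cases j <;> simp_all +decide
  have h3 : ∀ j, (3 : ℕ).testBit j = true → j = 0 ∨ j = 1 := fun j hj => by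
    have : j < 2 := by
      by_contra hc
      rw [Nat.testBit_lt_two_pow (lt_of_lt_of_le (by norm_num) (Nat.pow_le_pow_right two_pos (not_lt.1 hc)))] at hj
      cases hj
    interval_cases j <;> simp
  rcases h with (⟨h, h'⟩ | ⟨hv, h, h'⟩) | ⟨hv, h, h'⟩
  · rcases h3 _ h' with rfl | rfl
    · exact ⟨6, by norm_num, rfl, key _ h (by norm_num)⟩
    · exact ⟨7, by norm_num, rfl, key _ h (by norm_num)⟩
  · rcases h12 _ h' with hj | hj
    · obtain rfl : v = 3 := by omega
      exact ⟨8, by norm_num, rfl, key _ h (by norm_num)⟩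
    · obtain rfl : v = 4 := by omega
      exact ⟨9, by norm_num, rfl, key _ h (by norm_num)⟩
  · rcases h48 _ h' with hj | hj
    · obtain rfl : v = 6 := by omega
      exact ⟨10, by norm_num, rfl, key _ h (by norm_num)⟩
    · obtain rfl : v = 7 := by omega
      exact ⟨11, by norm_num, rfl, key _ h (by norm_num)⟩

theorem testBit_floodStep (E N c v : ℕ) : (floodStep E N c).testBit v = true ↔
    c.testBit v = true ∨ (1 ≤ v ∧ c.testBit (v - 1) = true ∧ E.testBit (v - 1) = true) ∨
    (c.testBit (v + 1) = true ∧ E.testBit v = true) ∨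
    (3 ≤ v ∧ c.testBit (v - 3) = true ∧ N.testBit (v - 3) = true) ∨
    (c.testBit (v + 3) = true ∧ N.testBit v = true) := by
  change (((c ||| ((c &&& E) <<< 1)) ||| ((c >>> 1) &&& E)) |||
    (((c &&& N) <<< 3) ||| ((c >>> 3) &&& N))).testBit v = true ↔ _
  simp only [Nat.testBit_or, Nat.testBit_and, Nat.testBit_shiftLeft, Nat.testBit_shiftRight,
    Bool.or_eq_true, Bool.and_eq_true, decide_eq_true_eq, add_comm 1 v, add_comm 3 v]
  tauto

/-- A property invariant along open edges holds on everything the flood fill reaches. This is the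
only direction required: flooded vertices are connected to the starting vertex. -/
theorem flood_induction {E N : ℕ} {p : ℕ → Prop}
    (hE : ∀ v, E.testBit v = true → (p v ↔ p (v + 1)))
    (hN : ∀ v, N.testBit v = true → (p v ↔ p (v + 3))) (n : ℕ) :
    ∀ c, (∀ v, c.testBit v = true → p v) → ∀ v, (flood E N n c).testBit v = true → p v := by
  induction n with
  | zero => exact fun c hc => hc
  | succ n ih =>
    refine fun c hc => ih _ fun v hv => ?_
    rcases (testBit_floodStep E N c v).1 hv with h | ⟨h1, h2, h3⟩ | ⟨h2, h3⟩ | ⟨h1, h2, h3⟩ | ⟨h2, h3⟩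
    · exact hc v h
    · have := (hE _ h3).1 (hc _ h2)
      rwa [Nat.sub_add_cancel h1] at this
    · exact (hE _ h3).2 (hc _ h2)
    · have := (hN _ h3).1 (hc _ h2)
      rwa [Nat.sub_add_cancel h1] at this
    · exact (hN _ h3).2 (hc _ h2)

theorem flood_mono {E N E' N' : ℕ} (hE : ∀ v, E.testBit v = true → E'.testBit v = true)
    (hN : ∀ v, N.testBit v = true → N'.testBit v = true) (n : ℕ) :
    ∀ c c' : ℕ, (∀ v, c.testBit v = true → c'.testBit v = true) →
      ∀ v, (flood E N n c).testBit v = true → (flood E' N' n c').testBit v = true := by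
  induction n with
  | zero => exact fun c c' hc => hc
  | succ n ih =>
    refine fun c c' hc => ih _ _ fun v hv => ?_
    rw [testBit_floodStep] at hv ⊢
    rcases hv with h | ⟨h1, h2, h3⟩ | ⟨h2, h3⟩ | ⟨h1, h2, h3⟩ | ⟨h2, h3⟩
    · exact .inl (hc v h)
    · exact .inr (.inl ⟨h1, hc _ h2, hE _ h3⟩)
    · exact .inr (.inr (.inl ⟨hc _ h2, hE _ h3⟩))
    · exact .inr (.inr (.inr (.inl ⟨h1, hc _ h2, hN _ h3⟩)))
    · exact .inr (.inr (.inr (.inr ⟨hc _ h2, hN _ h3⟩)))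

theorem bitCount_eq (n c : ℕ) :
    bitCount n c = ((Finset.range n).filter fun v => c.testBit v = true).card := by
  induction n generalizing c with
  | zero => rfl
  | succ n ih =>
    have h : bitCount (n + 1) c = c % 2 + bitCount n (c >>> 1) := rfl
    rw [h, ih, Finset.range_eq_Ico (a := n + 1), ← Finset.insert_Ico_add_one_left_eq_Ico (Nat.succ_pos n),
      Finset.filter_insert]
    have h2 : ((Finset.Ico (0 + 1) (n + 1)).filter fun v => c.testBit v = true) =
        ((Finset.range n).filter fun v => (c >>> 1).testBit v = true).map
          ⟨fun v => v + 1, add_left_injective 1⟩ := by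
      ext v
      simp only [Finset.mem_filter, Finset.mem_Ico, Finset.mem_map, Finset.mem_range,
        Function.Embedding.coeFn_mk, Nat.testBit_shiftRight]
      constructor
      · rintro ⟨⟨h1, h2⟩, h3⟩
        exact ⟨v - 1, ⟨by omega, by rwa [Nat.add_sub_cancel' h1]⟩, by omega⟩
      · rintro ⟨u, ⟨h1, h2⟩, rfl⟩
        exact ⟨by omega, by rwa [add_comm] at h2⟩
    rw [h2]
    have h3 := Nat.mod_two_eq_zero_or_one c
    have h4 : c.testBit 0 = decide (c % 2 = 1) := Nat.testBit_zero c
    rcases h3 with h3 | h3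
    · simp [h4, h3]
    · rw [if_pos (by simp [h4, h3]), Finset.card_insert_of_notMem (by simp), Finset.card_map, h3,
        add_comm]

theorem bitCount_mono {c c' : ℕ} (h : ∀ v, c.testBit v = true → c'.testBit v = true) (n : ℕ) :
    bitCount n c ≤ bitCount n c' := by
  rw [bitCount_eq, bitCount_eq]
  exact Finset.card_le_card fun v hv => by
    rw [Finset.mem_filter] at hv ⊢
    exact ⟨hv.1, h v hv.2⟩

/-- With fewer closed edges the flood fill reaches at least as many vertices. -/
theorem inMajority_anti {s s' : ℕ} (h : ∀ e, s.testBit e = true → s'.testBit e = true) {v : ℕ}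
    (hv : inMajority s' v = true) : inMajority s v = true := by
  refine Nat.ble_eq_true_of_le ((Nat.le_of_ble_eq_true hv).trans
    (bitCount_mono (flood_mono ?_ ?_ _ _ _ fun _ => id) _))
  · intro v hv
    change (((63 ^^^ (s' >>> 6)) &&& 3) ||| (((63 ^^^ (s' >>> 6)) &&& 12) <<< 1) |||
      (((63 ^^^ (s' >>> 6)) &&& 48) <<< 2)).testBit v = true at hv
    change (((63 ^^^ (s >>> 6)) &&& 3) ||| (((63 ^^^ (s >>> 6)) &&& 12) <<< 1) |||
      (((63 ^^^ (s >>> 6)) &&& 48) <<< 2)).testBit v = true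
    have key : ∀ j m, m = 3 ∨ m = 12 ∨ m = 48 → (63 ^^^ (s' >>> 6)).testBit j = true ∧ m.testBit j = true →
        (63 ^^^ (s >>> 6)).testBit j = true ∧ m.testBit j = true := by
      rintro j m hm ⟨hj, hm'⟩
      refine ⟨?_, hm'⟩
      have h63 : (63 : ℕ) = 2 ^ 6 - 1 := rfl
      have hj6 : j < 6 := by
        by_contra hc
        rw [Nat.testBit_lt_two_pow (lt_of_lt_of_le (b := 2 ^ 6) (by rcases hm with rfl | rfl | rfl <;> norm_num)
          (Nat.pow_le_pow_right two_pos (not_lt.1 hc)))] at hm'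
        cases hm'
      rw [h63, Nat.testBit_xor, Nat.testBit_two_pow_sub_one, Nat.testBit_shiftRight] at hj ⊢
      have := h (6 + j)
      simp only [hj6, decide_true, Bool.true_bne, Bool.not_eq_true', ← Bool.not_eq_true] at hj ⊢
      exact fun h' => hj (this h')
    simp only [Nat.testBit_or, Nat.testBit_and, Nat.testBit_shiftLeft, Bool.or_eq_true,
      Bool.and_eq_true, decide_eq_true_eq] at hv ⊢
    rcases hv with (hv | ⟨h1, hv⟩) | ⟨h1, hv⟩
    · exact .inl (.inl (key _ _ (by simp) hv))
    · exact .inl (.inr ⟨h1, key _ _ (by simp) hv⟩)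
    · exact .inr ⟨h1, key _ _ (by simp) hv⟩
  · intro v hv
    obtain ⟨h1, h2⟩ := testBit_openUp hv
    have h63 : (63 : ℕ) = 2 ^ 6 - 1 := rfl
    change (63 ^^^ (s &&& 63)).testBit v = true
    rw [h63, Nat.testBit_xor, Nat.testBit_and, Nat.testBit_two_pow_sub_one]
    have : s.testBit v = false := by
      by_contra hc
      rw [h v (by simpa using hc)] at h2
      cases h2
    simp [this, h1]

theorem testBit_pattern (s i : ℕ) : (pattern s).testBit i = true ↔
    i < 3 ∧ inMajority s (3 * i + 2) = true := by
  have h : pattern s = (inMajority s 2).toNat + (2 * (inMajority s 5).toNat +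
    4 * (inMajority s 8).toNat) := rfl
  rw [h]
  rcases lt_or_ge i 3 with hi | hi
  · interval_cases i <;> cases inMajority s 2 <;> cases inMajority s 5 <;> cases inMajority s 8 <;>
      simp +decide
  · rw [Nat.testBit_lt_two_pow]
    · simp [hi]
    · refine lt_of_lt_of_le (b := 2 ^ 3) ?_ (Nat.pow_le_pow_right two_pos hi)
      cases inMajority s 2 <;> cases inMajority s 5 <;> cases inMajority s 8 <;> simp

theorem testBit_patternAt {s : ℕ} (hs : s < 4096) (i : ℕ) : (patternAt s).testBit i = true ↔
    i < 3 ∧ inMajority s (3 * i + 2) = true := by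
  rw [← pattern_eq hs, testBit_pattern]

theorem isSeparated_eq_true_iff {σ : ℕ} (hσ : σ < 8) (τ l : ℕ) : isSeparated σ τ l = true ↔
    ∀ i < 3, σ.testBit i = true → τ.testBit i = true → l.testBit i = true := by
  have h7 : (7 : ℕ) = 2 ^ 3 - 1 := rfl
  have h : isSeparated σ τ l = true ↔ (σ &&& τ) &&& (7 ^^^ l) = 0 :=
    iff_of_eq Nat.beq_eq
  rw [h, h7, Nat.eq_iff_testBit_eq]
  simp only [Nat.testBit_and, Nat.testBit_xor, Nat.testBit_two_pow_sub_one, Nat.zero_testBit]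
  refine forall_congr' fun i => ?_
  rcases lt_or_ge i 3 with hi | hi
  · cases σ.testBit i <;> cases τ.testBit i <;> cases l.testBit i <;> simp [hi]
  · rw [Nat.testBit_lt_two_pow (lt_of_lt_of_le (b := 2 ^ 3) hσ (Nat.pow_le_pow_right two_pos hi))]
    simp [not_lt.2 hi]

/-- A larger set of closed edges does not create connections. -/
theorem isSeparated_mono {a a' b b' l l' : ℕ} (ha : a' < 4096) (hb : b' < 4096)
    (haa : ∀ e, a.testBit e = true → a'.testBit e = true)
    (hbb : ∀ e, b.testBit e = true → b'.testBit e = true)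
    (hll : ∀ e, l.testBit e = true → l'.testBit e = true)
    (h : isSeparated (patternAt a) (patternAt b) l = true) :
    isSeparated (patternAt a') (patternAt b') l' = true := by
  have hlt : ∀ {s s' : ℕ}, s' < 4096 → (∀ e, s.testBit e = true → s'.testBit e = true) → s < 4096 :=
    fun {s s'} hs' hss => lt_of_le_of_lt (Nat.le_of_testBit hss) hs'
  rw [isSeparated_eq_true_iff (patternAt_lt _)] at h ⊢
  intro i hi h1 h2
  rw [testBit_patternAt ha] at h1
  rw [testBit_patternAt hb] at h2
  exact hll i (h i hi ((testBit_patternAt (hlt ha haa) i).2 ⟨hi, inMajority_anti haa h1.2⟩)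
    ((testBit_patternAt (hlt hb hbb) i).2 ⟨hi, inMajority_anti hbb h2.2⟩))

/-- If the edges outside of `s` are open, the vertices in the majority component of the pattern are
connected to a majority of the vertices of the block. -/
theorem five_le_ncard_of_inMajority {V : Type*} {H : SimpleGraph V} {A : Set V} (hA : A.Finite)
    {pos : ℕ → V} (hpos : ∀ k < 9, pos k ∈ A)
    (hinj : ∀ k < 9, ∀ k' < 9, pos k = pos k' → k = k') {s : ℕ}
    (hs : ∀ e < 12, s.testBit e = false → H.Adj (pos (edgeEnds e).1) (pos (edgeEnds e).2))
    {v : ℕ} (hv : v < 9) (h : inMajority s v = true) :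
    5 ≤ {y | ConnIn H A (pos v) y}.ncard := by
  have h9 : ∀ e < 12, (edgeEnds e).1 < 9 ∧ (edgeEnds e).2 < 9 := by decide
  have hconn : ∀ e < 12, s.testBit e = false →
      (((edgeEnds e).1 < 9 ∧ ConnIn H A (pos v) (pos (edgeEnds e).1)) ↔
        ((edgeEnds e).2 < 9 ∧ ConnIn H A (pos v) (pos (edgeEnds e).2))) := by
    intro e he hse
    obtain ⟨h1, h2⟩ := h9 e he
    have hc := ConnIn.of_adj (hs e he hse) (hpos _ h1) (hpos _ h2)
    exact ⟨fun h => ⟨h2, h.2.trans hc⟩, fun h => ⟨h1, h.2.trans hc.symm⟩⟩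
  have hfl := flood_induction (E := openRight s) (N := openUp s)
    (p := fun k => k < 9 ∧ ConnIn H A (pos v) (pos k)) (fun k hk => by
      obtain ⟨e, he, hee, hse⟩ := testBit_openRight hk
      have := hconn e he hse
      rwa [hee] at this) (fun k hk => by
      obtain ⟨hk6, hse⟩ := testBit_openUp hk
      have := hconn k (by omega) hse
      rwa [edgeEnds, if_pos hk6] at this) 8 (2 ^ v) (fun k hk => by
      rw [Nat.testBit_two_pow] at hk
      obtain rfl : v = k := by simpa using hk
      exact ⟨hv, .refl (hpos v hv)⟩)
  have h5 : 5 ≤ bitCount 9 (flood (openRight s) (openUp s) 8 (2 ^ v)) := Nat.le_of_ble_eq_true h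
  rw [bitCount_eq] at h5
  set F := (Finset.range 9).filter fun k =>
    (flood (openRight s) (openUp s) 8 (2 ^ v)).testBit k = true with hF
  have h6 : (pos '' F).ncard = F.card := by
    rw [Set.InjOn.ncard_image, Set.ncard_coe_finset]
    intro k hk k' hk' hkk
    exact hinj k (Finset.mem_range.1 (Finset.mem_filter.1 hk).1) k'
      (Finset.mem_range.1 (Finset.mem_filter.1 hk').1) hkk
  rw [← h6] at h5
  refine h5.trans (Set.ncard_le_ncard ?_ (hA.subset fun y hy => hy.mem_right))
  rintro _ ⟨k, hk, rfl⟩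
  exact (hfl k (Finset.mem_filter.1 hk).2).2

/-! ### Pairs of adjacent blocks -/

open scoped Classical in
/-- A vertex of the block `v` that is in the relation `r` with at least five vertices, if there is
one. -/
noncomputable def majorityVertex (r : ℤ × ℤ → ℤ × ℤ → Prop) (v : ℤ × ℤ) : ℤ × ℤ :=
  if h : ∃ x ∈ block 3 v, 5 ≤ {y | r x y}.ncard then h.choose else (3 * v.1, 3 * v.2)

/-- The representative of the block `v`: a vertex that is joined inside the block to a majority of
its vertices, if there is one. -/
noncomputable def blockCentre (ω : BondConfig squareLattice) (v : ℤ × ℤ) : ℤ × ℤ :=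
  majorityVertex (ConnIn (openSubgraph squareLattice ω) (block 3 v)) v

theorem blockCentre_mem (ω : BondConfig squareLattice) (v : ℤ × ℤ) :
    blockCentre ω v ∈ block 3 v := by
  rw [blockCentre, majorityVertex]
  split
  · next h => exact h.choose_spec.1
  · rw [mem_block_iff (by norm_num)]
    simp

/-- `majorityVertex` chooses from the connection relation alone, so configurations that agree inside
the block, and therefore have the same relation, get the same choice. -/
theorem dependsOn_blockCentre (v : ℤ × ℤ) :
    DependsOn (fun ω => blockCentre ω v) (edgesIn squareLattice (block 3 v)) := by
  intro ω ω' h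
  have : ConnIn (openSubgraph squareLattice ω) (block 3 v) =
      ConnIn (openSubgraph squareLattice ω') (block 3 v) := by
    funext x y
    exact dependsOn_connIn _ x y h
  simp only [blockCentre, this]

theorem ncard_block (v : ℤ × ℤ) : (block 3 v).ncard = 9 := by
  have : block 3 v = (Finset.Ico (3 * v.1) (3 * v.1 + 3) ×ˢ Finset.Ico (3 * v.2) (3 * v.2 + 3) :
      Finset (ℤ × ℤ)) := by
    ext w
    rw [mem_block_iff (by norm_num)]
    simp
  rw [this, Set.ncard_coe_finset, Finset.card_product, Int.card_Ico, Int.card_Ico]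
  simp

/-- Two majorities of the same block meet. -/
theorem connIn_blockCentre {ω : BondConfig squareLattice} {v x : ℤ × ℤ}
    (h : 5 ≤ {y | ConnIn (openSubgraph squareLattice ω) (block 3 v) x y}.ncard) :
    ConnIn (openSubgraph squareLattice ω) (block 3 v) (blockCentre ω v) x := by
  have hx : x ∈ block 3 v := by
    obtain ⟨y, hy⟩ := Set.nonempty_of_ncard_ne_zero (by omega :
      {y | ConnIn (openSubgraph squareLattice ω) (block 3 v) x y}.ncard ≠ 0)
    exact hy.mem_left
  have hex : ∃ x ∈ block 3 v,
      5 ≤ {y | ConnIn (openSubgraph squareLattice ω) (block 3 v) x y}.ncard := ⟨x, hx, h⟩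
  have h' := hex.choose_spec.2
  have hc : blockCentre ω v = hex.choose := by rw [blockCentre, majorityVertex, dif_pos hex]
  rw [← hc] at h'
  have hfin := block_finite (by norm_num : 0 < 3) v
  have hsub : ∀ z, {y | ConnIn (openSubgraph squareLattice ω) (block 3 v) z y} ⊆ block 3 v :=
    fun z y hy => hy.mem_right
  -- Two disjoint components with at least five vertices each do not fit into nine.
  by_contra hn
  have hd : Disjoint {y | ConnIn (openSubgraph squareLattice ω) (block 3 v) x y}
      {y | ConnIn (openSubgraph squareLattice ω) (block 3 v) (blockCentre ω v) y} := by
    rw [Set.disjoint_left]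
    exact fun y hy hy' => hn (hy'.trans hy.symm)
  have h1 := Set.ncard_union_eq hd (hfin.subset (hsub _)) (hfin.subset (hsub _))
  have h2 := Set.ncard_le_ncard (Set.union_subset (hsub x) (hsub (blockCentre ω v))) hfin
  rw [ncard_block] at h2
  omega

/-- The numbers of the vertices of the edges of a window, which consists of a block, with vertices
`k < 9`, its mirror image, with vertices `9 ≤ k`, and the three links between them. -/
def windowEnds (e : Fin 27) : ℕ × ℕ :=
  if e.1 < 12 then edgeEnds e else
    if e.1 < 15 then (3 * (e - 12) + 2, 3 * (e - 12) + 11) else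
      ((edgeEnds (e - 15)).1 + 9, (edgeEnds (e - 15)).2 + 9)

/-- The coordinates of the vertices of a window. -/
def windowCoord (k : ℕ) : ℕ × ℕ := if k < 9 then (k % 3, k / 3) else (5 - k % 3, (k - 9) / 3)

/-- The neighbour of `v` in one of two directions. -/
def nextTo (up : Bool) (v : ℤ × ℤ) : ℤ × ℤ := if up then (v.1, v.2 + 1) else (v.1 + 1, v.2)

/-- The vertices of the window formed by the blocks `v` and `nextTo up v`. -/
def windowPos (up : Bool) (v : ℤ × ℤ) (k : ℕ) : ℤ × ℤ :=
  if up then (3 * v.1 + (windowCoord k).2, 3 * v.2 + (windowCoord k).1)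
  else (3 * v.1 + (windowCoord k).1, 3 * v.2 + (windowCoord k).2)

theorem windowPos_injective {up : Bool} {v : ℤ × ℤ} : ∀ k < 18, ∀ k' < 18,
    windowPos up v k = windowPos up v k' → k = k' := by
  have h : ∀ k < 18, ∀ k' < 18, windowCoord k = windowCoord k' → k = k' := by decide +kernel
  intro k hk k' hk' hkk
  refine h k hk k' hk' ?_
  cases up <;> simp [windowPos] at hkk <;> exact Prod.ext (by omega) (by omega)

theorem windowPos_mem {up : Bool} {v : ℤ × ℤ} {k : ℕ} (hk : k < 9) :
    windowPos up v k ∈ block 3 v := by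
  have h : ∀ k < 9, (windowCoord k).1 < 3 ∧ (windowCoord k).2 < 3 := by decide +kernel
  have := h k hk
  rw [mem_block_iff (by norm_num)]
  cases up <;> simp [windowPos] <;> omega

theorem windowPos_add_mem {up : Bool} {v : ℤ × ℤ} {k : ℕ} (hk : k < 9) :
    windowPos up v (k + 9) ∈ block 3 (nextTo up v) := by
  have h : ∀ k < 9, 3 ≤ (windowCoord (k + 9)).1 ∧ (windowCoord (k + 9)).1 < 6 ∧
    (windowCoord (k + 9)).2 < 3 := by decide +kernel
  have := h k hk
  rw [mem_block_iff (by norm_num)]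
  cases up <;> simp [windowPos, nextTo] <;> omega

theorem windowEnds_lt (e : Fin 27) : (windowEnds e).1 < 18 ∧ (windowEnds e).2 < 18 := by
  revert e
  decide +kernel

theorem windowPos_adj (up : Bool) (v : ℤ × ℤ) (e : Fin 27) :
    squareLattice.Adj (windowPos up v (windowEnds e).1) (windowPos up v (windowEnds e).2) := by
  have h : ∀ e : Fin 27, |((windowCoord (windowEnds e).1).1 : ℤ) - (windowCoord (windowEnds e).2).1| +
      |((windowCoord (windowEnds e).1).2 : ℤ) - (windowCoord (windowEnds e).2).2| = 1 := by
    decide +kernel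
  have := h e
  cases up
  · simpa [squareLattice, windowPos] using this
  · simpa [squareLattice, windowPos, add_comm] using this

/-- The edges of a window. -/
def windowEdge (up : Bool) (v : ℤ × ℤ) (e : Fin 27) : squareLattice.edgeSet :=
  ⟨s(windowPos up v (windowEnds e).1, windowPos up v (windowEnds e).2), windowPos_adj up v e⟩

/-- The edges `e` and `f` of a window have no common vertex. -/
def AreFar (e f : Fin 27) : Prop :=
  ((windowEnds e).1 ≠ (windowEnds f).1 ∧ (windowEnds e).1 ≠ (windowEnds f).2) ∧
    (windowEnds e).2 ≠ (windowEnds f).1 ∧ (windowEnds e).2 ≠ (windowEnds f).2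

instance (e f : Fin 27) : Decidable (AreFar e f) := by
  unfold AreFar
  infer_instance

theorem AreFar.windowEdge {up : Bool} {v : ℤ × ℤ} {e f : Fin 27} (h : AreFar e f) (x : ℤ × ℤ)
    (hx : x ∈ (windowEdge up v e : Sym2 (ℤ × ℤ))) : x ∉ (windowEdge up v f : Sym2 (ℤ × ℤ)) := by
  intro hx'
  have h1 := windowEnds_lt e
  have h2 := windowEnds_lt f
  rcases Sym2.mem_iff.1 hx with rfl | rfl <;> rcases Sym2.mem_iff.1 hx' with hx' | hx'
  · exact h.1.1 (windowPos_injective _ h1.1 _ h2.1 hx')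
  · exact h.1.2 (windowPos_injective _ h1.1 _ h2.2 hx')
  · exact h.2.1 (windowPos_injective _ h1.2 _ h2.1 hx')
  · exact h.2.2 (windowPos_injective _ h1.2 _ h2.2 hx')

/-- The set of closed edges of a window. -/
def windowClosed (up : Bool) (v : ℤ × ℤ) (ω : BondConfig squareLattice) (e : Fin 27) : Bool :=
  !ω (windowEdge up v e)

/-- The numbers in a window of the edges of one of the two blocks and the links. -/
def sideEdge (side : Bool) (k : Fin 15) : Fin 27 :=
  if h : side = true ∧ k.1 < 12 then ⟨k + 15, by omega⟩ else ⟨k, by omega⟩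

/-- The code of the set of closed edges of one of the two blocks and the links. -/
def sideCode (side : Bool) (S : Fin 27 → Bool) : ℕ := Nat.ofBits fun k : Fin 15 => S (sideEdge side k)

theorem sideCode_lt (side : Bool) (S : Fin 27 → Bool) : sideCode side S < 2 ^ 15 :=
  Nat.ofBits_lt_two_pow _

theorem testBit_sideCode (side : Bool) (S : Fin 27 → Bool) (k : Fin 15) :
    (sideCode side S).testBit k = S (sideEdge side k) := by
  rw [sideCode, Nat.testBit_ofBits_lt _ _ k.2]

theorem sideCode_div (side : Bool) (S : Fin 27 → Bool) :
    sideCode side S / 4096 = sideCode false S / 4096 := by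
  have h : (4096 : ℕ) = 2 ^ 12 := by norm_num
  refine Nat.eq_of_testBit_eq fun i => ?_
  rw [h, Nat.testBit_div_two_pow, Nat.testBit_div_two_pow]
  rcases lt_or_ge i 3 with hi | hi
  · have h1 := testBit_sideCode side S ⟨i + 12, by omega⟩
    have h2 := testBit_sideCode false S ⟨i + 12, by omega⟩
    simp only at h1 h2
    rw [h1, h2]
    simp [sideEdge]
  · rw [sideCode, sideCode, Nat.testBit_ofBits_ge _ _ (by omega), Nat.testBit_ofBits_ge _ _ (by omega)]

/-- The pattern of one of the two blocks. -/
def sidePattern (side : Bool) (S : Fin 27 → Bool) : ℕ := patternAt (sideCode side S % 4096)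

/-- The two blocks of a window with the set `S` of closed edges are not connected. -/
def WindowBad (S : Fin 27 → Bool) : Prop :=
  isSeparated (sidePattern false S) (sidePattern true S) (sideCode false S / 4096) = true

instance (S : Fin 27 → Bool) : Decidable (WindowBad S) := by
  unfold WindowBad
  infer_instance

/-- Monotonicity is what allows all closing probabilities to be raised to the same value `q`. -/
theorem WindowBad.mono {S S' : Fin 27 → Bool} (h : ∀ i, S i = true → S' i = true)
    (hS : WindowBad S) : WindowBad S' := by
  have hc : ∀ side e, (sideCode side S).testBit e = true → (sideCode side S').testBit e = true := by
    intro side e he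
    have he' : e < 15 := by
      by_contra hc
      rw [sideCode, Nat.testBit_ofBits_ge _ _ (by omega)] at he
      cases he
    rw [testBit_sideCode side S ⟨e, he'⟩] at he
    rw [testBit_sideCode side S' ⟨e, he'⟩]
    exact h _ he
  have h4096 : (4096 : ℕ) = 2 ^ 12 := by norm_num
  have hm : ∀ side e, (sideCode side S % 4096).testBit e = true →
      (sideCode side S' % 4096).testBit e = true := fun side e => by
    rw [h4096, Nat.testBit_mod_two_pow, Nat.testBit_mod_two_pow, Bool.and_eq_true, Bool.and_eq_true]
    exact fun he => ⟨he.1, hc side e he.2⟩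
  refine isSeparated_mono (Nat.mod_lt _ (by norm_num)) (Nat.mod_lt _ (by norm_num)) (hm _) (hm _) ?_ hS
  intro e he
  rw [h4096, Nat.testBit_div_two_pow] at he ⊢
  exact hc _ _ he

theorem windowClosed_eq_false {up : Bool} {v : ℤ × ℤ} {ω : BondConfig squareLattice} {e : Fin 27}
    (h : windowClosed up v ω e = false) : (openSubgraph squareLattice ω).Adj
      (windowPos up v (windowEnds e).1) (windowPos up v (windowEnds e).2) :=
  ⟨windowPos_adj up v e, by simpa [windowClosed, windowEdge] using h⟩

/-- The blocks of a good window are connected. -/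
theorem connIn_of_not_windowBad {up : Bool} {v : ℤ × ℤ} {ω : BondConfig squareLattice}
    (h : ¬ WindowBad (windowClosed up v ω)) :
    ConnIn (openSubgraph squareLattice ω) (block 3 v ∪ block 3 (nextTo up v)) (blockCentre ω v)
      (blockCentre ω (nextTo up v)) := by
  rw [WindowBad, sidePattern, sidePattern, isSeparated_eq_true_iff (patternAt_lt _)] at h
  push Not at h
  obtain ⟨i, hi, h1, h2, h3⟩ := h
  have h4096 : (4096 : ℕ) = 2 ^ 12 := by norm_num
  rw [testBit_patternAt (Nat.mod_lt _ (by norm_num))] at h1 h2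
  have hbit : ∀ side, ∀ e < 12, (sideCode side (windowClosed up v ω) % 4096).testBit e = false →
      ∀ e' : Fin 15, e'.1 = e → windowClosed up v ω (sideEdge side e') = false := by
    rintro side e he hb e' rfl
    rw [h4096, Nat.testBit_mod_two_pow, testBit_sideCode] at hb
    simpa [he] using hb
  -- Some index `i` has an open link whose two ends lie in the majority components of their blocks.
  -- The representatives are joined through this link; other connections inside the two blocks are
  -- not exploited.
  have hA := connIn_blockCentre (five_le_ncard_of_inMajority (H := openSubgraph squareLattice ω)
    (block_finite (by norm_num : 0 < 3) v) (pos := windowPos up v) (fun k hk => windowPos_mem hk)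
    (fun k hk k' hk' => windowPos_injective k (by omega) k' (by omega)) (fun e he hb => by
      have := windowClosed_eq_false (hbit false e he hb ⟨e, by omega⟩ rfl)
      simpa [sideEdge, windowEnds, he] using this) (by omega) h1.2)
  have hB := connIn_blockCentre (five_le_ncard_of_inMajority (H := openSubgraph squareLattice ω)
    (block_finite (by norm_num : 0 < 3) (nextTo up v)) (pos := fun k => windowPos up v (k + 9))
    (fun k hk => windowPos_add_mem hk)
    (fun k hk k' hk' hkk => by
      have := windowPos_injective (k + 9) (by omega) (k' + 9) (by omega) hkk
      omega) (fun e he hb => by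
      have := windowClosed_eq_false (hbit true e he hb ⟨e, by omega⟩ rfl)
      have h12 : ¬ e + 15 < 12 := by omega
      simpa [sideEdge, windowEnds, he, h12] using this) (by omega) h2.2)
  have h4 : windowClosed up v ω (sideEdge false ⟨i + 12, by omega⟩) = false := by
    rw [h4096, Nat.testBit_div_two_pow] at h3
    rw [← testBit_sideCode false (windowClosed up v ω)]
    simpa [add_comm] using h3
  have h5 := windowClosed_eq_false h4
  have hl : (openSubgraph squareLattice ω).Adj (windowPos up v (3 * i + 2))
      (windowPos up v (3 * i + 2 + 9)) := by
    have h6 : i + 12 < 15 := by omega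
    simpa [sideEdge, windowEnds, h6] using h5
  exact (hA.mono Set.subset_union_left).trans
    ((ConnIn.of_adj hl (.inl (windowPos_mem (by omega))) (.inr (windowPos_add_mem (by omega)))).trans
      (hB.symm.mono Set.subset_union_right))

theorem measurable_windowClosed (up : Bool) (v : ℤ × ℤ) : Measurable (windowClosed up v) :=
  measurable_pi_lambda _ fun _ => (measurable_of_finite (fun b : Bool => !b)).comp (measurable_pi_apply _)

/-- The coarse model of the `3 × 3` blocks. -/
theorem IsOneIndepModelGE.isScale {ν : Measure (BondConfig squareLattice)} {q q' : ℝ}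
    (hν : IsOneIndepModelGE squareLattice (1 - q) ν)
    (h : ∀ up v, ∫ ω, (if WindowBad (windowClosed up v ω) then 1 else 0 : ℝ) ∂ν ≤ q') :
    IsScale ν 3 q' (coarsen 3 blockCentre) blockCentre := by
  have := hν.isProbabilityMeasure
  refine isScale_coarsen hν (by norm_num) blockCentre_mem dependsOn_blockCentre ?_
  have key : ∀ up v, ν.real {ω | ¬ ConnIn (openSubgraph squareLattice ω)
      (block 3 v ∪ block 3 (nextTo up v)) (blockCentre ω v) (blockCentre ω (nextTo up v))} ≤ q' := by
    intro up v
    have hm : MeasurableSet {ω | WindowBad (windowClosed up v ω)} :=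
      (measurable_windowClosed up v) (MeasurableSet.of_discrete (s := {S | WindowBad S}))
    refine (measureReal_mono fun ω hω => ?_).trans ((integral_indicator_one hm).symm.le.trans
      (Eq.trans_le ?_ (h up v)))
    · by_contra hc
      exact hω (connIn_of_not_windowBad hc)
    · refine integral_congr_ae (ae_of_all _ fun ω => ?_)
      by_cases hω : WindowBad (windowClosed up v ω) <;> simp [hω]
  have key' : ∀ up v, ν.real {ω | ¬ ConnIn (openSubgraph squareLattice ω)
      (block 3 (nextTo up v) ∪ block 3 v) (blockCentre ω (nextTo up v)) (blockCentre ω v)} ≤ q' := by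
    intro up v
    convert key up v using 5
    rw [Set.union_comm]
    exact ⟨ConnIn.symm, ConnIn.symm⟩
  intro v w hvw
  have hadj : w = nextTo false v ∨ w = nextTo true v ∨ v = nextTo false w ∨ v = nextTo true w := by
    simp only [squareLattice] at hvw
    simp only [nextTo, Prod.ext_iff]
    simp only [Bool.false_eq_true, if_false, if_true]
    rcases abs_cases (v.1 - w.1) with h | h <;> rcases abs_cases (v.2 - w.2) with h' | h' <;> omega
  rcases hadj with rfl | rfl | rfl | rfl
  exacts [key _ _, key _ _, key' _ _, key' _ _]

/-! ### The renormalization step -/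

section Step

variable {ν : Measure (BondConfig squareLattice)} {q : ℝ} {up : Bool} {v : ℤ × ℤ}

theorem not_areFar_self (e : Fin 27) : ¬ AreFar e e := fun h => h.1.1 rfl

theorem indepFun_windowClosed (hν : IsOneIndependent squareLattice ν) (e : Fin 27) :
    IndepFun (fun ω => windowClosed up v ω e)
      (fun ω (i : {i | AreFar e i}) => windowClosed up v ω i) ν := by
  refine hν.indepFun (S₁ := {windowEdge up v e}) (S₂ := windowEdge up v '' {i | AreFar e i}) ?_ ?_ ?_
    (measurable_pi_iff.1 (measurable_windowClosed up v) e)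
    (measurable_pi_lambda _ fun i => measurable_pi_iff.1 (measurable_windowClosed up v) i)
  · rintro _ rfl _ ⟨i, hi, rfl⟩ x hx
    exact hi.windowEdge x hx
  · intro ω ω' h
    simp only [windowClosed, h _ rfl]
  · intro ω ω' h
    funext i
    simp only [windowClosed, h _ ⟨i, i.2, rfl⟩]

theorem prob_windowClosed (hν : IsOneIndepModelGE squareLattice (1 - q) ν) (e : Fin 27) :
    ν.real {ω | windowClosed up v ω e = true} ≤ q := by
  have h : {ω | windowClosed up v ω e = true} = {ω | ω (windowEdge up v e) = false} := by
    ext ω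
    simp [windowClosed]
  rw [h]
  exact hν.prob_closed _

theorem areFar_sideEdge (side : Bool) {e k : Fin 15} (h : (neighbourMask e).testBit k = false) :
    AreFar (sideEdge side e) (sideEdge side k) := by
  have : ∀ side, ∀ e k : Fin 15, (neighbourMask e).testBit k = false →
    AreFar (sideEdge side e) (sideEdge side k) := by decide +kernel
  exact this side e k h

theorem areFar_sideEdge_not (side : Bool) {e k : Fin 15} (he : e.1 < 12) (hk : k.1 < 12) :
    AreFar (sideEdge side e) (sideEdge (!side) k) := by
  have : ∀ side, ∀ e k : Fin 15, e.1 < 12 → k.1 < 12 →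
    AreFar (sideEdge side e) (sideEdge (!side) k) := by decide +kernel
  exact this side e k he hk

theorem dependsOn_sideCode_and (side : Bool) {e : Fin 15} {M : ℕ}
    (hM : M &&& neighbourMask e = 0) :
    DependsOn (fun S => M &&& sideCode side S = M) {i | AreFar (sideEdge side e) i} := by
  intro S S' h
  have : M &&& sideCode side S = M &&& sideCode side S' := by
    refine Nat.eq_of_testBit_eq fun i => ?_
    rw [Nat.testBit_and, Nat.testBit_and]
    rcases lt_or_ge i 15 with hi | hi
    · rw [testBit_sideCode side S ⟨i, hi⟩, testBit_sideCode side S' ⟨i, hi⟩]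
      cases hMi : M.testBit i
      · simp
      · rw [h]
        refine areFar_sideEdge side (k := ⟨i, hi⟩) ?_
        have h2 := congrArg (fun n => n.testBit i) hM
        simpa [hMi] using h2
    · rw [sideCode, sideCode, Nat.testBit_ofBits_ge _ _ hi, Nat.testBit_ofBits_ge _ _ hi]
  simp only [this]

/-- An edge inside one block shares no vertex with an edge inside the other. For a link this fails,
which is why `validEntry` forbids entries with a distinguished link to depend on the pattern. -/
theorem dependsOn_sidePattern (side : Bool) {e : Fin 15} (he : e.1 < 12) :
    DependsOn (sidePattern (!side)) {i | AreFar (sideEdge side e) i} := by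
  intro S S' h
  have h4096 : (4096 : ℕ) = 2 ^ 12 := by norm_num
  have : sideCode (!side) S % 4096 = sideCode (!side) S' % 4096 := by
    refine Nat.eq_of_testBit_eq fun i => ?_
    rw [h4096, Nat.testBit_mod_two_pow, Nat.testBit_mod_two_pow]
    rcases lt_or_ge i 12 with hi | hi
    · rw [testBit_sideCode (!side) S ⟨i, by omega⟩, testBit_sideCode (!side) S' ⟨i, by omega⟩, h]
      exact areFar_sideEdge_not side he hi
    · simp [not_lt.2 hi]
  rw [sidePattern, this, sidePattern]

/-- The entries of a certificate have expectation zero after the modification. -/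
theorem isBalanced_entryVal (hν : IsOneIndepModelGE squareLattice (1 - q) ν) {num den : ℕ}
    (hq : q ≤ num / den) (hnd : num < den) (side : Bool) {c : ℕ} (hc : validEntry c = true) :
    IsBalanced ν (windowClosed up v) ((num : ℝ) / den) fun S =>
      (entryVal num den c (sidePattern (!side) S) (sideCode side S) : ℝ) := by
  have := hν.isProbabilityMeasure
  have hden : (0 : ℝ) < den := by exact_mod_cast (Nat.zero_le _).trans_lt hnd
  rw [validEntry, Bool.and_eq_true, Bool.and_eq_true, Bool.or_eq_true] at hc
  obtain ⟨h1, h2, h3⟩ := hc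
  have he : entryEdge c < 15 := Nat.le_of_ble_eq_true h1
  have hM : entryMono c &&& neighbourMask (entryEdge c) = 0 := Nat.eq_of_beq_eq_true h2
  have hhas : DependsOn (fun S => entryHas c (sidePattern (!side) S))
      {i | AreFar (sideEdge side ⟨entryEdge c, he⟩) i} := by
    -- Either the distinguished edge lies inside the block, or the entry is used for all eight
    -- patterns, so the condition on the pattern is vacuous.
    rcases h3 with h3 | h3
    · intro S S' h
      have := dependsOn_sidePattern side (e := ⟨entryEdge c, he⟩) (Nat.le_of_ble_eq_true h3) h
      simp only [this]
    · have h4 : c % 2 ^ 8 = 2 ^ 8 - 1 := Nat.eq_of_beq_eq_true h3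
      have h5 : ∀ τ < 8, entryHas c τ = true := fun τ hτ => by
        have := congrArg (fun n => n.testBit τ) h4
        simp only [Nat.testBit_mod_two_pow, Nat.testBit_two_pow_sub_one, hτ, decide_true,
          Bool.true_and] at this
        exact this
      intro S S' _
      simp only [sidePattern, h5 _ (patternAt_lt _)]
  have key := (isBalanced_centered (P := ν) (X := windowClosed up v) (q := (num : ℝ) / den)
    (measurable_windowClosed up v) (fun i => (prob_windowClosed hν i).trans hq)
    (by rw [div_lt_one hden]; exact_mod_cast hnd) (not_areFar_self _)
    (indepFun_windowClosed hν.isOneIndependent (sideEdge side ⟨entryEdge c, he⟩))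
    (g := fun S => if entryHas c (sidePattern (!side) S) = true ∧
      entryMono c &&& sideCode side S = entryMono c then 1 else 0) (by
      intro S S' h
      have h6 := hhas h
      have h7 := dependsOn_sideCode_and side (e := ⟨entryEdge c, he⟩) hM h
      simp only at h6 h7
      simp only [h6, h7])).const_mul (entryCoef c * den)
  convert key using 2 with S
  rw [entryVal, ← testBit_sideCode side S ⟨entryEdge c, he⟩]
  split
  · push_cast
    field_simp
  · simp

/-- The polynomials of the certificate, read from both sides of the window, are balanced and
dominate `K` times the bad event up to the constant `c₀`. The window is symmetric under its
reflection, so the same certificate serves for both blocks. -/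
theorem integral_windowBad_le {num den K c₀ off m : ℕ} {cp cn : List ℕ}
    (h : checkCertificate num den K c₀ off m cp cn = true)
    (hν : IsOneIndepModelGE squareLattice (1 - q) ν) (hq : q ≤ num / den) (hnd : num < den)
    (hK : 0 < K) (up : Bool) (v : ℤ × ℤ) :
    ∫ ω, (if WindowBad (windowClosed up v ω) then 1 else 0 : ℝ) ∂ν ≤ c₀ / K := by
  have := hν.isProbabilityMeasure
  have hX := measurable_windowClosed up v
  have hden : (0 : ℝ) < den := by exact_mod_cast (Nat.zero_le _).trans_lt hnd
  have hK' : (0 : ℝ) < K := by exact_mod_cast hK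
  have hcert := h
  rw [checkCertificate, Bool.and_eq_true, Bool.and_eq_true, List.all_eq_true, List.all_eq_true] at h
  have hb : ∀ side, ∀ l : List ℕ, (∀ c ∈ l, validEntry c = true) →
      IsBalanced ν (windowClosed up v) ((num : ℝ) / den) fun S =>
        (entriesVal num den l (sidePattern (!side) S) (sideCode side S) : ℝ) := by
    intro side l hl
    have := isBalanced_list_sum hX (fun c hc => isBalanced_entryVal (up := up) (v := v) hν hq hnd side (hl c hc))
    convert this using 2 with S
    rw [entriesVal, Int.cast_list_sum, List.map_map]
    rfl
  have hbal := (((hb false cp h.1).add hX ((hb false cn h.2.1).const_mul (-1))).add hX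
    ((hb true cp h.1).add hX ((hb true cn h.2.1).const_mul (-1))))
  have hle := integral_le_of_isBalanced (g := fun S => (K : ℝ) * if WindowBad S then 1 else 0)
    (c := (c₀ : ℝ)) hX (fun i => (prob_windowClosed hν i).trans hq)
    (by rw [div_lt_one hden]; exact_mod_cast hnd) hbal ?_ ?_
  · rw [integral_const_mul] at hle
    rwa [le_div_iff₀ hK', mul_comm]
  · intro S S' hS
    refine mul_le_mul_of_nonneg_left ?_ hK'.le
    by_cases h1 : WindowBad S
    · rw [if_pos h1, if_pos (h1.mono hS)]
    · rw [if_neg h1]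
      split <;> norm_num
  · intro S
    have h1 : ∀ side, 4096 * (sideCode false S / 4096) + sideCode side S % 4096 = sideCode side S :=
      fun side => by
        rw [← sideCode_div side]
        exact Nat.div_add_mod _ _
    have h2 := le_of_checkCertificate hcert (a := sideCode false S % 4096)
      (b := sideCode true S % 4096) (l := sideCode false S / 4096) (Nat.mod_lt _ (by norm_num))
      (Nat.mod_lt _ (by norm_num)) (by
        have := sideCode_lt false S
        rw [Nat.div_lt_iff_lt_mul (by norm_num)]
        exact this)
    rw [h1, h1] at h2
    have h3 : ((isSeparated (patternAt (sideCode false S % 4096))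
        (patternAt (sideCode true S % 4096)) (sideCode false S / 4096)).toNat : ℝ) =
        if WindowBad S then 1 else 0 := by
      by_cases hS : WindowBad S
      · rw [if_pos hS]
        rw [WindowBad, sidePattern, sidePattern] at hS
        rw [hS]
        simp
      · rw [if_neg hS]
        rw [WindowBad, sidePattern, sidePattern, Bool.not_eq_true] at hS
        rw [hS]
        simp
    have h4 := (Int.cast_le (R := ℝ)).2 h2
    push_cast at h4
    rw [h3] at h4
    simp only [Bool.not_false, Bool.not_true, sidePattern]
    linarith

end Step

/-! ### The step for small closing probabilities -/

/-- Matchings of a block and its links, with coefficients. -/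
def matchingTerms : List (List (Fin 15) × ℕ) :=
  [([1, 2], 1), ([2, 4], 1), ([2, 3, 4], 1), ([1, 5], 2), ([4, 5], 1), ([5, 6, 8], 1), ([7, 9], 2),
    ([2, 10], 1), ([2, 11], 2), ([7, 8, 11], 2), ([6, 9, 11], 2), ([5, 12], 1), ([7, 13], 1),
    ([11, 13], 1), ([2, 14], 1), ([12, 13, 14], 1)]

/-- The code of a set of edges. -/
def edgeMask : List (Fin 15) → ℕ
  | [] => 0
  | k :: M => Nat.lor (Nat.pow 2 k.1) (edgeMask M)

theorem testBit_edgeMask {M : List (Fin 15)} {k : Fin 15} (h : k ∈ M) :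
    (edgeMask M).testBit k = true := by
  induction M with
  | nil => cases h
  | cons k' M ih =>
    change (2 ^ k'.1 ||| edgeMask M).testBit k = true
    rw [Nat.testBit_or, Bool.or_eq_true]
    rcases List.mem_cons.1 h with rfl | h
    · exact .inl Nat.testBit_two_pow_self
    · exact .inr (ih h)

/-- The lower bounds for the sum of the terms. -/
def matchingBounds : ℕ :=
  0x1000000030000000300000004000000030000000700000004000000040000000000000002000000010000000200000001000000050000000300000002000000000000000100000002000000030000000100000004000000030000000200000000000000010000000100000002000000000000000300000003000000020000000000000001000000010000000300000002000000050000000200000002000000000000000100000000000000020000000100000004000000020000000200000000000000000000000100000003000000010000000300000002000000020000000000000000000000000000000200000000000000020000000200000002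

/-- Pairs of the bounds suffice for bad windows. -/
theorem matching_check : and (checkLanes (matchingTerms.map fun t => (edgeMask t.1, t.2)) []
    matchingBounds 0 0) (allBelow (fun σ => allBelow (fun τ => allBelow (fun l => Nat.ble
      (Nat.mul (isSeparated σ τ l).toNat 2)
      (Nat.add (bound matchingBounds 0 l σ) (bound matchingBounds 0 l τ))) 3 0) 3 0) 3 0) = true := by
  decide +kernel

theorem pairwise_areFar_of_mem_matchingTerms (side : Bool) :
    ∀ t ∈ matchingTerms, (t.1.map (sideEdge side)).Pairwise AreFar := by
  revert side
  decide +kernel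

section Step

variable {ν : Measure (BondConfig squareLattice)} {q : ℝ}

theorem integral_matching_le (hν : IsOneIndepModelGE squareLattice (1 - q) ν) (up : Bool) (v : ℤ × ℤ)
    (side : Bool) {M : List (Fin 15)} (hM : (M.map (sideEdge side)).Pairwise AreFar) :
    ∫ ω, (if edgeMask M &&& sideCode side (windowClosed up v ω) = edgeMask M then 1 else 0 : ℝ) ∂ν ≤
      q ^ M.length := by
  have := hν.isProbabilityMeasure
  have hm : MeasurableSet {ω | edgeMask M &&& sideCode side (windowClosed up v ω) = edgeMask M} :=
    (measurable_windowClosed up v)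
      (MeasurableSet.of_discrete (s := {S | edgeMask M &&& sideCode side S = edgeMask M}))
  have h1 := hν.isOneIndependent.prob_matching_closed hν.prob_closed
    ((M.map (sideEdge side)).map (windowEdge up v)) (List.pairwise_map.2 (hM.imp fun h => h.windowEdge))
  rw [List.length_map, List.length_map] at h1
  refine (Eq.trans ?_ (integral_indicator_one hm)).le.trans
    ((measureReal_mono fun ω hω e he => ?_).trans h1)
  · refine integral_congr_ae (ae_of_all _ fun ω => ?_)
    simp only [Set.indicator_apply, Set.mem_ofPred_eq, Pi.one_apply]
  · obtain ⟨i, hi, rfl⟩ := List.mem_map.1 he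
    obtain ⟨k, hk, rfl⟩ := List.mem_map.1 hi
    have h2 : edgeMask M &&& sideCode side (windowClosed up v ω) = edgeMask M := hω
    have h3 := congrArg (fun n => n.testBit k) h2
    simp only [Nat.testBit_and, testBit_edgeMask hk, Bool.true_and, testBit_sideCode] at h3
    simpa [windowClosed] using h3

theorem integral_matchings_le (hν : IsOneIndepModelGE squareLattice (1 - q) ν) (up : Bool)
    (v : ℤ × ℤ) (side : Bool) {T : List (List (Fin 15) × ℕ)}
    (hT : ∀ t ∈ T, (t.1.map (sideEdge side)).Pairwise AreFar) :
    ∫ ω, (monoEval (T.map fun t => (edgeMask t.1, t.2)) (sideCode side (windowClosed up v ω)) : ℝ) ∂ν ≤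
      (T.map fun t => (t.2 : ℝ) * q ^ t.1.length).sum := by
  have := hν.isProbabilityMeasure
  have hX := measurable_windowClosed up v
  induction T with
  | nil => simp
  | cons t T ih =>
    have h1 : ∀ ω, (monoEval ((t :: T).map fun t => (edgeMask t.1, t.2))
        (sideCode side (windowClosed up v ω)) : ℝ) =
        t.2 * (if edgeMask t.1 &&& sideCode side (windowClosed up v ω) = edgeMask t.1 then 1 else 0) +
          monoEval (T.map fun t => (edgeMask t.1, t.2)) (sideCode side (windowClosed up v ω)) := by
      intro ω
      rw [List.map_cons, monoEval_cons]
      push_cast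
      simp only [mul_ite, mul_one, mul_zero]
    simp only [h1]
    rw [integral_add
      (integrable_comp_bool hX fun S =>
        (t.2 : ℝ) * (if edgeMask t.1 &&& sideCode side S = edgeMask t.1 then 1 else 0))
      (integrable_comp_bool hX fun S =>
        (monoEval (T.map fun t => (edgeMask t.1, t.2)) (sideCode side S) : ℝ)),
      integral_const_mul, List.map_cons, List.sum_cons]
    exact add_le_add (mul_le_mul_of_nonneg_left
      (integral_matching_le hν up v side (hT t (by simp))) (Nat.cast_nonneg _))
      (ih fun t' ht' => hT t' (by simp [ht']))

/-- In a bad window the closed matchings counted from the two sides have total weight at least 2, so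
half this weight dominates the indicator. By 1-independence a matching of `j` edges is closed with
probability at most `q ^ j`. -/
theorem integral_windowBad_le_of_small (hν : IsOneIndepModelGE squareLattice (1 - q) ν)
    (up : Bool) (v : ℤ × ℤ) :
    ∫ ω, (if WindowBad (windowClosed up v ω) then 1 else 0 : ℝ) ∂ν ≤ 14 * q ^ 2 + 7 * q ^ 3 := by
  have := hν.isProbabilityMeasure
  have hX := measurable_windowClosed up v
  have hcheck := matching_check
  rw [Bool.and_eq_true] at hcheck
  set T := matchingTerms.map fun t => (edgeMask t.1, t.2) with hT
  have h1 : ∀ S, (if WindowBad S then 1 else 0 : ℝ) ≤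
      1 / 2 * (monoEval T (sideCode false S) + monoEval T (sideCode true S)) := by
    intro S
    have hl : sideCode false S / 4096 < 8 := by
      have := sideCode_lt false S
      rw [Nat.div_lt_iff_lt_mul (by norm_num)]
      exact this
    have h2 : ∀ side, bound matchingBounds 0 (sideCode false S / 4096) (sidePattern side S) ≤
        monoEval T (sideCode side S) := fun side => by
      have h3 := of_checkLanes hcheck.1 (s := sideCode side S % 4096)
        (Nat.mod_lt _ (by norm_num)) hl
      rw [← sideCode_div side, Nat.div_add_mod, monoEval_nil, zero_add, add_zero] at h3
      rw [← sideCode_div side]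
      exact h3
    have h4 := Nat.le_of_ble_eq_true (of_allBelow (of_allBelow (of_allBelow hcheck.2
      (sidePattern false S) (Nat.zero_le _) (by rw [zero_add]; exact patternAt_lt _)) (sidePattern true S)
      (Nat.zero_le _) (by rw [zero_add]; exact patternAt_lt _)) _ (Nat.zero_le _) (by simpa using hl))
    simp only [Nat.add_eq, Nat.mul_eq] at h4
    have h5 := h4.trans (Nat.add_le_add (h2 false) (h2 true))
    split
    · next hS =>
      rw [WindowBad] at hS
      rw [hS] at h5
      have h6 : ((2 : ℕ) : ℝ) ≤ ((monoEval T (sideCode false S) + monoEval T (sideCode true S) : ℕ) : ℝ) :=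
        Nat.cast_le.2 (by rwa [Bool.toNat_true, one_mul] at h5)
      push_cast at h6
      linarith
    · exact mul_nonneg (by norm_num) (add_nonneg (Nat.cast_nonneg _) (Nat.cast_nonneg _))
  refine (integral_mono (integrable_comp_bool hX fun S => if WindowBad S then (1 : ℝ) else 0)
    (integrable_comp_bool hX fun S =>
      1 / 2 * ((monoEval T (sideCode false S) : ℝ) + monoEval T (sideCode true S)))
    fun ω => h1 (windowClosed up v ω)).trans ?_
  rw [integral_const_mul, integral_add
    (integrable_comp_bool hX fun S => (monoEval T (sideCode false S) : ℝ))
    (integrable_comp_bool hX fun S => (monoEval T (sideCode true S) : ℝ))]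
  have h2 := fun side => integral_matchings_le hν up v side (pairwise_areFar_of_mem_matchingTerms side)
  -- The coefficients of the pairs in `matchingTerms` add up to 14 and those of the triples to 7.
  have h3 : (matchingTerms.map fun t => (t.2 : ℝ) * q ^ t.1.length).sum = 14 * q ^ 2 + 7 * q ^ 3 := by
    simp only [matchingTerms, List.map_cons, List.map_nil, List.sum_cons, List.sum_nil,
      List.length_cons, List.length_nil]
    push_cast
    ring
  simp only [h3] at h2
  have h4 := h2 false
  have h5 := h2 true
  linarith

end Step

/-! ### Iteration -/

/-- The model can be viewed as a model on the blocks of side `L` with closing probabilities at most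
`q`. -/
def HasScale (μ : Measure (BondConfig squareLattice)) (L : ℕ) (q : ℝ) : Prop :=
  ∃ Φ R, IsScale μ L q Φ R

section

variable {μ : Measure (BondConfig squareLattice)} {L : ℕ} {q : ℝ}

theorem HasScale.of_checkCertificate {num den K c₀ off m : ℕ} {cp cn : List ℕ} (h : HasScale μ L q)
    (hc : checkCertificate num den K c₀ off m cp cn = true) (hq : q ≤ num / den) (hnd : num < den)
    (hK : 0 < K) : HasScale μ (L * 3) (c₀ / K) := by
  obtain ⟨Φ, R, h⟩ := h
  exact ⟨_, _, h.comp (h.model.isScale (integral_windowBad_le hc h.model hq hnd hK))⟩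

theorem HasScale.succ (h : HasScale μ L q) : HasScale μ (3 * L) (14 * q ^ 2 + 7 * q ^ 3) := by
  obtain ⟨Φ, R, h⟩ := h
  rw [mul_comm]
  exact ⟨_, _, h.comp (h.model.isScale (integral_windowBad_le_of_small h.model))⟩

/-- The bounds for the closing probabilities at the scales `81 * 3 ^ k`. -/
noncomputable def closingBound : ℕ → ℝ
  | 0 => 65 / 1000
  | k + 1 => 14 * closingBound k ^ 2 + 7 * closingBound k ^ 3

/-- For `q ≤ 0.065` the factor `14 * q + 7 * q ^ 2` is at most 0.94, below 19/20, so the decay is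
geometric. -/
theorem closingBound_le (k : ℕ) :
    0 ≤ closingBound k ∧ closingBound k ≤ 65 / 1000 * (19 / 20) ^ k := by
  induction k with
  | zero => norm_num [closingBound]
  | succ k ih =>
    obtain ⟨h0, h1⟩ := ih
    have h2 : ((19 : ℝ) / 20) ^ k ≤ 1 := pow_le_one₀ (by norm_num) (by norm_num)
    have h3 : closingBound k ≤ 65 / 1000 := by linarith
    rw [closingBound, pow_succ ((19 : ℝ) / 20)]
    refine ⟨by positivity, ?_⟩
    have h4 : closingBound k * closingBound k ≤ 65 / 1000 * closingBound k :=
      mul_le_mul_of_nonneg_right h3 h0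
    have h5 : closingBound k * closingBound k * closingBound k ≤
        65 / 1000 * (65 / 1000 * closingBound k) := by
      nlinarith
    have h6 : 14 * closingBound k ^ 2 + 7 * closingBound k ^ 3 =
      14 * (closingBound k * closingBound k) +
        7 * (closingBound k * closingBound k * closingBound k) := by ring
    rw [h6]
    linarith

theorem summable_closingBound : Summable closingBound :=
  Summable.of_nonneg_of_le (fun k => (closingBound_le k).1) (fun k => (closingBound_le k).2)
    ((summable_geometric_of_lt_one (by norm_num) (by norm_num)).mul_left _)

/-- The four certificates account for the initial side 81 = 3⁴; each later scale is one matching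
step. -/
theorem hasScale_closingBound (hμ : IsOneIndepModelGE squareLattice 0.8457 μ) (k : ℕ) :
    HasScale μ (3 ^ k * 81) (closingBound k) := by
  induction k with
  | zero =>
    have h0 : HasScale μ 1 (1543 / 10000) :=
      ⟨_, _, IsScale.refl (by convert hμ using 1; norm_num)⟩
    have h1 := h0.of_checkCertificate certificateOne (by norm_num) (by norm_num) (by norm_num)
    have h2 := h1.of_checkCertificate certificateTwo (by norm_num) (by norm_num) (by norm_num)
    have h3 := h2.of_checkCertificate certificateThree (by norm_num) (by norm_num) (by norm_num)
    have h4 := h3.of_checkCertificate certificateFour (by norm_num) (by norm_num) (by norm_num)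
    have h5 : closingBound 0 = ((260000 : ℕ) : ℝ) / (4000000 : ℕ) := by
      rw [closingBound]
      norm_num
    rw [h5]
    exact h4
  | succ k ih =>
    rw [pow_succ', mul_assoc]
    exact ih.succ

end

theorem mainTheorem10 (μ : Measure (BondConfig squareLattice))
    (hμ : IsOneIndepModelGE squareLattice 0.8457 μ) :
    (∀ C : ℝ, 0 < C →
      Tendsto
        (fun n : ℕ => μ.real {ω | HasLeftRightCrossing (openSubgraph squareLattice ω) (C * n) n})
        atTop (𝓝 1)) ∧
    (∀ᵐ ω ∂μ, ∀ B : Set (ℝ × ℝ), Bornology.IsBounded B →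
      ∃ (v : ℤ × ℤ) (c : (openSubgraph squareLattice ω).Walk v v), c.IsCycle ∧ Encloses c B) ∧
    (∀ᵐ ω ∂μ, ∃! K : (openSubgraph squareLattice ω).ConnectedComponent, K.supp.Infinite) := by
  have := hμ.isProbabilityMeasure
  choose Φ R h using hasScale_closingBound hμ
  have hL : ∀ k, 3 ^ (k + 1) * 81 = 3 * (3 ^ k * 81) := fun k => by ring
  exact ⟨fun C hC => tendsto_prob_crossing h hL summable_closingBound.tendsto_atTop_zero hC,
    ae_exists_cycle h hL summable_closingBound,
    ae_existsUnique_infinite_component h hL summable_closingBound⟩
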